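/- Let $A\to M$ be a (real or complex) vector bundle of rank $n$ over a smooth manifold $M$ of dimension $m$, and suppose that $A$ and its dual $A^*$ are each endowed with a Lie algebroid structure, $(A,[\cdot,\cdot],\rho)$ and $(A^*,[\cdot,\cdot]_*,\rho_*)$. (In the complex case functions, vector fields and forms on $M$ are complex-valued.) Write $[\cdot,\cdot]$ and $[\cdot,\cdot]_*$ also for the Schouten brackets on $\Gamma(\wedge A)$ and $\Gamma(\wedge A^*)$, and let $d:\Gamma(\wedge^kA^*)\to\Gamma(\wedge^{k+1}A^*)$ and $d_*:\Gamma(\wedge^kA)\to\Gamma(\wedge^{k+1}A)$ be the differentials of the Lie algebroids $A$ and $A^*$. For $u\in\Gamma(A)$ put $L_u=[u,\cdot]$ on $\Gamma(\wedge A)$ and $L_u=\iota_ud+d\iota_u$ on $\Gamma(\wedge A^*)$; for $\theta\in\Gamma(A^*)$ put $L_\theta=[\theta,\cdot]_*$ on $\Gamma(\wedge A^*)$ and $L_\theta=\iota_\theta d_*+d_*\iota_\theta$ on $\Gamma(\wedge A)$; and $L_{u+\theta}=L_u+L_\theta$. Put $$u\circ\theta=-\iota_\theta d_*u+L_u\theta,\qquad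 \theta\circ u=-\iota_u d\theta+L_\theta u,$$ which are sections of $A\oplus A^*$. Contractions are normalised by $\iota_{a\wedge b}=\iota_b\iota_a$, and $\langle\cdot,\cdot\rangle$ is the determinant pairing of $\wedge^kA$ with $\wedge^kA^*$, so $\langle\omega,U\rangle=\iota_U\omega$ for $U\in\Gamma(\wedge^kA)$, $\omega\in\Gamma(\wedge^kA^*)$. Let $s\in\Gamma(\wedge^mT^*M)$ be a volume form, let $\Omega\in\Gamma(\wedge^nA^*)$ be nowhere vanishing, and let $V\in\Gamma(\wedge^nA)$ be the section with $\langle\Omega,V\rangle=1$. Let $\Omega^\sharp(X)=\iota_X\Omega$ and $V^\sharp(\xi)=\iota_\xi V$, and define $\partial$ on $\Gamma(\wedge A)$ and $\partial_*$ on $\Gamma(\wedge A^*)$ by $$\Omega^\sharp\partial\beta=(-1)^l\,d\,\Omega^\sharp\beta\quad(\beta\in\Gamma(\wedge^lA)),\qquad V^\sharp\partial_*\alpha=(-1)^k\,d_*V^\sharp\alpha\quad(\alpha\in\Gamma(\wedge^kA^*)).$$ Put $\Delta=d_*\partial+\partial d_*$ on $\Gamma(\wedge A)$ and $\Delta_*=d\partial_*+\partial_*d$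 on $\Gamma(\wedge A^*)$. Let $X_0\in\Gamma(A)$ and $\xi_0\in\Gamma(A^*)$ be the modular cocycles, i.e. the sections such that, for all $\theta\in\Gamma(A^*)$ and $u\in\Gamma(A)$, $$(L_\theta\Omega)\otimes s+\Omega\otimes L_{\rho_*(\theta)}s=\langle X_0,\theta\rangle\,\Omega\otimes s,\qquad (L_{\rho(u)}s)\otimes V+s\otimes L_uV=\langle\xi_0,u\rangle\,s\otimes V.$$ Then the following six assertions are equivalent: 1. $d_*[u,v]=[d_*u,v]+(-1)^{k-1}[u,d_*v]$ for all $u\in\Gamma(\wedge^kA)$, $v\in\Gamma(\wedge^lA)$ and all $k,l$; 2. $d[\theta,\eta]_*=[d\theta,\eta]_*+(-1)^{k-1}[\theta,d\eta]_*$ for all $\theta\in\Gamma(\wedge^kA^*)$, $\eta\in\Gamma(\wedge^lA^*)$ and all $k,l$; 3. $\Delta(u\wedge v)=\Delta u\wedge v+u\wedge\Delta v$ for all $u,v\in\Gamma(\wedge A)$; 4. $\Delta_*(\theta\wedge\eta)=\Delta_*\theta\wedge\eta+\theta\wedge\Delta_*\eta$ for all $\theta,\eta\in\Gamma(\wedge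 A^*)$; 5. $\Delta=\frac12(L_{X_0}+L_{\xi_0})$ on $\Gamma(\wedge A)$; 6. $\Delta_*=\frac12(L_{X_0}+L_{\xi_0})$ on $\Gamma(\wedge A^*)$. They imply the following six assertions, which are equivalent to each other: 7. $\Delta_*\langle\theta,u\rangle=\langle\Delta_*\theta,u\rangle+\langle\theta,\Delta u\rangle$ for all $u\in\Gamma(A)$, $\theta\in\Gamma(A^*)$; 8. $\Delta\langle\theta,u\rangle=\langle\Delta_*\theta,u\rangle+\langle\theta,\Delta u\rangle$ for all $u\in\Gamma(A)$, $\theta\in\Gamma(A^*)$; 9. for all $u\in\Gamma(A)$ and $\theta\in\Gamma(A^*)$, the map $L_{u\circ\theta}-[L_u,L_\theta]:\Gamma(A^*)\to\Gamma(A^*)$ is $C^\infty(M)$-linear and its trace is $2\langle d_*u,d\theta\rangle$; 10. for all $\theta\in\Gamma(A^*)$ and $u\in\Gamma(A)$, the map $L_{\theta\circ u}-[L_\theta,L_u]:\Gamma(A)\to\Gamma(A)$ is $C^\infty(M)$-linear and its trace is $2\langle d\theta,d_*u\rangle$; 11. $\Delta f=\frac12(L_{X_0}+L_{\xi_0})f$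 and $\Delta u=\frac12(L_{X_0}+L_{\xi_0})u$ for all $f\in C^\infty(M)$ and $u\in\Gamma(A)$; 12. $\Delta_*f=\frac12(L_{X_0}+L_{\xi_0})f$ and $\Delta_*\theta=\frac12(L_{X_0}+L_{\xi_0})\theta$ for all $f\in C^\infty(M)$ and $\theta\in\Gamma(A^*)$. -/

import Mathlib

open scoped TensorProduct

noncomputable section

namespace LieAlgebroidPair

section ExteriorDerivations

variable {R L : Type*} [CommRing R] [AddCommGroup L] [Module R L]

/-- The parity automorphism of the exterior algebra: `(-1)^k` on elements of degree `k`. -/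
abbrev parity : ExteriorAlgebra R L →ₐ[R] ExteriorAlgebra R L := CliffordAlgebra.involute

theorem parity_ι (x : L) : parity (ExteriorAlgebra.ι R x) = -ExteriorAlgebra.ι R x :=
  CliffordAlgebra.involute_ι x

theorem ι_mul_eq (x : L) (w : ExteriorAlgebra R L) :
    ExteriorAlgebra.ι R x * w = parity w * ExteriorAlgebra.ι R x := by
  induction w using ExteriorAlgebra.induction with
  | algebraMap r => simpa using (Algebra.commutes r (ExteriorAlgebra.ι R x)).symm
  | ι y =>
    rw [parity_ι, neg_mul]
    exact eq_neg_of_add_eq_zero_left (ExteriorAlgebra.ι_add_mul_swap x y)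
  | mul a b ha hb => rw [map_mul, ← mul_assoc, ha, mul_assoc, hb, mul_assoc]
  | add a b ha hb => rw [mul_add, ha, hb, map_add, add_mul]

theorem even_mul_comm {w : ExteriorAlgebra R L} (hw : parity w = w) (a : ExteriorAlgebra R L) :
    a * w = w * a := by
  induction a using ExteriorAlgebra.induction with
  | algebraMap r => exact Algebra.commutes r w
  | ι y => rw [ι_mul_eq, hw]
  | mul a b ha hb => rw [mul_assoc, hb, ← mul_assoc, ha, mul_assoc]
  | add a b ha hb => rw [mul_add, ← ha, ← hb, add_mul]

theorem odd_mul_comm {w : ExteriorAlgebra R L} (hw : parity w = -w) (a : ExteriorAlgebra R L) :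
    parity a * w = w * a := by
  induction a using ExteriorAlgebra.induction with
  | algebraMap r => simpa using Algebra.commutes r w
  | ι y => rw [parity_ι, neg_mul, ι_mul_eq, hw]; simp
  | mul a b ha hb => rw [map_mul, mul_assoc, hb, ← mul_assoc, ha, mul_assoc]
  | add a b ha hb => rw [mul_add, ← ha, ← hb, map_add, add_mul]

/-- Pairs `(a, b)` with the product `(a, b) (a', b') = (a a', τ a b' + b a')`. -/
@[ext] structure Tw (S : Type*) [Ring S] (τ : S →+* S) where
  fst : S
  snd : S

namespace Tw
variable {S : Type*} [Ring S] {τ : S →+* S}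

instance : Zero (Tw S τ) := ⟨⟨0, 0⟩⟩
instance : One (Tw S τ) := ⟨⟨1, 0⟩⟩
instance : Add (Tw S τ) := ⟨fun a b => ⟨a.fst + b.fst, a.snd + b.snd⟩⟩
instance : Neg (Tw S τ) := ⟨fun a => ⟨-a.fst, -a.snd⟩⟩
instance : Mul (Tw S τ) := ⟨fun a b => ⟨a.fst * b.fst, τ a.fst * b.snd + a.snd * b.fst⟩⟩
@[simp] theorem zero_fst : (0 : Tw S τ).fst = 0 := rfl
@[simp] theorem zero_snd : (0 : Tw S τ).snd = 0 := rfl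
@[simp] theorem one_fst : (1 : Tw S τ).fst = 1 := rfl
@[simp] theorem one_snd : (1 : Tw S τ).snd = 0 := rfl
@[simp] theorem add_fst (a b : Tw S τ) : (a + b).fst = a.fst + b.fst := rfl
@[simp] theorem add_snd (a b : Tw S τ) : (a + b).snd = a.snd + b.snd := rfl
@[simp] theorem neg_fst (a : Tw S τ) : (-a).fst = -a.fst := rfl
@[simp] theorem neg_snd (a : Tw S τ) : (-a).snd = -a.snd := rfl
@[simp] theorem mul_fst (a b : Tw S τ) : (a * b).fst = a.fst * b.fst := rfl
@[simp] theorem mul_snd (a b : Tw S τ) :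
    (a * b).snd = τ a.fst * b.snd + a.snd * b.fst := rfl

instance : Ring (Tw S τ) where
  add_assoc a b c := by ext <;> simp [add_assoc]
  zero_add a := by ext <;> simp
  add_zero a := by ext <;> simp
  add_comm a b := by ext <;> simp [add_comm]
  nsmul := nsmulRec
  zsmul := zsmulRec
  neg_add_cancel a := by ext <;> simp
  mul_assoc a b c := by ext <;> simp [mul_assoc, mul_add, add_mul, add_assoc]
  one_mul a := by ext <;> simp
  mul_one a := by ext <;> simp
  zero_mul a := by ext <;> simp
  mul_zero a := by ext <;> simp
  left_distrib a b c := by ext <;> simp [mul_add, add_add_add_comm]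
  right_distrib a b c := by ext <;> simp [add_mul, add_add_add_comm]
end Tw

/-- Twisted derivations of the exterior algebra exist with prescribed values on generators. -/
theorem exists_twisted_derivation (τ : ExteriorAlgebra R L →ₐ[R] ExteriorAlgebra R L)
    (δ₀ : R →+ ExteriorAlgebra R L) (δ₁ : L →+ ExteriorAlgebra R L)
    (h₀ : ∀ f g, δ₀ (f * g) = f • δ₀ g + g • δ₀ f)
    (h₁ : ∀ (f : R) x, δ₁ (f • x) = f • δ₁ x + δ₀ f * ExteriorAlgebra.ι R x)
    (hc : ∀ f a, τ a * δ₀ f = δ₀ f * a)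
    (hs : ∀ x, τ (ExteriorAlgebra.ι R x) * δ₁ x + δ₁ x * ExteriorAlgebra.ι R x = 0) :
    ∃ D : ExteriorAlgebra R L →+ ExteriorAlgebra R L,
      (∀ f, D (algebraMap R _ f) = δ₀ f) ∧ (∀ x, D (ExteriorAlgebra.ι R x) = δ₁ x) ∧
      ∀ a b, D (a * b) = τ a * D b + D a * b := by
  let T := Tw (ExteriorAlgebra R L) (τ : ExteriorAlgebra R L →+* ExteriorAlgebra R L)
  have h1 : δ₀ 1 = 0 := by simpa using h₀ 1 1
  let φ : R →+* T :=
    { toFun := fun f => ⟨algebraMap R _ f, δ₀ f⟩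
      map_zero' := Tw.ext (map_zero _) (map_zero _)
      map_one' := Tw.ext (map_one _) h1
      map_add' := fun f g => Tw.ext (map_add _ f g) (map_add _ f g)
      map_mul' := fun f g => by
        refine Tw.ext (map_mul _ f g) ?_
        change δ₀ (f * g) = τ (algebraMap R _ f) * δ₀ g + δ₀ f * algebraMap R _ g
        rw [h₀, Algebra.smul_def, Algebra.smul_def, AlgHom.commutes, Algebra.commutes g] }
  let _ : Algebra R T := φ.toAlgebra' fun f a => by
    ext
    · exact Algebra.commutes f a.fst
    · change τ (algebraMap R _ f) * a.snd + δ₀ f * a.fst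
        = τ a.fst * δ₀ f + a.snd * algebraMap R _ f
      rw [hc, AlgHom.commutes, Algebra.commutes, add_comm]
  let ψ : L →ₗ[R] T :=
    { toFun := fun x => ⟨ExteriorAlgebra.ι R x, δ₁ x⟩
      map_add' := fun x y => Tw.ext (map_add _ x y) (map_add _ x y)
      map_smul' := fun f x => by
        rw [RingHom.id_apply, Algebra.smul_def]
        change _ = φ f * _
        ext
        · change ExteriorAlgebra.ι R (f • x) = algebraMap R _ f * ExteriorAlgebra.ι R x
          rw [map_smul, Algebra.smul_def]
        · change δ₁ (f • x) = τ (algebraMap R _ f) * δ₁ x + δ₀ f * ExteriorAlgebra.ι R x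
          rw [AlgHom.commutes, h₁, Algebra.smul_def] }
  let Φ : ExteriorAlgebra R L →ₐ[R] T := ExteriorAlgebra.lift R ⟨ψ, fun x => by
    ext
    · exact ExteriorAlgebra.ι_sq_zero x
    · exact hs x⟩
  have hΦι : ∀ x, Φ (ExteriorAlgebra.ι R x) = ψ x := fun x => ExteriorAlgebra.lift_ι_apply ..
  have hΦa : ∀ f, Φ (algebraMap R _ f) = φ f := fun f => Φ.commutes f
  have hfst : ∀ a, (Φ a).fst = a := fun a => by
    induction a using ExteriorAlgebra.induction with
    | algebraMap r => rw [hΦa]; rfl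
    | ι x => rw [hΦι]; rfl
    | mul a b ha hb => rw [map_mul, Tw.mul_fst, ha, hb]
    | add a b ha hb => rw [map_add, Tw.add_fst, ha, hb]
  refine ⟨{ toFun := fun a => (Φ a).snd, map_zero' := by rw [map_zero]; rfl,
            map_add' := fun a b => by rw [map_add]; rfl }, fun f => ?_, fun x => ?_, fun a b => ?_⟩
  · change (Φ _).snd = _; rw [hΦa]; rfl
  · change (Φ _).snd = _; rw [hΦι]; rfl
  · change (Φ _).snd = τ a * (Φ b).snd + (Φ a).snd * b
    rw [map_mul, Tw.mul_snd, hfst, hfst]; rfl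

theorem twisted_derivation_ext (τ : ExteriorAlgebra R L →ₐ[R] ExteriorAlgebra R L)
    {D D' : ExteriorAlgebra R L →+ ExteriorAlgebra R L}
    (h₀ : ∀ f, D (algebraMap R _ f) = D' (algebraMap R _ f))
    (h₁ : ∀ x, D (ExteriorAlgebra.ι R x) = D' (ExteriorAlgebra.ι R x))
    (h : ∀ a b, D (a * b) = τ a * D b + D a * b)
    (h' : ∀ a b, D' (a * b) = τ a * D' b + D' a * b) : D = D' := by
  ext a
  induction a using ExteriorAlgebra.induction with
  | algebraMap r => exact h₀ r
  | ι x => exact h₁ x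
  | mul a b ha hb => rw [h, h', ha, hb]
  | add a b ha hb => rw [map_add, map_add, ha, hb]

end ExteriorDerivations

section Structures

variable (𝕜 R L : Type*) [Field 𝕜] [CommRing R] [Algebra 𝕜 R] [AddCommGroup L] [Module R L]

/-- A Lie algebroid structure, expressed on the `R`-module `L` of sections, where `R` is the algebra
of smooth functions and `Derivation 𝕜 R R` the module of vector fields. A bundle map into the
tangent bundle is the same as an `R`-linear map on sections. The bracket is automatically
`𝕜`-bilinear, by the Leibniz rule for constant functions. -/
structure LieAlgebroid where
  bracket : L →+ L →+ L
  anchor : L →ₗ[R] Derivation 𝕜 R R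
  bracket_self : ∀ x, bracket x x = 0
  jacobi : ∀ x y z, bracket x (bracket y z) = bracket (bracket x y) z + bracket y (bracket x z)
  anchor_bracket : ∀ x y, anchor (bracket x y) = ⁅anchor x, anchor y⁆
  leibniz : ∀ x (f : R) y, bracket x (f • y) = anchor x f • y + f • bracket x y

end Structures

section Schouten

variable {𝕜 R L : Type*} [Field 𝕜] [CommRing R] [Algebra 𝕜 R] [AddCommGroup L] [Module R L]
variable (𝔞 : LieAlgebroid 𝕜 R L)

theorem LieAlgebroid.bracket_skew (x y : L) : 𝔞.bracket x y = -𝔞.bracket y x := by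
  have h := 𝔞.bracket_self (x + y)
  simp only [map_add, AddMonoidHom.add_apply, 𝔞.bracket_self, zero_add, add_zero] at h
  exact eq_neg_of_add_eq_zero_right h

/-- `Br` is the Schouten bracket: the graded skew-symmetric biderivation of the exterior algebra
(with the degree shifted by one) that extends the bracket and the anchor. -/
structure IsSchouten
    (Br : ExteriorAlgebra R L →+ ExteriorAlgebra R L →+ ExteriorAlgebra R L) : Prop where
  fun_fun : ∀ f g, Br (algebraMap R _ f) (algebraMap R _ g) = 0
  section_fun : ∀ x f, Br (ExteriorAlgebra.ι R x) (algebraMap R _ f) =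
    algebraMap R _ (𝔞.anchor x f)
  section_section : ∀ x y, Br (ExteriorAlgebra.ι R x) (ExteriorAlgebra.ι R y) =
    ExteriorAlgebra.ι R (𝔞.bracket x y)
  skew : ∀ (k l : ℕ), ∀ u ∈ ⋀[R]^k L, ∀ v ∈ ⋀[R]^l L,
    Br u v = -((-1 : R) ^ ((k + 1) * (l + 1)) • Br v u)
  leibniz : ∀ (k l : ℕ), ∀ u ∈ ⋀[R]^k L, ∀ v ∈ ⋀[R]^l L, ∀ w,
    Br u (v * w) = Br u v * w + (-1 : R) ^ ((k + 1) * l) • (v * Br u w)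

/-- The differential of a function, as a linear form on sections. -/
def anchorDual : R →+ Module.Dual R L where
  toFun f :=
    { toFun := fun x => 𝔞.anchor x f
      map_add' := fun x y => by simp
      map_smul' := fun r x => by simp }
  map_zero' := by ext x; simp
  map_add' f g := by ext x; simp

theorem anchorDual_apply (f : R) (x : L) : anchorDual 𝔞 f x = 𝔞.anchor x f := rfl

theorem anchorDual_mul (f g : R) :
    anchorDual 𝔞 (f * g) = f • anchorDual 𝔞 g + g • anchorDual 𝔞 f := by
  ext x; simp [anchorDual_apply]

/-- Contraction of the exterior algebra of `L` with a linear form on `L`. -/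
abbrev contract (φ : Module.Dual R L) : ExteriorAlgebra R L →ₗ[R] ExteriorAlgebra R L :=
  CliffordAlgebra.contractLeft φ

theorem contract_ι (φ : Module.Dual R L) (x : L) :
    contract φ (ExteriorAlgebra.ι R x) = algebraMap R _ (φ x) :=
  CliffordAlgebra.contractLeft_ι _ φ x

theorem contract_algebraMap (φ : Module.Dual R L) (f : R) :
    contract φ (algebraMap R (ExteriorAlgebra R L) f) = 0 :=
  CliffordAlgebra.contractLeft_algebraMap _ φ f

theorem contract_ι_mul (φ : Module.Dual R L) (x : L) (b : ExteriorAlgebra R L) :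
    contract φ (ExteriorAlgebra.ι R x * b) = φ x • b - ExteriorAlgebra.ι R x * contract φ b :=
  CliffordAlgebra.contractLeft_ι_mul φ x b

theorem contract_mul (φ : Module.Dual R L) (a b : ExteriorAlgebra R L) :
    contract φ (a * b) = parity a * contract φ b + contract φ a * b := by
  induction a using ExteriorAlgebra.induction generalizing b with
  | algebraMap r =>
    rw [contract_algebraMap, AlgHom.commutes, zero_mul, add_zero, ← Algebra.smul_def, map_smul,
      Algebra.smul_def]
  | ι x => rw [contract_ι_mul, parity_ι, contract_ι, Algebra.smul_def]; noncomm_ring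
  | mul a a' ha ha' =>
    rw [mul_assoc, ha, ha', ha, map_mul]; noncomm_ring
  | add a a' ha ha' => rw [add_mul, map_add, ha, ha', map_add, map_add]; noncomm_ring

theorem parity_contract (φ : Module.Dual R L) (a : ExteriorAlgebra R L) :
    parity (contract φ a) = -contract φ (parity a) := by
  induction a using ExteriorAlgebra.induction with
  | algebraMap r => simp
  | ι x => rw [contract_ι, parity_ι, map_neg, contract_ι, AlgHom.commutes, neg_neg]
  | mul a b ha hb =>
    rw [contract_mul, map_add, map_mul, map_mul, ha, hb, map_mul, contract_mul,
      CliffordAlgebra.involute_involute]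
    noncomm_ring
  | add a b ha hb => rw [map_add, map_add, ha, hb, map_add, map_add]; abel

theorem parity_of_mem {k : ℕ} {u : ExteriorAlgebra R L} (hu : u ∈ ⋀[R]^k L) :
    parity u = (-1 : R) ^ k • u := by
  induction hu using Submodule.pow_induction_on_left' with
  | algebraMap r => simp
  | add x y i hx hy ihx ihy => rw [map_add, ihx, ihy, smul_add]
  | mem_mul m hm i x hx ih =>
    obtain ⟨y, rfl⟩ := hm
    rw [map_mul, ih, parity_ι, pow_succ]
    simp

/-- The Lie derivative of multisections along a section exists. -/
theorem exists_lie (x : L) : ∃ D : ExteriorAlgebra R L →+ ExteriorAlgebra R L,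
    (∀ f, D (algebraMap R _ f) = algebraMap R _ (𝔞.anchor x f)) ∧
    (∀ y, D (ExteriorAlgebra.ι R y) = ExteriorAlgebra.ι R (𝔞.bracket x y)) ∧
    ∀ a b, D (a * b) = a * D b + D a * b := by
  refine exists_twisted_derivation (AlgHom.id R _)
    ((algebraMap R (ExteriorAlgebra R L)).toAddMonoidHom.comp
      ((𝔞.anchor x : R →ₗ[𝕜] R).toAddMonoidHom))
    ((ExteriorAlgebra.ι R).toAddMonoidHom.comp (𝔞.bracket x)) ?_ ?_ ?_ ?_
  · intro f g
    change algebraMap R _ (𝔞.anchor x (f * g)) =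
      f • algebraMap R _ (𝔞.anchor x g) + g • algebraMap R _ (𝔞.anchor x f)
    simp [Algebra.smul_def]
  · intro f y
    change ExteriorAlgebra.ι R (𝔞.bracket x (f • y)) = f • ExteriorAlgebra.ι R (𝔞.bracket x y) +
      algebraMap R _ (𝔞.anchor x f) * ExteriorAlgebra.ι R y
    rw [𝔞.leibniz, map_add, map_smul, map_smul, ← Algebra.smul_def, add_comm]
  · intro f a
    exact (Algebra.commutes (R := R) (𝔞.anchor x f) a).symm
  · intro y
    exact ExteriorAlgebra.ι_add_mul_swap y (𝔞.bracket x y)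

theorem half_smul_add [CharZero 𝕜] (u : ExteriorAlgebra R L) :
    algebraMap 𝕜 R (1 / 2) • u + algebraMap 𝕜 R (1 / 2) • u = u := by
  rw [← add_smul, ← map_add, show (1 / 2 + 1 / 2 : 𝕜) = 1 by norm_num, map_one, one_smul]

theorem exists_isSchouten [CharZero 𝕜] : ∃ Br, IsSchouten 𝔞 Br := by
  choose Lv Lv0 Lv1 LvD using exists_lie 𝔞
  have Ladd : ∀ x y, Lv (x + y) = Lv x + Lv y := fun x y => by
    refine twisted_derivation_ext (AlgHom.id R _) (fun f => ?_) (fun z => ?_) (LvD _) ?_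
    · simp [Lv0]
    · simp [Lv1]
    · intro a b
      simp only [AddMonoidHom.add_apply, LvD, AlgHom.id_apply]
      noncomm_ring
  have Lsmul : ∀ (f : R) x a, Lv (f • x) a =
      f • Lv x a - ExteriorAlgebra.ι R x * contract (anchorDual 𝔞 f) a := fun f x a => by
    let D' : ExteriorAlgebra R L →+ ExteriorAlgebra R L := AddMonoidHom.mk'
      (fun a => f • Lv x a - ExteriorAlgebra.ι R x * contract (anchorDual 𝔞 f) a)
      (fun a b => by rw [map_add, map_add, smul_add, mul_add]; abel)
    refine DFunLike.congr_fun (show Lv (f • x) = D' from ?_) a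
    refine twisted_derivation_ext (AlgHom.id R _) (fun g => ?_) (fun z => ?_) (LvD _) ?_
    · change _ = f • Lv x _ - ExteriorAlgebra.ι R x * contract (anchorDual 𝔞 f) _
      rw [Lv0, Lv0, contract_algebraMap, Algebra.smul_def, ← map_mul]
      simp
    · change _ = f • Lv x _ - ExteriorAlgebra.ι R x * contract (anchorDual 𝔞 f) _
      rw [Lv1, Lv1, contract_ι, 𝔞.bracket_skew, 𝔞.leibniz, ← Algebra.commutes, ← Algebra.smul_def,
        anchorDual_apply, 𝔞.bracket_skew x z]
      simp only [map_neg, map_add, map_smul, smul_neg]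
      abel
    · intro a b
      change f • Lv x _ - ExteriorAlgebra.ι R x * contract (anchorDual 𝔞 f) _ =
        a * (f • Lv x b - ExteriorAlgebra.ι R x * contract (anchorDual 𝔞 f) b) +
        (f • Lv x a - ExteriorAlgebra.ι R x * contract (anchorDual 𝔞 f) a) * b
      rw [contract_mul, LvD, mul_add, ← mul_assoc _ (parity a), ι_mul_eq x (parity a),
        CliffordAlgebra.involute_involute, smul_add, mul_sub, sub_mul, mul_smul_comm,
        smul_mul_assoc]
      noncomm_ring
  have Lpar : ∀ x a, parity (Lv x a) = Lv x (parity a) := fun x a => by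
    induction a using ExteriorAlgebra.induction with
    | algebraMap r => rw [Lv0, AlgHom.commutes, AlgHom.commutes, Lv0]
    | ι y => rw [Lv1, parity_ι, parity_ι, map_neg, Lv1]
    | mul a b ha hb => rw [LvD, map_add, map_mul, map_mul, ha, hb, map_mul, LvD]
    | add a b ha hb => rw [map_add, map_add, ha, hb, map_add, map_add]
  -- the inner derivation of a multisection of definite parity
  have key : ∀ (τ : ExteriorAlgebra R L →ₐ[R] ExteriorAlgebra R L) (u : ExteriorAlgebra R L),
      ((τ = AlgHom.id R _ ∧ parity u = -u) ∨ (τ = parity ∧ parity u = u)) →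
      ∃ D : ExteriorAlgebra R L →+ ExteriorAlgebra R L,
        (∀ f, D (algebraMap R _ f) = -contract (anchorDual 𝔞 f) (parity u)) ∧
        (∀ y, D (ExteriorAlgebra.ι R y) = -Lv y u) ∧
        ∀ a b, D (a * b) = τ a * D b + D a * b := by
    intro τ u hτ
    refine exists_twisted_derivation τ
      (AddMonoidHom.mk' (fun f => -contract (anchorDual 𝔞 f) (parity u)) fun f g => by
        rw [map_add (anchorDual 𝔞), contract, map_add, LinearMap.add_apply, neg_add])
      (AddMonoidHom.mk' (fun y => -Lv y u) fun x y => by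
        rw [Ladd, AddMonoidHom.add_apply, neg_add]) ?_ ?_ ?_ ?_
    · intro f g
      simp only [AddMonoidHom.mk'_apply, anchorDual_mul, map_add, map_smul, LinearMap.add_apply,
        LinearMap.smul_apply, smul_neg]
      abel
    · intro f y
      simp only [AddMonoidHom.mk'_apply]
      rw [Lsmul, ι_mul_eq, parity_contract, smul_neg]
      abel
    · intro f a
      simp only [AddMonoidHom.mk'_apply]
      rcases hτ with ⟨rfl, hu⟩ | ⟨rfl, hu⟩
      · refine even_mul_comm ?_ a
        rw [map_neg, parity_contract, hu, map_neg parity, hu, neg_neg, map_neg]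
      · refine odd_mul_comm ?_ a
        rw [map_neg, parity_contract, hu, hu]
    · intro y
      simp only [AddMonoidHom.mk'_apply]
      rcases hτ with ⟨rfl, hu⟩ | ⟨rfl, hu⟩
      · rw [AlgHom.id_apply, ι_mul_eq, map_neg, Lpar, hu, map_neg]
        noncomm_ring
      · rw [parity_ι, neg_mul, ι_mul_eq, map_neg, Lpar, hu]
        noncomm_ring
  have keyO := fun (u : ExteriorAlgebra R L) (hu : parity u = -u) => key _ u (Or.inl ⟨rfl, hu⟩)
  have keyE := fun (u : ExteriorAlgebra R L) (hu : parity u = u) => key _ u (Or.inr ⟨rfl, hu⟩)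
  choose adO adO0 adO1 adOD using keyO
  choose adE adE0 adE1 adED using keyE
  let h : R := algebraMap 𝕜 R (1 / 2)
  have hO : ∀ u : ExteriorAlgebra R L, parity (h • u - h • parity u) = -(h • u - h • parity u) :=
    fun u => by rw [map_sub, map_smul, map_smul, CliffordAlgebra.involute_involute]; abel
  have hE : ∀ u : ExteriorAlgebra R L, parity (h • u + h • parity u) = h • u + h • parity u :=
    fun u => by rw [map_add, map_smul, map_smul, CliffordAlgebra.involute_involute]; abel
  have hhalf : ∀ u : ExteriorAlgebra R L, h • u + h • u = u := half_smul_add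
  let Br : ExteriorAlgebra R L →+ ExteriorAlgebra R L →+ ExteriorAlgebra R L :=
    AddMonoidHom.mk' (fun u => adO _ (hO u) + adE _ (hE u)) fun u v => by
      have e1 : adO _ (hO (u + v)) = adO _ (hO u) + adO _ (hO v) := by
        refine twisted_derivation_ext (AlgHom.id R _) (fun f => ?_) (fun z => ?_) (adOD _ _) ?_
        · simp only [AddMonoidHom.add_apply, adO0, ← neg_add, ← map_add]
          congr 3
          simp only [smul_add, map_add]; abel
        · simp only [AddMonoidHom.add_apply, adO1, ← neg_add, ← map_add]
          congr 2
          simp only [smul_add, map_add]; abel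
        · intro a b
          simp only [AddMonoidHom.add_apply, adOD]
          noncomm_ring
      have e2 : adE _ (hE (u + v)) = adE _ (hE u) + adE _ (hE v) := by
        refine twisted_derivation_ext parity (fun f => ?_) (fun z => ?_) (adED _ _) ?_
        · simp only [AddMonoidHom.add_apply, adE0, ← neg_add, ← map_add]
          congr 3
          simp only [smul_add, map_add]; abel
        · simp only [AddMonoidHom.add_apply, adE1, ← neg_add, ← map_add]
          congr 2
          simp only [smul_add, map_add]; abel
        · intro a b
          simp only [AddMonoidHom.add_apply, adED]
          noncomm_ring
      rw [e1, e2]; abel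
  have hBr : ∀ u, Br u = adO _ (hO u) + adE _ (hE u) := fun u => rfl
  have Br0 : ∀ u f, Br u (algebraMap R _ f) = -contract (anchorDual 𝔞 f) (parity u) :=
    fun u f => by
      rw [hBr, AddMonoidHom.add_apply, adO0, adE0, ← neg_add, ← map_add, ← map_add,
        show h • u - h • parity u + (h • u + h • parity u) = h • u + h • u by abel, hhalf]
  have Br1 : ∀ u y, Br u (ExteriorAlgebra.ι R y) = -Lv y u := fun u y => by
    rw [hBr, AddMonoidHom.add_apply, adO1, adE1, ← neg_add, ← map_add,
        show h • u - h • parity u + (h • u + h • parity u) = h • u + h • u by abel, hhalf]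
  have BrO : ∀ u, parity u = -u → ∀ a b, Br u (a * b) = a * Br u b + Br u a * b := by
    intro u hu a b
    have hz : adE _ (hE u) = 0 := by
      have e : h • u + h • parity u = 0 := by rw [hu, smul_neg, add_neg_cancel]
      refine twisted_derivation_ext parity (fun f => ?_) (fun z => ?_) (adED _ _) ?_
      · rw [adE0, e]; simp
      · rw [adE1, e]; simp
      · intro a b; simp
    rw [hBr, hz, add_zero, adOD]; rfl
  have BrE : ∀ u, parity u = u → ∀ a b, Br u (a * b) = parity a * Br u b + Br u a * b := by
    intro u hu a b
    have hz : adO _ (hO u) = 0 := by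
      have e : h • u - h • parity u = 0 := by rw [hu, sub_self]
      refine twisted_derivation_ext (AlgHom.id R _) (fun f => ?_) (fun z => ?_) (adOD _ _) ?_
      · rw [adO0, e]; simp
      · rw [adO1, e]; simp
      · intro a b; simp
    rw [hBr, hz, zero_add, adED]
  have hparE : ∀ {k : ℕ} {u : ExteriorAlgebra R L}, Even k → u ∈ ⋀[R]^k L → parity u = u :=
    fun hk hu => by rw [parity_of_mem hu, hk.neg_one_pow, one_smul]
  have hparO : ∀ {k : ℕ} {u : ExteriorAlgebra R L}, Odd k → u ∈ ⋀[R]^k L → parity u = -u :=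
    fun hk hu => by rw [parity_of_mem hu, hk.neg_one_pow, neg_smul, one_smul]
  have Brι : ∀ x, Br (ExteriorAlgebra.ι R x) = Lv x := fun x => by
    refine twisted_derivation_ext (AlgHom.id R _) (fun f => ?_) (fun z => ?_)
      (BrO _ (parity_ι x)) (LvD x)
    · rw [Br0, parity_ι, map_neg, neg_neg, contract_ι, Lv0, anchorDual_apply]
    · rw [Br1, Lv1, Lv1, 𝔞.bracket_skew x z, map_neg]
  have Bralg : ∀ r a, Br (algebraMap R _ r) a = -contract (anchorDual 𝔞 r) a := fun r a => by
    refine DFunLike.congr_fun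
      (show Br (algebraMap R _ r) = -(contract (anchorDual 𝔞 r)).toAddMonoidHom from ?_) a
    refine twisted_derivation_ext parity (fun f => ?_) (fun z => ?_)
      (BrE _ (AlgHom.commutes _ r)) ?_
    · rw [Br0, AlgHom.commutes, contract_algebraMap]
      simp
    · rw [Br1, Lv0]
      simp [anchorDual_apply]
    · intro a b
      simp only [AddMonoidHom.neg_apply, LinearMap.toAddMonoidHom_coe, contract_mul]
      noncomm_ring
  have BrLE : ∀ x u, parity u = u → ∀ v, Br (ExteriorAlgebra.ι R x * u) v =
      ExteriorAlgebra.ι R x * Br u v + Lv x v * u := by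
    intro x u hu v
    let D' : ExteriorAlgebra R L →+ ExteriorAlgebra R L := AddMonoidHom.mk'
      (fun v => ExteriorAlgebra.ι R x * Br u v + Lv x v * u)
      (fun a b => by rw [map_add, map_add, mul_add, add_mul]; abel)
    have hp : parity (ExteriorAlgebra.ι R x * u) = -(ExteriorAlgebra.ι R x * u) := by
      rw [map_mul, parity_ι, hu, neg_mul]
    refine DFunLike.congr_fun (show Br (ExteriorAlgebra.ι R x * u) = D' from ?_) v
    refine twisted_derivation_ext (AlgHom.id R _) (fun f => ?_) (fun z => ?_) (BrO _ hp) ?_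
    · change _ = ExteriorAlgebra.ι R x * Br u _ + Lv x _ * u
      rw [Br0, hp, map_neg, neg_neg, contract_ι_mul, Br0, hu, Lv0, Algebra.smul_def,
        anchorDual_apply]
      noncomm_ring
    · change _ = ExteriorAlgebra.ι R x * Br u _ + Lv x _ * u
      rw [Br1, Br1, LvD, Lv1, Lv1, 𝔞.bracket_skew x z, map_neg]
      noncomm_ring
    · intro a b
      change ExteriorAlgebra.ι R x * Br u (a * b) + Lv x (a * b) * u =
        a * (ExteriorAlgebra.ι R x * Br u b + Lv x b * u) +
        (ExteriorAlgebra.ι R x * Br u a + Lv x a * u) * b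
      rw [BrE u hu, LvD, mul_add, ← mul_assoc _ (parity a), ι_mul_eq x (parity a),
        CliffordAlgebra.involute_involute, add_mul, mul_assoc _ b u, even_mul_comm hu b]
      noncomm_ring
  have BrLO : ∀ x u, parity u = -u → ∀ v, Br (ExteriorAlgebra.ι R x * u) v =
      ExteriorAlgebra.ι R x * Br u v - Lv x (parity v) * u := by
    intro x u hu v
    let D' : ExteriorAlgebra R L →+ ExteriorAlgebra R L := AddMonoidHom.mk'
      (fun v => ExteriorAlgebra.ι R x * Br u v - Lv x (parity v) * u)
      (fun a b => by rw [map_add, map_add, map_add, mul_add, add_mul]; abel)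
    have hp : parity (ExteriorAlgebra.ι R x * u) = ExteriorAlgebra.ι R x * u := by
      rw [map_mul, parity_ι, hu, neg_mul_neg]
    refine DFunLike.congr_fun (show Br (ExteriorAlgebra.ι R x * u) = D' from ?_) v
    refine twisted_derivation_ext parity (fun f => ?_) (fun z => ?_) (BrE _ hp) ?_
    · change _ = ExteriorAlgebra.ι R x * Br u _ - Lv x (parity _) * u
      rw [Br0, hp, contract_ι_mul, Br0, hu, AlgHom.commutes, Lv0, Algebra.smul_def,
        anchorDual_apply, map_neg]
      noncomm_ring
    · change _ = ExteriorAlgebra.ι R x * Br u _ - Lv x (parity _) * u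
      rw [Br1, Br1, LvD, parity_ι, map_neg, Lv1, Lv1, 𝔞.bracket_skew x z, map_neg]
      noncomm_ring
    · intro a b
      change ExteriorAlgebra.ι R x * Br u (a * b) - Lv x (parity (a * b)) * u =
        parity a * (ExteriorAlgebra.ι R x * Br u b - Lv x (parity b) * u) +
        (ExteriorAlgebra.ι R x * Br u a - Lv x (parity a) * u) * b
      rw [BrO u hu, map_mul, LvD, mul_add, ← mul_assoc _ a, ι_mul_eq x a, add_mul,
        mul_assoc _ (parity b) u, odd_mul_comm hu b]
      noncomm_ring
  refine ⟨Br, fun f g => ?_, fun x f => ?_, fun x y => ?_, ?_, ?_⟩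
  · rw [Br0, AlgHom.commutes, contract_algebraMap, neg_zero]
  · rw [Brι, Lv0]
  · rw [Brι, Lv1]
  · intro k l u hu v hv
    induction hu using Submodule.pow_induction_on_left' with
    | algebraMap r =>
      rw [Bralg, Br0, parity_of_mem hv, map_smul, smul_neg, neg_neg, smul_smul, ← pow_add,
        Odd.neg_one_pow (by exact ⟨l, by ring⟩), neg_smul, one_smul]
    | add x y i hx hy ihx ihy =>
      rw [map_add, AddMonoidHom.add_apply, ihx, ihy, map_add, smul_add, neg_add]
    | mem_mul m hm i x hx ih =>
      obtain ⟨y, rfl⟩ := hm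
      have e : Br v (ExteriorAlgebra.ι R y * x) =
          -(Lv y v * x) + (-1 : R) ^ (l + 1) • (ExteriorAlgebra.ι R y * Br v x) := by
        rcases Nat.even_or_odd l with hl | hl
        · rw [BrE _ (hparE hl hv), Br1, parity_ι, hl.add_one.neg_one_pow, neg_smul, one_smul]
          noncomm_ring
        · rw [BrO _ (hparO hl hv), Br1, hl.add_one.neg_one_pow, one_smul]
          noncomm_ring
      have e' : Br x v = -((-1 : R) ^ ((i + 1) * (l + 1)) • Br v x) := ih
      rw [e, Nat.succ_eq_add_one]
      rcases Nat.even_or_odd i with hi | hi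
      · rw [BrLE y x (hparE hi hx), e', Even.neg_one_pow (n := (i + 1 + 1) * (l + 1))
          ((by simpa [parity_simps] using hi : Even (i + 1 + 1)).mul_right _), one_smul]
        rcases Nat.even_or_odd l with hl | hl
        · rw [hl.add_one.neg_one_pow, (hi.add_one.mul hl.add_one).neg_one_pow]
          simp only [neg_smul, one_smul]
          noncomm_ring
        · rw [hl.add_one.neg_one_pow, (hl.add_one.mul_left _).neg_one_pow]
          simp only [one_smul]
          noncomm_ring
      · rw [BrLO y x (hparO hi hx), e', parity_of_mem hv]
        rcases Nat.even_or_odd l with hl | hl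
        · rw [hl.add_one.neg_one_pow, (hi.add_one.mul_right _).neg_one_pow, hl.neg_one_pow,
            (hi.add_one.add_one.mul hl.add_one).neg_one_pow]
          simp only [neg_smul, one_smul]
          noncomm_ring
        · rw [hl.add_one.neg_one_pow, (hi.add_one.mul_right _).neg_one_pow, hl.neg_one_pow,
            (hl.add_one.mul_left _).neg_one_pow]
          simp only [neg_smul, one_smul, map_neg]
          noncomm_ring
  · intro k l u hu v hv w
    rcases Nat.even_or_odd k with hk | hk
    · rw [BrE _ (hparE hk hu), parity_of_mem hv, pow_mul, hk.add_one.neg_one_pow, smul_mul_assoc,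
        add_comm]
    · rw [BrO _ (hparO hk hu), pow_mul, hk.add_one.neg_one_pow, one_pow, one_smul, add_comm]

/-- The Schouten bracket on `Γ(∧A)`. -/
def schouten [CharZero 𝕜] : ExteriorAlgebra R L →+ ExteriorAlgebra R L →+ ExteriorAlgebra R L :=
  (exists_isSchouten 𝔞).choose

theorem schouten_spec [CharZero 𝕜] : IsSchouten 𝔞 (schouten 𝔞) := (exists_isSchouten 𝔞).choose_spec

end Schouten

section Duality

variable {𝕜 R L L' : Type*} [Field 𝕜] [CommRing R] [Algebra 𝕜 R] [AddCommGroup L] [Module R L]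
  [AddCommGroup L'] [Module R L']

/-- The contraction `i_U` of forms by a multisection `U`, characterised by `i_f = f` for functions,
`(i_x ω)(x₁, …) = ω(x, x₁, …)` for sections, and `i_{U ∧ W} = i_W ∘ i_U`.
Here `B` is the duality pairing. -/
def interiorHom (B : L →ₗ[R] L' →ₗ[R] R) :
    ExteriorAlgebra R L →ₐ[R] (Module.End R (ExteriorAlgebra R L'))ᵐᵒᵖ :=
  ExteriorAlgebra.lift R
    ⟨(MulOpposite.opLinearEquiv R).toLinearMap ∘ₗ CliffordAlgebra.contractLeft ∘ₗ B, fun x => by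
      apply MulOpposite.unop_injective
      refine LinearMap.ext fun w => ?_
      exact CliffordAlgebra.contractLeft_contractLeft (B x) w⟩

/-- The contraction `i_U ω`. -/
def interior (B : L →ₗ[R] L' →ₗ[R] R) (U : ExteriorAlgebra R L) :
    ExteriorAlgebra R L' →ₗ[R] ExteriorAlgebra R L' :=
  (interiorHom B U).unop

theorem interior_ι (B : L →ₗ[R] L' →ₗ[R] R) (x : L) :
    interior B (ExteriorAlgebra.ι R x) = contract (B x) := by
  simp only [interior, interiorHom, ExteriorAlgebra.lift_ι_apply]
  rfl

theorem interior_mul (B : L →ₗ[R] L' →ₗ[R] R) (U W : ExteriorAlgebra R L)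
    (ω : ExteriorAlgebra R L') :
    interior B (U * W) ω = interior B W (interior B U ω) := by
  simp only [interior, map_mul]
  rfl

/-- The duality pairing of multisections and forms, i.e. the determinant pairing in each degree:
the degree-zero part of `i_U ω`. -/
def pair (B : L →ₗ[R] L' →ₗ[R] R) (U : ExteriorAlgebra R L) (ω : ExteriorAlgebra R L') : R :=
  ExteriorAlgebra.algebraMapInv (interior B U ω)

variable (𝔞 : LieAlgebroid 𝕜 R L)

/-- `D` is the Lie algebroid differential on forms: the derivation of degree one given
by `(df)(x) = ρ(x) f` and `(dθ)(x, y) = ρ(x) θ(y) - ρ(y) θ(x) - θ([x, y])`. -/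
structure IsDifferential (B : L →ₗ[R] L' →ₗ[R] R)
    (D : ExteriorAlgebra R L' →+ ExteriorAlgebra R L') : Prop where
  degree_fun : ∀ f, D (algebraMap R _ f) ∈ ⋀[R]^1 L'
  eval_fun : ∀ f x, pair B (ExteriorAlgebra.ι R x) (D (algebraMap R _ f)) = 𝔞.anchor x f
  degree_section : ∀ θ, D (ExteriorAlgebra.ι R θ) ∈ ⋀[R]^2 L'
  eval_section : ∀ θ x y,
    pair B (ExteriorAlgebra.ι R x * ExteriorAlgebra.ι R y) (D (ExteriorAlgebra.ι R θ)) =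
      𝔞.anchor x (B y θ) - 𝔞.anchor y (B x θ) - B (𝔞.bracket x y) θ
  derivation : ∀ k, ∀ a ∈ ⋀[R]^k L', ∀ b, D (a * b) = D a * b + (-1 : R) ^ k • (a * D b)

open Classical in
/-- The Lie algebroid differential `d` on `Γ(∧A*)`. -/
def differential (B : L →ₗ[R] L' →ₗ[R] R) : ExteriorAlgebra R L' →+ ExteriorAlgebra R L' :=
  if h : ∃ D, IsDifferential 𝔞 B D then h.choose else 0

/-- A finite dual basis for the pairing `B`. -/
def HasDualBasis (B : L →ₗ[R] L' →ₗ[R] R) : Prop :=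
  ∃ (J : Type) (_ : Fintype J) (e : J → L) (ε : J → L'),
    (∀ x, x = ∑ i, B x (ε i) • e i) ∧ ∀ θ, θ = ∑ i, B (e i) θ • ε i

theorem pair_ι_ι (B : L →ₗ[R] L' →ₗ[R] R) (x : L) (θ : L') :
    pair B (ExteriorAlgebra.ι R x) (ExteriorAlgebra.ι R θ) = B x θ := by
  rw [pair, interior_ι, contract_ι, AlgHom.commutes]
  rfl

theorem pair_ι_mul_ι (B : L →ₗ[R] L' →ₗ[R] R) (x y : L) (θ η : L') :
    pair B (ExteriorAlgebra.ι R x * ExteriorAlgebra.ι R y)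
      (ExteriorAlgebra.ι R θ * ExteriorAlgebra.ι R η) = B x θ * B y η - B y θ * B x η := by
  rw [pair, interior_mul, interior_ι, interior_ι, contract_ι_mul, contract_ι, map_sub, map_smul,
    contract_ι, contract_ι_mul, contract_algebraMap, mul_zero, sub_zero]
  simp [Algebra.smul_def, ExteriorAlgebra.algebraMap_leftInverse _ _]

theorem pair_add (B : L →ₗ[R] L' →ₗ[R] R) (U : ExteriorAlgebra R L)
    (ω ω' : ExteriorAlgebra R L') : pair B U (ω + ω') = pair B U ω + pair B U ω' := by
  simp [pair]

theorem pair_smul (B : L →ₗ[R] L' →ₗ[R] R) (U : ExteriorAlgebra R L) (f : R)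
    (ω : ExteriorAlgebra R L') : pair B U (f • ω) = f * pair B U ω := by
  simp [pair]

theorem pair_sum (B : L →ₗ[R] L' →ₗ[R] R) (U : ExteriorAlgebra R L) {ι : Type*} (s : Finset ι)
    (ω : ι → ExteriorAlgebra R L') : pair B U (∑ i ∈ s, ω i) = ∑ i ∈ s, pair B U (ω i) := by
  simp [pair]

theorem ι_mul_ι_mem (θ η : L') :
    ExteriorAlgebra.ι R θ * ExteriorAlgebra.ι R η ∈ ⋀[R]^2 L' := by
  rw [ExteriorAlgebra.exteriorPower, pow_two]
  exact Submodule.mul_mem_mul ⟨θ, rfl⟩ ⟨η, rfl⟩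

theorem exists_isDifferential [CharZero 𝕜] (B : L →ₗ[R] L' →ₗ[R] R) (hB : HasDualBasis B) :
    ∃ D, IsDifferential 𝔞 B D := by
  obtain ⟨J, _, e, ε, he, hε⟩ := hB
  let h : R := algebraMap 𝕜 R (1 / 2)
  let F : L → L → L' → R := fun x y θ =>
    𝔞.anchor x (B y θ) - 𝔞.anchor y (B x θ) - B (𝔞.bracket x y) θ
  have F_skew : ∀ x y θ, F y x θ = -F x y θ := fun x y θ => by
    simp only [F, 𝔞.bracket_skew y x, map_neg, LinearMap.neg_apply]; ring
  have F_smul : ∀ (f : R) x y θ, F x (f • y) θ = f * F x y θ := fun f x y θ => by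
    simp only [F, 𝔞.leibniz, map_smul, map_add, LinearMap.add_apply, LinearMap.smul_apply,
      smul_eq_mul, Derivation.leibniz, Derivation.smul_apply]; ring
  have F_add : ∀ x y z θ, F x (y + z) θ = F x y θ + F x z θ := fun x y z θ => by
    simp only [F, map_add, LinearMap.add_apply, Derivation.add_apply]; ring
  have F_zero : ∀ x θ, F x 0 θ = 0 := fun x θ => by
    simp [F]
  have F_sum : ∀ x θ (c : J → R) (s : Finset J),
      F x (∑ i ∈ s, c i • e i) θ = ∑ i ∈ s, c i * F x (e i) θ := fun x θ c s => by
    classical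
    induction s using Finset.induction_on with
    | empty => simp [F_zero]
    | insert a s ha ih => rw [Finset.sum_insert ha, F_add, F_smul, ih, Finset.sum_insert ha]
  have F_exp : ∀ x y θ, F x y θ = ∑ i, B y (ε i) * F x (e i) θ := fun x y θ => by
    conv_lhs => rw [he y]
    rw [F_sum]
  have F_exp' : ∀ x y θ, F x y θ = ∑ i, B x (ε i) * F (e i) y θ := fun x y θ => by
    rw [F_skew y x, F_exp, ← Finset.sum_neg_distrib]
    exact Finset.sum_congr rfl fun i _ => by rw [F_skew (e i) y]; ring
  let d0 : R →+ L' := AddMonoidHom.mk' (fun f => ∑ i, 𝔞.anchor (e i) f • ε i) fun f g => by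
    simp only [map_add, add_smul, Finset.sum_add_distrib]
  have hd0 : ∀ f, d0 f = ∑ i, 𝔞.anchor (e i) f • ε i := fun f => rfl
  have Bd0 : ∀ x f, B x (d0 f) = 𝔞.anchor x f := fun x f => by
    conv_rhs => rw [he x]
    rw [hd0]
    rw [← anchorDual_apply]
    simp only [map_sum, map_smul, smul_eq_mul, anchorDual_apply]
    exact Finset.sum_congr rfl fun i _ => mul_comm _ _
  let d1 : L' →+ ExteriorAlgebra R L' := AddMonoidHom.mk'
    (fun θ => h • ∑ i, ∑ j, F (e i) (e j) θ • (ExteriorAlgebra.ι R (ε i) *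
      ExteriorAlgebra.ι R (ε j))) fun θ η => by
    have : ∀ x y, F x y (θ + η) = F x y θ + F x y η := fun x y => by
      simp only [F, map_add]; ring
    simp only [this, add_smul, Finset.sum_add_distrib, smul_add]
  have hd1 : ∀ θ, d1 θ = h • ∑ i, ∑ j, F (e i) (e j) θ • (ExteriorAlgebra.ι R (ε i) *
      ExteriorAlgebra.ι R (ε j)) := fun θ => rfl
  have d1_mem : ∀ θ, d1 θ ∈ ⋀[R]^2 L' := fun θ =>
    Submodule.smul_mem _ _ (Submodule.sum_mem _ fun i _ => Submodule.sum_mem _ fun j _ =>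
      Submodule.smul_mem _ _ (ι_mul_ι_mem _ _))
  have d0ι : ∀ f, ExteriorAlgebra.ι R (d0 f) =
      ∑ i, 𝔞.anchor (e i) f • ExteriorAlgebra.ι R (ε i) := fun f => by
    rw [hd0]; simp only [map_sum, map_smul]
  have ιε : ∀ θ, ExteriorAlgebra.ι R θ = ∑ i, B (e i) θ • ExteriorAlgebra.ι R (ε i) := fun θ => by
    conv_lhs => rw [hε θ]
    simp only [map_sum, map_smul]
  have pev : ∀ θ, parity (d1 θ) = d1 θ := fun θ => by
    rw [parity_of_mem (d1_mem θ)]; simp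
  obtain ⟨D, D0, D1, DD⟩ := exists_twisted_derivation (R := R) (L := L') parity
    ((ExteriorAlgebra.ι R).toAddMonoidHom.comp d0) d1
    (by
      intro f g
      change ExteriorAlgebra.ι R (d0 (f * g)) = f • ExteriorAlgebra.ι R (d0 g) +
        g • ExteriorAlgebra.ι R (d0 f)
      rw [← map_smul (ExteriorAlgebra.ι R), ← map_smul (ExteriorAlgebra.ι R),
        ← map_add (ExteriorAlgebra.ι R)]
      congr 1
      simp only [hd0, Derivation.leibniz, add_smul, Finset.sum_add_distrib, Finset.smul_sum,
        smul_eq_mul, mul_smul])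
    (by
      intro f θ
      change d1 (f • θ) = f • d1 θ + ExteriorAlgebra.ι R (d0 f) * ExteriorAlgebra.ι R θ
      have hF : ∀ x y, F x y (f • θ) =
          f * F x y θ + (𝔞.anchor x f * B y θ - 𝔞.anchor y f * B x θ) := fun x y => by
        simp only [F, map_smul, smul_eq_mul, Derivation.leibniz]; ring
      have e1 : ExteriorAlgebra.ι R (d0 f) * ExteriorAlgebra.ι R θ =
          ∑ i, ∑ j, (𝔞.anchor (e i) f * B (e j) θ) • (ExteriorAlgebra.ι R (ε i) *
            ExteriorAlgebra.ι R (ε j)) := by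
        rw [d0ι, ιε θ, Finset.sum_mul_sum]
        simp only [smul_mul_smul_comm]
      have e2 : ExteriorAlgebra.ι R θ * ExteriorAlgebra.ι R (d0 f) =
          ∑ i, ∑ j, (𝔞.anchor (e j) f * B (e i) θ) • (ExteriorAlgebra.ι R (ε i) *
            ExteriorAlgebra.ι R (ε j)) := by
        rw [d0ι, ιε θ, Finset.sum_mul_sum]
        simp only [smul_mul_smul_comm, mul_comm]
      have e3 : ExteriorAlgebra.ι R θ * ExteriorAlgebra.ι R (d0 f) =
          -(ExteriorAlgebra.ι R (d0 f) * ExteriorAlgebra.ι R θ) :=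
        eq_neg_of_add_eq_zero_left (ExteriorAlgebra.ι_add_mul_swap _ _)
      rw [hd1, hd1]
      simp only [hF, add_smul, sub_smul, Finset.sum_add_distrib, Finset.sum_sub_distrib]
      rw [← e1, ← e2, e3, sub_neg_eq_add, smul_add, smul_add, half_smul_add]
      congr 1
      simp only [Finset.smul_sum, smul_smul]
      refine Finset.sum_congr rfl fun i _ => Finset.sum_congr rfl fun j _ => ?_
      congr 1; ring)
    (by
      intro f a
      exact odd_mul_comm (parity_ι _) a)
    (by
      intro θ
      rw [parity_ι, neg_mul, even_mul_comm (pev θ), neg_add_cancel])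
  refine ⟨D, fun f => ?_, fun f x => ?_, fun θ => ?_, fun θ x y => ?_, fun k a ha b => ?_⟩
  · rw [D0, ExteriorAlgebra.exteriorPower, pow_one]
    exact ⟨d0 f, rfl⟩
  · rw [D0]
    exact (pair_ι_ι B x (d0 f)).trans (Bd0 x f)
  · rw [D1]; exact d1_mem θ
  · rw [D1, hd1, pair_smul, pair_sum]
    simp only [pair_sum, pair_smul, pair_ι_mul_ι]
    have e1 : ∑ i, ∑ j, F (e i) (e j) θ * (B x (ε i) * B y (ε j) - B y (ε i) * B x (ε j)) =
        F x y θ - F y x θ := by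
      simp only [mul_sub, Finset.sum_sub_distrib]
      congr 1
      · rw [F_exp' x y]
        refine Finset.sum_congr rfl fun i _ => ?_
        rw [F_exp (e i) y, Finset.mul_sum]
        exact Finset.sum_congr rfl fun j _ => by ring
      · rw [F_exp' y x]
        refine Finset.sum_congr rfl fun i _ => ?_
        rw [F_exp (e i) x, Finset.mul_sum]
        exact Finset.sum_congr rfl fun j _ => by ring
    rw [e1, F_skew x y, sub_neg_eq_add, mul_add, ← add_mul]
    change (algebraMap 𝕜 R (1 / 2) + algebraMap 𝕜 R (1 / 2)) * _ = _
    rw [← map_add, show (1 / 2 + 1 / 2 : 𝕜) = 1 by norm_num, map_one, one_mul]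
  · rw [DD, parity_of_mem ha, smul_mul_assoc, add_comm]

theorem differential_spec [CharZero 𝕜] (B : L →ₗ[R] L' →ₗ[R] R) (hB : HasDualBasis B) :
    IsDifferential 𝔞 B (differential 𝔞 B) := by
  have h := exists_isDifferential 𝔞 B hB
  rw [differential, dif_pos h]
  exact h.choose_spec

end Duality

section Operators

variable {𝕜 R L L' : Type*} [Field 𝕜] [CharZero 𝕜] [CommRing R] [Algebra 𝕜 R]
  [AddCommGroup L] [Module R L] [AddCommGroup L'] [Module R L']
variable (𝔞 : LieAlgebroid 𝕜 R L) (𝔟 : LieAlgebroid 𝕜 R L') (B : L →ₗ[R] L' →ₗ[R] R)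

/-- The Lie derivative `L_x = [x, ·]` of multisections along a section `x`. -/
def lieMulti (x : L) : ExteriorAlgebra R L →+ ExteriorAlgebra R L :=
  schouten 𝔞 (ExteriorAlgebra.ι R x)

/-- The Lie derivative `L_x = i_x d + d i_x` of forms along a section `x`. -/
def lieForm (x : L) : ExteriorAlgebra R L' →+ ExteriorAlgebra R L' :=
  (contract (B x)).toAddMonoidHom.comp (differential 𝔞 B) +
    (differential 𝔞 B).comp (contract (B x)).toAddMonoidHom

/-- The map `Ω^♯ : U ↦ i_U Ω` from multisections to forms. -/
def sharp (Ω : ExteriorAlgebra R L') (U : ExteriorAlgebra R L) : ExteriorAlgebra R L' :=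
  interior B U Ω

/-- The Batalin-Vilkovisky operator `∂` on multisections: `Ω^♯ ∂β = (-1)^l d Ω^♯ β` for `β` of
degree `l`. -/
def bv (Ω : ExteriorAlgebra R L') (β : ExteriorAlgebra R L) : ExteriorAlgebra R L :=
  Function.invFun (sharp B Ω) (differential 𝔞 B (sharp B Ω (parity β)))

/-- The Laplacian `Δ = d_* ∂ + ∂ d_*` on multisections of the first algebroid. -/
def laplacian (Ω : ExteriorAlgebra R L') (u : ExteriorAlgebra R L) : ExteriorAlgebra R L :=
  differential 𝔟 B.flip (bv 𝔞 B Ω u) + bv 𝔞 B Ω (differential 𝔟 B.flip u)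

/-- The Lie derivative `L_{x + ξ} = L_x + L_ξ` on `Γ(∧A*)`, for `x ∈ Γ(A)` and `ξ ∈ Γ(A*)`.
With the roles of `A` and `A*` exchanged it is the one on `Γ(∧A)`. -/
def lieSum (x : L) (ξ : L') : ExteriorAlgebra R L' →+ ExteriorAlgebra R L' :=
  lieForm 𝔞 B x + lieMulti 𝔟 ξ

/-- The Dorfman product `u ∘ θ = -i_θ d_* u + L_u θ` of `u ∈ Γ(A)` and `θ ∈ Γ(A*)`. With the roles
of `A` and `A*` exchanged it is `θ ∘ u = -i_u dθ + L_θ u`. -/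
def dorfman (u : L) (θ : L') : L × L' :=
  (-ExteriorAlgebra.ιInv
      (contract (B.flip θ) (differential 𝔟 B.flip (ExteriorAlgebra.ι R u))),
    ExteriorAlgebra.ιInv (lieForm 𝔞 B u (ExteriorAlgebra.ι R θ)))

/-- The operator `L_{u ∘ θ} - [L_u, L_θ]` on `Γ(∧A*)`. -/
def dorfmanDefect (u : L) (θ : L') (α : ExteriorAlgebra R L') : ExteriorAlgebra R L' :=
  lieSum 𝔞 𝔟 B (dorfman 𝔞 𝔟 B u θ).1 (dorfman 𝔞 𝔟 B u θ).2 α -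
    (lieForm 𝔞 B u (lieMulti 𝔟 θ α) - lieMulti 𝔟 θ (lieForm 𝔞 B u α))

end Operators

section BaseForms

variable {𝕜 R : Type*} [Field 𝕜] [CommRing R] [Algebra 𝕜 R]

/-- The differential forms on the base: the exterior algebra of the dual of the vector fields. -/
abbrev BaseForms (𝕜 R : Type*) [Field 𝕜] [CommRing R] [Algebra 𝕜 R] : Type _ :=
  ExteriorAlgebra R (Module.Dual R (Derivation 𝕜 R R))

/-- The Lie derivative of a one-form: `(L_X α)(Y) = X (α Y) - α [X, Y]`. -/
def lieOneForm (X : Derivation 𝕜 R R) :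
    Module.Dual R (Derivation 𝕜 R R) →+ Module.Dual R (Derivation 𝕜 R R) where
  toFun α :=
    { toFun := fun Y => X (α Y) - α ⁅X, Y⁆
      map_add' := fun Y Z => by rw [lie_add]; simp only [map_add]; ring
      map_smul' := fun f Y => by
        rw [LieRinehartRing.leibniz_smul_right]
        simp only [map_add, map_smul, smul_eq_mul, Derivation.leibniz, RingHom.id_apply]
        change _ + α Y * X f - (_ + X f * α Y) = _
        ring }
  map_zero' := by ext Y; simp
  map_add' α β := by ext Y; simp; ring

theorem exists_lieBaseForm (X : Derivation 𝕜 R R) : ∃ D : BaseForms 𝕜 R →+ BaseForms 𝕜 R,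
    (∀ f, D (algebraMap R _ f) = algebraMap R _ (X f)) ∧
    (∀ α, D (ExteriorAlgebra.ι R α) = ExteriorAlgebra.ι R (lieOneForm X α)) ∧
    ∀ a b, D (a * b) = a * D b + D a * b := by
  refine exists_twisted_derivation (AlgHom.id R _)
    ((algebraMap R (BaseForms 𝕜 R)).toAddMonoidHom.comp (X : R →ₗ[𝕜] R).toAddMonoidHom)
    ((ExteriorAlgebra.ι R).toAddMonoidHom.comp (lieOneForm X)) ?_ ?_ ?_ ?_
  · intro f g
    change algebraMap R _ (X (f * g)) = f • algebraMap R _ (X g) + g • algebraMap R _ (X f)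
    simp [Algebra.smul_def]
  · intro f α
    change ExteriorAlgebra.ι R (lieOneForm X (f • α)) = f • ExteriorAlgebra.ι R (lieOneForm X α) +
      algebraMap R _ (X f) * ExteriorAlgebra.ι R α
    rw [← Algebra.smul_def, ← map_smul (ExteriorAlgebra.ι R), ← map_smul (ExteriorAlgebra.ι R),
      ← map_add (ExteriorAlgebra.ι R)]
    congr 1
    ext Y
    simp [lieOneForm]
    ring
  · intro f a
    exact (Algebra.commutes (R := R) (X f) a).symm
  · intro α
    exact ExteriorAlgebra.ι_add_mul_swap α (lieOneForm X α)

/-- The Lie derivative of differential forms on the base along a vector field: the derivation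
of degree zero with `L_X f = X f` and `(L_X α)(Y) = X (α Y) - α [X, Y]`. -/
def lieBaseForm (X : Derivation 𝕜 R R) : BaseForms 𝕜 R →+ BaseForms 𝕜 R :=
  (exists_lieBaseForm X).choose

/-- The value `s(Y₁, …, Y_k)` of the degree `k` part of a differential form on vector fields. -/
def evalBaseForm {k : ℕ} (s : BaseForms 𝕜 R) (Y : Fin k → Derivation 𝕜 R R) : R :=
  pair (Module.Dual.eval R (Derivation 𝕜 R R)) (ExteriorAlgebra.ιMulti R k Y) s

variable {L L' : Type*} [AddCommGroup L] [Module R L] [AddCommGroup L'] [Module R L'] [CharZero 𝕜]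

/-- `ξ₀` is the modular cocycle of the Lie algebroid `𝔞` with respect to the top multisection `V`
and the volume form `s` of the base:
`(L_u V) ⊗ s + V ⊗ (L_{ρ(u)} s) = ⟨ξ₀, u⟩ V ⊗ s` for all sections `u`. -/
def IsModularCocycle (𝔞 : LieAlgebroid 𝕜 R L) (B : L →ₗ[R] L' →ₗ[R] R)
    (V : ExteriorAlgebra R L) (s : BaseForms 𝕜 R) (ξ₀ : L') : Prop :=
  ∀ u : L, lieMulti 𝔞 u V ⊗ₜ[R] s + V ⊗ₜ[R] lieBaseForm (𝔞.anchor u) s = B u ξ₀ • (V ⊗ₜ[R] s)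

end BaseForms

end LieAlgebroidPair

open scoped Manifold ContDiff Bundle TensorProduct

namespace LieAlgebroidPair

section Geometry

variable (𝕜 : Type*) [RCLike 𝕜] (m n : ℕ) (M : Type*) [TopologicalSpace M]
  [ChartedSpace (EuclideanSpace ℝ (Fin m)) M]

/-- The smooth `𝕜`-valued functions on the real manifold `M`, as a subalgebra of all functions. -/
def smoothFun : Subalgebra 𝕜 (M → 𝕜) where
  carrier := {f | ContMDiff (𝓡 m) 𝓘(ℝ, 𝕜) ∞ f}
  mul_mem' hf hg := (contDiff_mul (𝕜 := ℝ) (𝔸 := 𝕜)).comp_contMDiff (hf.prodMk_space hg)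
  add_mem' hf hg := ContMDiff.add hf hg
  algebraMap_mem' _ := contMDiff_const

/-- The algebra `C^∞(M, 𝕜)`. -/
def Fn : Type _ := smoothFun 𝕜 m M

instance : CommRing (Fn 𝕜 m M) := inferInstanceAs (CommRing (smoothFun 𝕜 m M))
instance : Algebra 𝕜 (Fn 𝕜 m M) := inferInstanceAs (Algebra 𝕜 (smoothFun 𝕜 m M))

variable (A : M → Type*) [TopologicalSpace (Bundle.TotalSpace (Fin n → 𝕜) A)]
  [∀ p, TopologicalSpace (A p)] [∀ p, AddCommGroup (A p)] [∀ p, Module 𝕜 (A p)]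
  [∀ p, Module ℝ (A p)] [FiberBundle (Fin n → 𝕜) A]
  [VectorBundle 𝕜 (Fin n → 𝕜) A] [VectorBundle ℝ (Fin n → 𝕜) A]

/-- The smooth sections of the rank `n` vector bundle `A`, as a module over the smooth
functions. -/
def smoothSections : Submodule (smoothFun 𝕜 m M) (∀ p, A p) where
  carrier := {u | ContMDiff (𝓡 m) ((𝓡 m).prod 𝓘(ℝ, Fin n → 𝕜)) ∞
    fun p => Bundle.TotalSpace.mk' (Fin n → 𝕜) p (u p)}
  zero_mem' := Bundle.contMDiff_zeroSection ℝ A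
  add_mem' hu hv := ContMDiff.add_section hu hv
  smul_mem' f u hu := by
    intro p
    have hu := hu p
    rw [Bundle.contMDiffAt_section] at hu ⊢
    set e := trivializationAt (Fin n → 𝕜) A p
    have hf : ContMDiffAt (𝓡 m) 𝓘(ℝ, 𝕜) ∞ (f : M → 𝕜) p := f.2 p
    have hs : ContDiff ℝ ∞ fun x : 𝕜 × (Fin n → 𝕜) => x.1 • x.2 :=
      contDiff_fst.smul contDiff_snd
    refine (hs.contDiffAt.comp_contMDiffAt (hf.prodMk_space hu)).congr_of_eventuallyEq ?_
    filter_upwards [e.open_baseSet.mem_nhds (FiberBundle.mem_baseSet_trivializationAt' p)]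
      with x hx
    exact (e.linear 𝕜 hx).2 _ _

/-- The module `Γ(A)` of smooth sections of `A`. -/
def Sec : Type _ := smoothSections 𝕜 m n M A

instance : AddCommGroup (Sec 𝕜 m n M A) := inferInstanceAs (AddCommGroup (smoothSections 𝕜 m n M A))
instance : Module (Fn 𝕜 m M) (Sec 𝕜 m n M A) :=
  inferInstanceAs (Module (smoothFun 𝕜 m M) (smoothSections 𝕜 m n M A))

/-- The smooth sections of the dual bundle `A*`: the families of linear forms on the fibres whose
value on every smooth section of `A` is a smooth function. -/
def smoothDualSections : Submodule (smoothFun 𝕜 m M) (∀ p, Module.Dual 𝕜 (A p)) where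
  carrier := {θ | ∀ u ∈ smoothSections 𝕜 m n M A, (fun p => θ p (u p)) ∈ smoothFun 𝕜 m M}
  zero_mem' _ _ := (smoothFun 𝕜 m M).zero_mem
  add_mem' hθ hη u hu := (smoothFun 𝕜 m M).add_mem (hθ u hu) (hη u hu)
  smul_mem' f _ hθ u hu := (smoothFun 𝕜 m M).mul_mem f.2 (hθ u hu)

/-- The module `Γ(A*)` of smooth sections of `A*`. -/
def DualSec : Type _ := smoothDualSections 𝕜 m n M A

instance : AddCommGroup (DualSec 𝕜 m n M A) :=
  inferInstanceAs (AddCommGroup (smoothDualSections 𝕜 m n M A))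
instance : Module (Fn 𝕜 m M) (DualSec 𝕜 m n M A) :=
  inferInstanceAs (Module (smoothFun 𝕜 m M) (smoothDualSections 𝕜 m n M A))

/-- The duality pairing `⟨u, θ⟩` of sections of `A` and `A*`. -/
def duality : Sec 𝕜 m n M A →ₗ[Fn 𝕜 m M] DualSec 𝕜 m n M A →ₗ[Fn 𝕜 m M] Fn 𝕜 m M :=
  LinearMap.mk₂ _ (fun u θ => ⟨fun p => θ.1 p (u.1 p), θ.2 u.1 u.2⟩)
    (fun _ _ θ => Subtype.ext (funext fun p => map_add (θ.1 p) _ _))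
    (fun f _ θ => Subtype.ext (funext fun p => map_smul (θ.1 p) (f.1 p) _))
    (fun _ _ _ => rfl) (fun _ _ _ => rfl)

variable {𝕜 m n M A}

/-- `t` is the trace of the operator `T` on `Γ(A)`: `T` acts on each fibre by an endomorphism, and
the trace of that endomorphism is the value of `t`. -/
def HasTrace (T : Sec 𝕜 m n M A →ₗ[Fn 𝕜 m M] Sec 𝕜 m n M A) (t : Fn 𝕜 m M) : Prop :=
  ∀ p, ∃ Tp : A p →ₗ[𝕜] A p, (∀ x, (T x).1 p = Tp (x.1 p)) ∧ LinearMap.trace 𝕜 (A p) Tp = t.1 p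

/-- `t` is the trace of the operator `T` on `Γ(A*)`. -/
def HasDualTrace (T : DualSec 𝕜 m n M A →ₗ[Fn 𝕜 m M] DualSec 𝕜 m n M A) (t : Fn 𝕜 m M) : Prop :=
  ∀ p, ∃ Tp : Module.Dual 𝕜 (A p) →ₗ[𝕜] Module.Dual 𝕜 (A p),
    (∀ α, (T α).1 p = Tp (α.1 p)) ∧ LinearMap.trace 𝕜 (Module.Dual 𝕜 (A p)) Tp = t.1 p

/-- `s` is a volume form on `M`: a nowhere vanishing differential form of degree `m = dim M`. -/
def IsVolumeForm (s : BaseForms 𝕜 (Fn 𝕜 m M)) : Prop :=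
  s ∈ ⋀[Fn 𝕜 m M]^m (Module.Dual (Fn 𝕜 m M) (Derivation 𝕜 (Fn 𝕜 m M) (Fn 𝕜 m M))) ∧
    ∀ p : M, ∃ Y : Fin m → Derivation 𝕜 (Fn 𝕜 m M) (Fn 𝕜 m M), (evalBaseForm s Y).1 p ≠ 0

end Geometry

end LieAlgebroidPair

namespace LieAlgebroidPair

section Fibres

variable {𝕜 : Type*} [RCLike 𝕜] {m n : ℕ} {M : Type*} [TopologicalSpace M]
  [ChartedSpace (EuclideanSpace ℝ (Fin m)) M]
  {A : M → Type*} [TopologicalSpace (Bundle.TotalSpace (Fin n → 𝕜) A)]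
  [∀ p, TopologicalSpace (A p)] [∀ p, AddCommGroup (A p)] [∀ p, Module 𝕜 (A p)]
  [∀ p, Module ℝ (A p)] [FiberBundle (Fin n → 𝕜) A]
  [VectorBundle 𝕜 (Fin n → 𝕜) A] [VectorBundle ℝ (Fin n → 𝕜) A]

/-- Evaluation of functions at a point. -/
def evalAt (p : M) : Fn 𝕜 m M →+* 𝕜 :=
  (Pi.evalRingHom (fun _ : M => 𝕜) p).comp (smoothFun 𝕜 m M).val.toRingHom

/-- Evaluation of sections at a point. -/
def secAt (p : M) : Sec 𝕜 m n M A →+ A p where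
  toFun x := x.1 p
  map_zero' := rfl
  map_add' _ _ := rfl

/-- Evaluation of dual sections at a point. -/
def dualSecAt (p : M) : DualSec 𝕜 m n M A →+ Module.Dual 𝕜 (A p) where
  toFun x := x.1 p
  map_zero' := rfl
  map_add' _ _ := rfl

/-- A top form has a value in each fibre, which is an alternating form. -/
theorem exists_fibre_form (Ω : ExteriorAlgebra (Fn 𝕜 m M) (DualSec 𝕜 m n M A)) (p : M) :
    ∃ w : A p [⋀^Fin n]→ₗ[𝕜] 𝕜, ∀ v : Fin n → Sec 𝕜 m n M A,
      (pair (duality 𝕜 m n M A) (ExteriorAlgebra.ιMulti (Fn 𝕜 m M) n v) Ω).1 p =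
        w fun i => (v i).1 p := by
  let φ : Fn 𝕜 m M →+* 𝕜 := evalAt p
  let E := ExteriorAlgebra 𝕜 (Module.Dual 𝕜 (A p))
  let _ : Algebra (Fn 𝕜 m M) E := ((algebraMap 𝕜 E).comp φ).toAlgebra' fun c x =>
    Algebra.commutes (φ c) x
  have hsm : ∀ (f : Fn 𝕜 m M) (x : E), f • x = f.1 p • x := fun f x => by
    rw [Algebra.smul_def, Algebra.smul_def]; rfl
  let ev : ExteriorAlgebra (Fn 𝕜 m M) (DualSec 𝕜 m n M A) →ₐ[Fn 𝕜 m M] E :=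
    ExteriorAlgebra.lift (Fn 𝕜 m M)
      ⟨{ toFun := fun θ => ExteriorAlgebra.ι 𝕜 (θ.1 p)
         map_add' := fun θ η => map_add (ExteriorAlgebra.ι 𝕜) (θ.1 p) (η.1 p)
         map_smul' := fun f θ => by
          rw [RingHom.id_apply, hsm]
          exact map_smul (ExteriorAlgebra.ι 𝕜) (f.1 p) (θ.1 p) },
        fun θ => ExteriorAlgebra.ι_sq_zero (θ.1 p)⟩
  have evι : ∀ θ : DualSec 𝕜 m n M A, ev (ExteriorAlgebra.ι _ θ) = ExteriorAlgebra.ι 𝕜 (θ.1 p) :=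
    fun θ => ExteriorAlgebra.lift_ι_apply ..
  have evc : ∀ f : Fn 𝕜 m M, ev (algebraMap _ _ f) = algebraMap 𝕜 E (f.1 p) :=
    fun f => ev.commutes f
  let b : A p →ₗ[𝕜] Module.Dual 𝕜 (A p) →ₗ[𝕜] 𝕜 := Module.Dual.eval 𝕜 (A p)
  have evcon : ∀ (x : Sec 𝕜 m n M A) w,
      ev (contract (duality 𝕜 m n M A x) w) = contract (b (x.1 p)) (ev w) := by
    intro x w
    induction w using CliffordAlgebra.left_induction with
    | algebraMap r =>
      have e := evc r
      change ev (algebraMap _ (CliffordAlgebra 0) r) = _ at e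
      rw [e]
      refine (congrArg ev (contract_algebraMap _ r)).trans ?_
      rw [map_zero]
      exact (contract_algebraMap _ _).symm
    | add a c ha hc => rw [map_add, map_add, ha, hc, map_add, map_add]
    | ι_mul a θ ha =>
      erw [contract_ι_mul, map_sub, map_smul, map_mul, map_mul, ha, evι, contract_ι_mul, hsm]
  have evint : ∀ (k : ℕ) (v : Fin k → Sec 𝕜 m n M A) w,
      ev (interior (duality 𝕜 m n M A) (ExteriorAlgebra.ιMulti _ k v) w) =
        interior b (ExteriorAlgebra.ιMulti 𝕜 k fun i => (v i).1 p) (ev w) := by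
    intro k
    induction k with
    | zero => intro v w; simp [interior]
    | succ k ih =>
      intro v w
      rw [ExteriorAlgebra.ιMulti_succ_apply, ExteriorAlgebra.ιMulti_succ_apply, interior_mul,
        interior_mul, ih, interior_ι, interior_ι, evcon]
      rfl
  have evinv : ∀ w, (ExteriorAlgebra.algebraMapInv w).1 p =
      ExteriorAlgebra.algebraMapInv (ev w) := by
    intro w
    induction w using ExteriorAlgebra.induction with
    | algebraMap r =>
      rw [evc, ExteriorAlgebra.algebraMap_leftInverse, ExteriorAlgebra.algebraMap_leftInverse]
    | ι θ =>
      rw [evι]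
      simp [ExteriorAlgebra.algebraMapInv]
      rfl
    | mul a c ha hc =>
      rw [map_mul, map_mul, map_mul, ← ha, ← hc]; rfl
    | add a c ha hc =>
      rw [map_add, map_add, map_add, ← ha, ← hc]; rfl
  let ℓ : ExteriorAlgebra 𝕜 (A p) →ₗ[𝕜] 𝕜 :=
    { toFun := fun U => pair b U (ev Ω)
      map_add' := fun U W => by simp [pair, interior]
      map_smul' := fun c U => by simp [pair, interior] }
  refine ⟨ℓ.compAlternatingMap (ExteriorAlgebra.ιMulti 𝕜 n), fun v => ?_⟩
  rw [pair, evinv, evint]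
  rfl

set_option linter.unusedSectionVars false in
theorem finrank_fibre (p : M) : Module.finrank 𝕜 (A p) = n := by
  have e := (trivializationAt (Fin n → 𝕜) A p).linearEquivAt 𝕜 p
    (FiberBundle.mem_baseSet_trivializationAt' p)
  rw [e.finrank_eq, Module.finrank_fin_fun]

set_option linter.unusedSectionVars false in
theorem smul_eq_sum_update {K E : Type*} [Field K] [AddCommGroup E] [Module K E] [Module.Finite K E]
    (hE : Module.finrank K E = n) (w : E [⋀^Fin n]→ₗ[K] K) (v : Fin n → E) (y : E) :
    (w v) ^ 2 • y = ∑ k, (w v * w (Function.update v k y)) • v k := by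
  classical
  by_cases h : w v = 0
  · simp [h]
  have hli : LinearIndependent K v := by
    by_contra hv
    exact h (w.map_linearDependent v hv)
  rcases Nat.eq_zero_or_pos n with rfl | hn
  · have : Subsingleton E := Module.finrank_zero_iff.mp hE
    exact Subsingleton.elim _ _
  have : Nonempty (Fin n) := ⟨⟨0, hn⟩⟩
  let bs := basisOfLinearIndependentOfCardEqFinrank hli (by simp [hE])
  have hbs : ∀ i, bs i = v i := fun i => by simp [bs]
  have hy : y = ∑ i, bs.repr y i • v i := by
    conv_lhs => rw [← bs.sum_repr y]
    simp [hbs]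
  have hc : ∀ k, w (Function.update v k y) = bs.repr y k * w v := fun k => by
    conv_lhs => rw [hy]
    rw [AlternatingMap.map_update_sum, Finset.sum_eq_single k]
    · simp
    · intro j _ hj
      rw [AlternatingMap.map_update_smul, AlternatingMap.map_update_self _ _ hj.symm, smul_zero]
    · simp
  simp only [hc]
  conv_lhs => rw [hy, Finset.smul_sum]
  refine Finset.sum_congr rfl fun i _ => ?_
  rw [smul_smul]
  congr 1; ring

/-- A pair of dual top sections provides a finite dual basis of `Γ(A)` and `Γ(A*)`. -/
theorem hasDualBasis_duality (Ω : ExteriorAlgebra (Fn 𝕜 m M) (DualSec 𝕜 m n M A))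
    (V : ExteriorAlgebra (Fn 𝕜 m M) (Sec 𝕜 m n M A)) (hV : V ∈ ⋀[Fn 𝕜 m M]^n (Sec 𝕜 m n M A))
    (hΩV : pair (duality 𝕜 m n M A) V Ω = 1) : HasDualBasis (duality 𝕜 m n M A) := by
  classical
  choose w hw using exists_fibre_form (n := n) Ω
  let F : (Fin n → Sec 𝕜 m n M A) → Fn 𝕜 m M := fun v =>
    pair (duality 𝕜 m n M A) (ExteriorAlgebra.ιMulti (Fn 𝕜 m M) n v) Ω
  let ℓ : ExteriorAlgebra (Fn 𝕜 m M) (Sec 𝕜 m n M A) →ₗ[Fn 𝕜 m M] Fn 𝕜 m M :=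
    { toFun := fun U => pair (duality 𝕜 m n M A) U Ω
      map_add' := fun U W => by simp [pair, interior]
      map_smul' := fun c U => by simp [pair, interior] }
  have htop : Ideal.span (Set.range F) = ⊤ := by
    rw [Ideal.eq_top_iff_one]
    have h1 : ℓ V ∈ Submodule.map ℓ (⋀[Fn 𝕜 m M]^n (Sec 𝕜 m n M A)) := ⟨V, hV, rfl⟩
    rw [← ExteriorAlgebra.ιMulti_span_fixedDegree, Submodule.map_span, ← Set.range_comp] at h1
    rw [← hΩV]
    exact h1
  have h1 : (1 : Fn 𝕜 m M) ∈ Submodule.span (Fn 𝕜 m M) ((fun x => x ^ 2) '' Set.range F) := by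
    have := Ideal.span_pow_eq_top _ htop 2
    rwa [Ideal.eq_top_iff_one] at this
  obtain ⟨N, h, g, hg⟩ := Submodule.mem_span_set'.mp h1
  have hg2 : ∀ j, ∃ v, F v ^ 2 = (g j : Fn 𝕜 m M) := fun j => by
    obtain ⟨_, ⟨v, rfl⟩, e⟩ := (g j).2
    exact ⟨v, e⟩
  choose v hv using hg2
  have hsum : ∀ p, ∑ j, (h j).1 p * ((w p) fun i => (v j i).1 p) ^ 2 = 1 := fun p => by
    have e : evalAt p (∑ j, h j • (g j : Fn 𝕜 m M)) = 1 := by rw [hg, map_one]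
    rw [map_sum] at e
    rw [← e]
    refine Finset.sum_congr rfl fun j _ => ?_
    rw [← hv, smul_eq_mul, map_mul, map_pow, ← hw]
    rfl
  have hup : ∀ (a : Fin n → Sec 𝕜 m n M A) (k : Fin n) (x : Sec 𝕜 m n M A) (p : M),
      (fun i => (Function.update a k x i).1 p) =
        Function.update (fun i => (a i).1 p) k (x.1 p) := fun a k x p => by
    funext i
    by_cases hi : i = k
    · subst hi; simp
    · simp [hi]
  let θ : Fin N → Fin n → DualSec 𝕜 m n M A := fun j k =>
    ⟨fun p => (w p).toMultilinearMap.toLinearMap (fun i => (v j i).1 p) k, fun u hu => by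
      have e := (F (Function.update (v j) k ⟨u, hu⟩)).2
      convert e using 1
      funext p
      change (w p) (Function.update _ _ _) = _
      refine Eq.trans ?_ (hw p _).symm
      exact congrArg (w p) (hup (v j) k ⟨u, hu⟩ p).symm⟩
  have hθ : ∀ j k p y, (θ j k).1 p y = w p (Function.update (fun i => (v j i).1 p) k y) :=
    fun _ _ _ _ => rfl
  have key : ∀ (p : M) (y : A p), y = ∑ jk : Fin N × Fin n,
      ((h jk.1).1 p * (F (v jk.1)).1 p * (θ jk.1 jk.2).1 p y) • (v jk.1 jk.2).1 p := by
    intro p y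
    have : Module.Finite 𝕜 (A p) := Module.Finite.equiv
      ((trivializationAt (Fin n → 𝕜) A p).linearEquivAt 𝕜 p
        (FiberBundle.mem_baseSet_trivializationAt' p)).symm
    rw [Fintype.sum_prod_type]
    conv_lhs => rw [← one_smul 𝕜 y, ← hsum p, Finset.sum_smul]
    refine Finset.sum_congr rfl fun j _ => ?_
    rw [mul_smul, smul_eq_sum_update (finrank_fibre p) (w p), Finset.smul_sum]
    refine Finset.sum_congr rfl fun k _ => ?_
    rw [smul_smul, hθ, ← hw, mul_assoc]
  refine ⟨Fin N × Fin n, inferInstance, fun jk => v jk.1 jk.2,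
    fun jk => (h jk.1 * F (v jk.1)) • θ jk.1 jk.2, fun x => ?_, fun η => ?_⟩
  · refine Subtype.ext (funext fun p => (key p (x.1 p)).trans ?_)
    exact (map_sum (secAt (𝕜 := 𝕜) (m := m) (n := n) (A := A) p)
      (fun jk : Fin N × Fin n => duality 𝕜 m n M A x ((h jk.1 * F (v jk.1)) • θ jk.1 jk.2) • v jk.1 jk.2)
      Finset.univ).symm
  · refine Subtype.ext (funext fun p => LinearMap.ext fun y => ?_)
    refine (congrArg (η.1 p) (key p y)).trans ((map_sum (η.1 p) _ _).trans ?_)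
    refine Eq.trans ?_ (DFunLike.congr_fun (map_sum (dualSecAt p) _ _).symm y)
    rw [LinearMap.sum_apply]
    refine Finset.sum_congr rfl fun jk _ => ?_
    rw [map_smul]
    exact mul_comm _ _

theorem differential_isDifferential (𝔞 : LieAlgebroid 𝕜 (Fn 𝕜 m M) (Sec 𝕜 m n M A))
    (𝔟 : LieAlgebroid 𝕜 (Fn 𝕜 m M) (DualSec 𝕜 m n M A))
    (Ω : ExteriorAlgebra (Fn 𝕜 m M) (DualSec 𝕜 m n M A))
    (V : ExteriorAlgebra (Fn 𝕜 m M) (Sec 𝕜 m n M A)) (hV : V ∈ ⋀[Fn 𝕜 m M]^n (Sec 𝕜 m n M A))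
    (hΩV : pair (duality 𝕜 m n M A) V Ω = 1) :
    IsDifferential 𝔞 (duality 𝕜 m n M A) (differential 𝔞 (duality 𝕜 m n M A)) ∧
      IsDifferential 𝔟 (duality 𝕜 m n M A).flip (differential 𝔟 (duality 𝕜 m n M A).flip) := by
  have h := hasDualBasis_duality Ω V hV hΩV
  refine ⟨differential_spec 𝔞 _ h, differential_spec 𝔟 _ ?_⟩
  obtain ⟨J, hJ, e, ε, he, hε⟩ := h
  exact ⟨J, hJ, ε, e, hε, he⟩

end Fibres

end LieAlgebroidPair

end

open LieAlgebroidPair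
open scoped Manifold ContDiff

/-! Everything rests on the isomorphism Ω^♯, which carries ∂ to d and d_* to ∂_* up to signs. Two
consequences govern the first six assertions.

First, ∂ generates the Schouten bracket (`bv_mul`): for a product with one section this is Cartan's
formula together with L_xΩ = -(∂x)Ω. Hence the failure of Δ to be a derivation is the failure of d_*
to be a derivation of the bracket (`laplacian_mul`), so 1 ⇔ 3, and dually 2 ⇔ 4.

Second, Δ_*Ω^♯ = Ω^♯Δ (`laplacian_sharp`). If Δ is half of a derivation D with dual derivation D',
then ΔV = 0 forces D'Ω = 0, so D' also corresponds to D under Ω^♯, and Δ_* is half of D'; this is 5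
⇔ 6 (`laplacian_flip_eq`). If Δ is a derivation, write θ = Ω^♯U; then ⟨θ, u⟩ = Ω^♯(U ∧ u), and 7
follows (`laplacian_pairing`).

For the last six, the defect of Δ on a product fu is [u, d_*f] - L_{df}u (`lapDefect`). Testing 7 on
(u, fθ) kills it. Testing 7 on (fu, θ) then shows that the derivation ρ(d_*f) + ρ_*(df) multiplies
each ⟨u, θ⟩ by Δ_*f - Δf, which is possible only if both vanish (`anchor_dFun_add_eq_zero`). So 7 ⇔
8.

The operator in 9 is a derivation of Γ(∧A*). On functions it is the defect paired with -θ, and it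
scales Ω by 2⟨d_*u, dθ⟩ plus the failure of 7. A function-linear derivation scales Ω by its trace,
whence 7 ⇔ 9 (`dorfman_iff`).

For 11, a vanishing defect means ρ_*(L_uθ) = [ρ(u), ρ_*(θ)] + ρ(i_θ d_*u). Both sides act on the
volume form s, where L_{ρ(u)}s = (⟨ξ₀, u⟩ - ∂u)s and dually. The result evaluates ⟨u, Δ_*θ⟩ - ⟨Δu,
θ⟩ - Δ_*⟨u, θ⟩; combined with 7 it leaves 2Δu (`laplacianCompatible_iff_modular`). Conversely, 11
makes the defect vanish, and the same identity returns 7. Since a derivation is determined by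
degrees zero and one, 3 ⇒ 7 ⇒ 11 yields 3 ⇒ 5.

All of this is algebra over the ring of functions, for two modules with a finite dual basis, dual
top elements and vanishing powers of degree n + 1 (`IsTopPair`). For bundles these properties come
from Cramer's rule with the functions Ω(v₁, …, v_n), which generate the unit ideal because ⟨Ω, V⟩ =
1. -/

noncomputable section

namespace LieAlgebroidPair

open ExteriorAlgebra (ι)

/-! ### Contractions between two exterior algebras in duality -/

section Contractions

variable {R L L' : Type*} [CommRing R] [AddCommGroup L] [Module R L] [AddCommGroup L'] [Module R L']

/-- Identities whose signs depend on the degree can be checked where `parity` is a scalar. -/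
theorem homogeneous_induction {p : ExteriorAlgebra R L → Prop}
    (h : ∀ k, ∀ u ∈ ⋀[R]^k L, p u) (hadd : ∀ u v, p u → p v → p (u + v))
    (u : ExteriorAlgebra R L) : p u := by
  classical
  refine DirectSum.Decomposition.inductionOn (fun k : ℕ => ⋀[R]^k L)
    (h 0 0 (Submodule.zero_mem _)) (fun {i} m => h i m m.2) hadd u

theorem algebraMap_mem_zero (r : R) : algebraMap R (ExteriorAlgebra R L) r ∈ ⋀[R]^0 L := by
  rw [ExteriorAlgebra.exteriorPower, pow_zero]
  exact Submodule.algebraMap_mem r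

theorem ι_mem_one (x : L) : ι R x ∈ ⋀[R]^1 L := by
  rw [ExteriorAlgebra.exteriorPower, pow_one]
  exact ⟨x, rfl⟩

theorem exists_of_mem_zero {u : ExteriorAlgebra R L} (hu : u ∈ ⋀[R]^0 L) :
    ∃ r, u = algebraMap R _ r := by
  rw [ExteriorAlgebra.exteriorPower, pow_zero, Submodule.mem_one] at hu
  obtain ⟨r, hr⟩ := hu
  exact ⟨r, hr.symm⟩

theorem exists_of_mem_one {u : ExteriorAlgebra R L} (hu : u ∈ ⋀[R]^1 L) : ∃ x, u = ι R x := by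
  rw [ExteriorAlgebra.exteriorPower, pow_one] at hu
  obtain ⟨r, hr⟩ := hu
  exact ⟨r, hr.symm⟩

theorem mul_mem_add {k l : ℕ} {u v : ExteriorAlgebra R L} (hu : u ∈ ⋀[R]^k L)
    (hv : v ∈ ⋀[R]^l L) : u * v ∈ ⋀[R]^(k + l) L := by
  rw [ExteriorAlgebra.exteriorPower, pow_add]
  exact Submodule.mul_mem_mul hu hv

theorem ι_mul_mem {k : ℕ} {u : ExteriorAlgebra R L} (x : L) (hu : u ∈ ⋀[R]^k L) :
    ι R x * u ∈ ⋀[R]^(k + 1) L :=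
  add_comm 1 k ▸ mul_mem_add (ι_mem_one x) hu

theorem mul_ι_eq (w : ExteriorAlgebra R L) (x : L) : w * ι R x = ι R x * parity w := by
  rw [ι_mul_eq, CliffordAlgebra.involute_involute]

theorem contract_eq_zero_of_mem_zero (φ : Module.Dual R L) {a : ExteriorAlgebra R L}
    (ha : a ∈ ⋀[R]^0 L) : contract φ a = 0 := by
  obtain ⟨r, rfl⟩ := exists_of_mem_zero ha
  exact contract_algebraMap _ _

theorem contract_mem (φ : Module.Dual R L) {k : ℕ} {a : ExteriorAlgebra R L}
    (ha : a ∈ ⋀[R]^k L) : ∀ j, k = j + 1 → contract φ a ∈ ⋀[R]^j L := by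
  induction ha using Submodule.pow_induction_on_left' with
  | algebraMap r => intro j hj; omega
  | add x y i hx hy ihx ihy =>
    intro j hj
    rw [map_add]
    exact Submodule.add_mem _ (ihx j hj) (ihy j hj)
  | mem_mul m hm i x hx ih =>
    intro j hj
    obtain ⟨y, rfl⟩ := hm
    obtain rfl : i = j := by omega
    rw [contract_ι_mul]
    refine Submodule.sub_mem _ (Submodule.smul_mem _ _ hx) ?_
    rcases i with _ | i
    · rw [contract_eq_zero_of_mem_zero φ hx, mul_zero]; exact Submodule.zero_mem _
    · exact ι_mul_mem y (ih i rfl)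

variable (B : L →ₗ[R] L' →ₗ[R] R)

theorem interior_algebraMap (r : R) (w : ExteriorAlgebra R L') :
    interior B (algebraMap R _ r) w = r • w := by
  simp only [interior, AlgHom.commutes]
  rfl

theorem interior_add (U W : ExteriorAlgebra R L) (w : ExteriorAlgebra R L') :
    interior B (U + W) w = interior B U w + interior B W w := by
  simp [interior]

theorem interior_zero (w : ExteriorAlgebra R L') : interior B 0 w = 0 := by
  simp [interior]

theorem interior_neg (U : ExteriorAlgebra R L) (w : ExteriorAlgebra R L') :
    interior B (-U) w = -interior B U w := by
  simp [interior]

theorem interior_sub (U W : ExteriorAlgebra R L) (w : ExteriorAlgebra R L') :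
    interior B (U - W) w = interior B U w - interior B W w := by
  simp [interior]

theorem interior_smul (r : R) (U : ExteriorAlgebra R L) (w : ExteriorAlgebra R L') :
    interior B (r • U) w = r • interior B U w := by
  simp [interior]

theorem interior_ι_mul (x : L) (U : ExteriorAlgebra R L) (w : ExteriorAlgebra R L') :
    interior B (ι R x * U) w = interior B U (contract (B x) w) := by
  rw [interior_mul, interior_ι]

theorem interior_mul_ι (x : L) (U : ExteriorAlgebra R L) (w : ExteriorAlgebra R L') :
    interior B (U * ι R x) w = contract (B x) (interior B U w) := by
  rw [interior_mul, interior_ι]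

theorem parity_interior (U : ExteriorAlgebra R L) (w : ExteriorAlgebra R L') :
    parity (interior B U w) = interior B (parity U) (parity w) := by
  induction U using ExteriorAlgebra.induction generalizing w with
  | algebraMap r => rw [interior_algebraMap, map_smul, AlgHom.commutes, interior_algebraMap]
  | ι x => rw [interior_ι, parity_contract, parity_ι, interior_neg, interior_ι]
  | mul a b ha hb => rw [interior_mul, hb, ha, map_mul, interior_mul]
  | add a b ha hb => rw [interior_add, map_add, ha, hb, map_add, interior_add]

theorem interior_mem {k : ℕ} {U : ExteriorAlgebra R L} (hU : U ∈ ⋀[R]^k L) :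
    ∀ (j : ℕ) (w : ExteriorAlgebra R L'), w ∈ ⋀[R]^(k + j) L' → interior B U w ∈ ⋀[R]^j L' := by
  induction hU using Submodule.pow_induction_on_left' with
  | algebraMap r =>
    intro j w hw
    rw [interior_algebraMap]
    rw [zero_add] at hw
    exact Submodule.smul_mem _ _ hw
  | add x y i hx hy ihx ihy =>
    intro j w hw
    rw [interior_add]
    exact Submodule.add_mem _ (ihx j w hw) (ihy j w hw)
  | mem_mul m hm i x hx ih =>
    intro j w hw
    obtain ⟨y, rfl⟩ := hm
    rw [interior_ι_mul]
    exact ih j _ (contract_mem _ hw _ (by simp only [Nat.succ_eq_add_one]; omega))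

theorem algebraMapInv_ι_mul (θ : L') (w : ExteriorAlgebra R L') :
    ExteriorAlgebra.algebraMapInv (ι R θ * w) = 0 := by
  rw [map_mul]
  simp [ExteriorAlgebra.algebraMapInv]

theorem pair_ι_mul (x : L) (U : ExteriorAlgebra R L) (w : ExteriorAlgebra R L') :
    pair B (ι R x * U) w = pair B U (contract (B x) w) := by
  rw [pair, interior_ι_mul, pair]

/-- Adjointness of multiplication and contraction, for the pairing read from the other side. Both
sides peel a factor θ off w by the product rule for contractions, and the induction hypothesis at
i_θ U compares the remaining terms. -/
theorem pair_flip_ι_mul (x : L) (U : ExteriorAlgebra R L) (w : ExteriorAlgebra R L') :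
    pair B.flip w (ι R x * U) = pair B.flip (contract (B x) w) U := by
  induction w using CliffordAlgebra.left_induction generalizing U with
  | algebraMap r =>
    erw [contract_algebraMap, pair, interior_algebraMap, map_smul, algebraMapInv_ι_mul, pair,
      interior_zero, map_zero, smul_zero]
  | add a b ha hb =>
    rw [map_add]
    simp only [pair] at *
    rw [interior_add, interior_add, map_add, map_add, ha, hb]
  | ι_mul a θ ha =>
    erw [pair_ι_mul, contract_ι_mul, contract_ι_mul]
    simp only [pair] at *
    rw [interior_sub, interior_smul, map_sub, map_sub, map_sub, map_smul, ha, interior_ι_mul]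
    simp

theorem algebraMapInv_interior_one (U : ExteriorAlgebra R L) :
    ExteriorAlgebra.algebraMapInv (interior B U 1) = ExteriorAlgebra.algebraMapInv U := by
  induction U using CliffordAlgebra.left_induction with
  | algebraMap r =>
    erw [interior_algebraMap, map_smul, map_one, AlgHom.commutes]
    simp
  | add a b ha hb => rw [interior_add, map_add, map_add, ha, hb]
  | ι_mul a x ha =>
    erw [interior_ι_mul, algebraMapInv_ι_mul]
    rw [← map_one (algebraMap R _), contract_algebraMap, map_zero, map_zero]

/-- By adjointness, peeling a section off U reduces both sides to the contracted form. This symmetry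
allows each later result to be reused with the two modules exchanged. -/
theorem pair_flip (U : ExteriorAlgebra R L) (w : ExteriorAlgebra R L') :
    pair B.flip w U = pair B U w := by
  induction U using CliffordAlgebra.left_induction generalizing w with
  | algebraMap r =>
    erw [pair, pair, interior_algebraMap, Algebra.algebraMap_eq_smul_one, map_smul, map_smul,
      algebraMapInv_interior_one, map_smul]
  | add a b ha hb =>
    rw [pair_add, ha, hb]
    simp [pair, interior_add]
  | ι_mul a x ha =>
    erw [pair_flip_ι_mul, pair_ι_mul, ha]

/-- In equal degrees the contraction is already a function, so taking its degree-zero part loses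
nothing. -/
theorem pair_eq_of_mem {k : ℕ} {U : ExteriorAlgebra R L} {w : ExteriorAlgebra R L'}
    (hU : U ∈ ⋀[R]^k L) (hw : w ∈ ⋀[R]^k L') : interior B U w = algebraMap R _ (pair B U w) := by
  obtain ⟨r, hr⟩ := exists_of_mem_zero (interior_mem B hU 0 w hw)
  rw [pair, hr, AlgHom.commutes]
  rfl

end Contractions

/-! ### Dual pairs of derivations of degree zero -/

section Derivations

variable {R L L' : Type*} [CommRing R] [AddCommGroup L'] [Module R L'] [AddCommGroup L] [Module R L]

/-- Derivations of degree zero of the two exterior algebras that are dual to each other: both act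
on functions by `Y`, and they satisfy the Leibniz rule for the pairing of sections. -/
structure IsDualDerivation (B : L →ₗ[R] L' →ₗ[R] R) (Y : R → R)
    (D : ExteriorAlgebra R L →+ ExteriorAlgebra R L)
    (D' : ExteriorAlgebra R L' →+ ExteriorAlgebra R L') : Prop where
  map_fun : ∀ f, D (algebraMap R _ f) = algebraMap R _ (Y f)
  map_fun' : ∀ f, D' (algebraMap R _ f) = algebraMap R _ (Y f)
  map_mul : ∀ a b, D (a * b) = D a * b + a * D b
  map_mul' : ∀ a b, D' (a * b) = D' a * b + a * D' b
  degree : ∀ x, D (ι R x) ∈ ⋀[R]^1 L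
  degree' : ∀ θ, D' (ι R θ) ∈ ⋀[R]^1 L'
  pairing : ∀ x θ, pair B (D (ι R x)) (ι R θ) + pair B (ι R x) (D' (ι R θ)) = Y (B x θ)

namespace IsDualDerivation

variable {B : L →ₗ[R] L' →ₗ[R] R} {Y : R → R} {D : ExteriorAlgebra R L →+ ExteriorAlgebra R L}
  {D' : ExteriorAlgebra R L' →+ ExteriorAlgebra R L'} (h : IsDualDerivation B Y D D')

include h

theorem flip : IsDualDerivation B.flip Y D' D where
  map_fun := h.map_fun'
  map_fun' := h.map_fun
  map_mul := h.map_mul'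
  map_mul' := h.map_mul
  degree := h.degree'
  degree' := h.degree
  pairing θ x := by
    rw [pair_flip, pair_flip, add_comm]
    exact h.pairing x θ

theorem smul (f : R) (a : ExteriorAlgebra R L) : D (f • a) = Y f • a + f • D a := by
  rw [Algebra.smul_def, h.map_mul, h.map_fun, ← Algebra.smul_def, ← Algebra.smul_def]

theorem mem {k : ℕ} {a : ExteriorAlgebra R L} (ha : a ∈ ⋀[R]^k L) : D a ∈ ⋀[R]^k L := by
  induction ha using Submodule.pow_induction_on_left' with
  | algebraMap r => rw [h.map_fun]; exact algebraMap_mem_zero _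
  | add x y i hx hy ihx ihy => rw [map_add]; exact Submodule.add_mem _ ihx ihy
  | mem_mul m hm i x hx ih =>
    obtain ⟨y, rfl⟩ := hm
    rw [h.map_mul]
    refine Submodule.add_mem _ ?_ (ι_mul_mem y ih)
    rw [Nat.succ_eq_add_one, add_comm]
    exact mul_mem_add (h.degree y) hx

theorem contract_comm (x : L) (w : ExteriorAlgebra R L') :
    D' (contract (B x) w) = interior B (D (ι R x)) w + contract (B x) (D' w) := by
  obtain ⟨y, hy⟩ := exists_of_mem_one (h.degree x)
  rw [hy, interior_ι]
  induction w using CliffordAlgebra.left_induction with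
  | algebraMap r =>
    erw [h.map_fun', contract_algebraMap, contract_algebraMap, contract_algebraMap]
    simp
  | add a b ha hb => rw [map_add, map_add, ha, hb, map_add, map_add, map_add]; abel
  | ι_mul a θ ha =>
    -- The Leibniz rule for ⟨x, θ⟩ accounts for the term in which D' differentiates the coefficient
    -- of a.
    have hp := h.pairing x θ
    obtain ⟨η, hη⟩ := exists_of_mem_one (h.degree' θ)
    rw [hy, hη, pair_ι_ι, pair_ι_ι] at hp
    erw [contract_ι_mul, contract_ι_mul, h.map_mul', hη, map_sub, map_add, h.map_mul', ha,
      contract_ι_mul, contract_ι_mul, h.flip.smul, hη, ← hp]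
    rw [add_smul, mul_add]
    abel

/-- Dual derivations satisfy the Leibniz rule for contractions. -/
theorem interior_comm (U : ExteriorAlgebra R L) (w : ExteriorAlgebra R L') :
    D' (interior B U w) = interior B (D U) w + interior B U (D' w) := by
  induction U using ExteriorAlgebra.induction generalizing w with
  | algebraMap r =>
    rw [interior_algebraMap, h.map_fun, interior_algebraMap, interior_algebraMap, h.flip.smul]
  | ι x => rw [interior_ι, h.contract_comm]
  | mul a b ha hb =>
    rw [interior_mul, hb, ha, h.map_mul, interior_add, interior_mul, interior_mul, interior_mul,
      map_add]
    abel
  | add a b ha hb =>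
    rw [interior_add, map_add, ha, hb, map_add, interior_add, interior_add]; abel

theorem add {Y₂ : R → R} {D₂ : ExteriorAlgebra R L →+ ExteriorAlgebra R L}
    {D₂' : ExteriorAlgebra R L' →+ ExteriorAlgebra R L'} (h₂ : IsDualDerivation B Y₂ D₂ D₂') :
    IsDualDerivation B (fun f => Y f + Y₂ f) (D + D₂) (D' + D₂') where
  map_fun f := by simp [h.map_fun, h₂.map_fun]
  map_fun' f := by simp [h.map_fun', h₂.map_fun']
  map_mul a b := by
    simp only [AddMonoidHom.add_apply, h.map_mul, h₂.map_mul, add_mul, mul_add]; abel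
  map_mul' a b := by
    simp only [AddMonoidHom.add_apply, h.map_mul', h₂.map_mul', add_mul, mul_add]; abel
  degree x := Submodule.add_mem _ (h.degree x) (h₂.degree x)
  degree' x := Submodule.add_mem _ (h.degree' x) (h₂.degree' x)
  pairing x θ := by
    rw [← h.pairing, ← h₂.pairing]
    simp only [AddMonoidHom.add_apply, pair, interior_add, map_add]
    ring

end IsDualDerivation

end Derivations

/-! ### Cartan calculus and the Schouten bracket -/

section Cartan

variable {𝕜 R L L' : Type*} [Field 𝕜] [CommRing R] [Algebra 𝕜 R]
  [AddCommGroup L] [Module R L] [AddCommGroup L'] [Module R L']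
  {𝔞 : LieAlgebroid 𝕜 R L} {B : L →ₗ[R] L' →ₗ[R] R}

namespace IsDifferential

variable {D : ExteriorAlgebra R L' →+ ExteriorAlgebra R L'} (hD : IsDifferential 𝔞 B D)

include hD

theorem map_mul (a b : ExteriorAlgebra R L') : D (a * b) = D a * b + parity a * D b := by
  induction a using homogeneous_induction with
  | h k u hu => rw [hD.derivation k u hu, parity_of_mem hu, smul_mul_assoc]
  | hadd u v hu hv => rw [add_mul, map_add, hu, hv, map_add, map_add]; noncomm_ring

theorem smul (f : R) (a : ExteriorAlgebra R L') :
    D (f • a) = D (algebraMap R _ f) * a + f • D a := by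
  rw [Algebra.smul_def, hD.map_mul, AlgHom.commutes, ← Algebra.smul_def]

theorem map_one : D 1 = 0 := by
  have h := hD.map_mul 1 1
  rw [_root_.map_one parity, mul_one, mul_one, one_mul] at h
  exact left_eq_add.mp h

theorem mem {k : ℕ} {a : ExteriorAlgebra R L'} (ha : a ∈ ⋀[R]^k L') : D a ∈ ⋀[R]^(k + 1) L' := by
  induction ha using Submodule.pow_induction_on_left' with
  | algebraMap r => exact hD.degree_fun r
  | add x y i hx hy ihx ihy => rw [map_add]; exact Submodule.add_mem _ ihx ihy
  | mem_mul m hm i x hx ih =>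
    obtain ⟨y, rfl⟩ := hm
    rw [hD.map_mul, parity_ι, neg_mul]
    refine Submodule.add_mem _ ?_ (Submodule.neg_mem _ (ι_mul_mem y ih))
    have h := mul_mem_add (hD.degree_section y) hx
    rwa [add_comm 2 i] at h

theorem parity_apply (a : ExteriorAlgebra R L') : parity (D a) = -D (parity a) := by
  induction a using homogeneous_induction with
  | h k u hu =>
    rw [parity_of_mem (hD.mem hu), parity_of_mem hu]
    rcases Nat.even_or_odd k with hk | hk
    · simp [hk.neg_one_pow, hk.add_one.neg_one_pow]
    · simp [hk.neg_one_pow, hk.add_one.neg_one_pow]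
  | hadd u v hu hv => rw [map_add, map_add, hu, hv, map_add, map_add]; abel

theorem exists_fun (f : R) :
    ∃ φ, D (algebraMap R _ f) = ι R φ ∧ ∀ x, B x φ = 𝔞.anchor x f := by
  obtain ⟨φ, hφ⟩ := exists_of_mem_one (hD.degree_fun f)
  refine ⟨φ, hφ, fun x => ?_⟩
  rw [← hD.eval_fun, hφ, pair_ι_ι]

end IsDifferential

variable [CharZero 𝕜] (𝔞)

theorem schouten_ι_mul (x : L) (a b : ExteriorAlgebra R L) :
    schouten 𝔞 (ι R x) (a * b) = schouten 𝔞 (ι R x) a * b + a * schouten 𝔞 (ι R x) b := by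
  induction a using homogeneous_induction with
  | h k u hu =>
    rw [(schouten_spec 𝔞).leibniz 1 k _ (ι_mem_one x) u hu, pow_mul]
    simp
  | hadd u v hu hv => rw [add_mul, map_add, hu, hv, map_add]; noncomm_ring

/-- Both sides are derivations twisted by the parity, so functions and sections suffice; on sections
the minus sign comes from skew-symmetry. -/
theorem schouten_algebraMap (f : R) (a : ExteriorAlgebra R L) :
    schouten 𝔞 (algebraMap R _ f) a = -contract (anchorDual 𝔞 f) a := by
  refine DFunLike.congr_fun (show schouten 𝔞 (algebraMap R _ f) =
    -(contract (anchorDual 𝔞 f)).toAddMonoidHom from ?_) a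
  refine twisted_derivation_ext parity (fun g => ?_) (fun z => ?_) (fun a b => ?_) (fun a b => ?_)
  · simp [(schouten_spec 𝔞).fun_fun]
  · rw [(schouten_spec 𝔞).skew 0 1 _ (algebraMap_mem_zero f) _ (ι_mem_one z),
      (schouten_spec 𝔞).section_fun]
    simp [anchorDual_apply]
  · induction a using homogeneous_induction with
    | h k u hu =>
      rw [(schouten_spec 𝔞).leibniz 0 k _ (algebraMap_mem_zero f) u hu, parity_of_mem hu]
      simp [add_comm]
    | hadd u v hu hv => rw [add_mul, map_add, hu, hv, map_add, map_add]; noncomm_ring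
  · simp only [AddMonoidHom.neg_apply, LinearMap.toAddMonoidHom_coe, contract_mul]
    noncomm_ring

theorem schouten_ι_mem (x : L) {k : ℕ} {a : ExteriorAlgebra R L} (ha : a ∈ ⋀[R]^k L) :
    schouten 𝔞 (ι R x) a ∈ ⋀[R]^k L := by
  induction ha using Submodule.pow_induction_on_left' with
  | algebraMap r => rw [(schouten_spec 𝔞).section_fun]; exact algebraMap_mem_zero _
  | add x y i hx hy ihx ihy => rw [map_add]; exact Submodule.add_mem _ ihx ihy
  | mem_mul m hm i u hu ih =>
    obtain ⟨y, rfl⟩ := hm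
    rw [schouten_ι_mul, (schouten_spec 𝔞).section_section]
    exact Submodule.add_mem _ (ι_mul_mem _ hu) (ι_mul_mem y ih)

/-- `IsSchouten` provides the Leibniz rule in the second argument only. The rule in the first
follows from graded skew-symmetry: swap, expand, swap back. -/
theorem schouten_mul_left (x : L) (c b : ExteriorAlgebra R L) :
    schouten 𝔞 (ι R x * c) b =
      ι R x * schouten 𝔞 c b + parity c * schouten 𝔞 (ι R x) b := by
  induction c using homogeneous_induction with
  | h i c hc =>
    induction b using homogeneous_induction with
    | h l b hb =>
      have S := schouten_spec 𝔞
      -- The bracket [x, b] has the degree l of b, so it passes c with the sign (-1)^(il).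
      have hcomm : schouten 𝔞 (ι R x) b * c =
          (-1 : R) ^ (i * l) • (c * schouten 𝔞 (ι R x) b) := by
        have hp := parity_of_mem hc
        rcases Nat.even_or_odd i with hi | hi
        · rw [hi.neg_one_pow, one_smul] at hp
          rw [even_mul_comm hp, (hi.mul_right l).neg_one_pow, one_smul]
        · rw [hi.neg_one_pow, neg_smul, one_smul] at hp
          rw [← odd_mul_comm hp, parity_of_mem (schouten_ι_mem 𝔞 x hb), smul_mul_assoc, smul_smul,
            ← pow_add, Even.neg_one_pow, one_smul]
          rcases Nat.even_or_odd l with hl | hl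
          · exact (hl.mul_left i).add hl
          · exact (hi.mul hl).add_odd hl
      rw [S.skew (i + 1) l _ (ι_mul_mem x hc) b hb, S.leibniz l 1 b hb _ (ι_mem_one x),
        S.skew l 1 b hb _ (ι_mem_one x), S.skew l i b hb c hc, parity_of_mem hc, neg_mul,
        smul_mul_assoc, hcomm]
      rcases Nat.even_or_odd i with hi | hi <;> rcases Nat.even_or_odd l with hl | hl <;>
      simp [hi, hl, pow_mul, pow_add]
    | hadd u v hu hv => rw [map_add, hu, hv, map_add, map_add]; noncomm_ring
  | hadd u v hu hv =>
    rw [mul_add, map_add, AddMonoidHom.add_apply, hu, hv, map_add, AddMonoidHom.add_apply, map_add]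
    noncomm_ring

variable {𝔞}

/-- On forms, the anticommutator of the antiderivations i_x and d is a derivation; its duality with
[x, ·] is the formula for dθ(x, y). Through `interior_comm` this yields the Leibniz rule L_x i_U =
i_{[x, U]} + i_U L_x. -/
theorem lie_isDualDerivation (hB : HasDualBasis B) (x : L) :
    IsDualDerivation B (𝔞.anchor x) (lieMulti 𝔞 x) (lieForm 𝔞 B x) := by
  have hD := differential_spec 𝔞 B hB
  have hl : ∀ a, lieForm 𝔞 B x a =
    contract (B x) (differential 𝔞 B a) + differential 𝔞 B (contract (B x) a) := fun a => rfl
  have hm : ∀ a, lieMulti 𝔞 x a = schouten 𝔞 (ι R x) a := fun a => rfl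
  refine ⟨(schouten_spec 𝔞).section_fun x, fun f => ?_, schouten_ι_mul 𝔞 x, fun a b => ?_,
    fun y => ?_, fun θ => ?_, fun y θ => ?_⟩
  · obtain ⟨φ, h1, h2⟩ := hD.exists_fun f
    rw [hl, h1, contract_ι, h2, contract_algebraMap, map_zero, add_zero]
  · simp only [hl, hD.map_mul, contract_mul, map_add, parity_contract, hD.parity_apply,
      CliffordAlgebra.involute_involute]
    noncomm_ring
  · rw [hm, (schouten_spec 𝔞).section_section]
    exact ι_mem_one _
  · rw [hl, contract_ι]
    exact Submodule.add_mem _ (contract_mem _ (hD.degree_section θ) 1 rfl) (hD.degree_fun _)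
  · rw [hm, (schouten_spec 𝔞).section_section, hl, contract_ι, pair_add, hD.eval_fun, pair_ι_ι,
      pair, interior_ι, ← interior_ι B x, ← interior_ι B y, ← interior_mul]
    change _ + (pair B _ _ + _) = _
    rw [hD.eval_section]
    ring

end Cartan

/-! ### Dual top sections and the isomorphism Ω^♯ -/

theorem HasDualBasis.flip {R L L' : Type*} [CommRing R] [AddCommGroup L] [Module R L]
    [AddCommGroup L'] [Module R L'] {B : L →ₗ[R] L' →ₗ[R] R} (hB : HasDualBasis B) :
    HasDualBasis B.flip := by
  obtain ⟨J, hJ, e, ε, he, hε⟩ := hB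
  exact ⟨J, hJ, ε, e, hε, he⟩

/-- Since i_{U ∧ x} = i_x i_U, a factor added on the right of U acts last, directly on Ω^♯U.
Inductions about Ω^♯ therefore run from the right. -/
theorem right_induction {R L : Type*} [CommRing R] [AddCommGroup L] [Module R L]
    {p : ExteriorAlgebra R L → Prop} (algebraMap : ∀ r, p (algebraMap R _ r))
    (add : ∀ a b, p a → p b → p (a + b)) (mul_ι : ∀ a x, p a → p (a * ι R x))
    (u : ExteriorAlgebra R L) : p u :=
  CliffordAlgebra.right_induction (P := p) 0 algebraMap add (fun x a => mul_ι a x) u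

/-- Dual nowhere vanishing top sections `Ω` and `V` of two dual bundles of rank `n`. -/
structure IsTopPair {R L L' : Type*} [CommRing R] [AddCommGroup L] [Module R L]
    [AddCommGroup L'] [Module R L'] (B : L →ₗ[R] L' →ₗ[R] R) (n : ℕ)
    (Ω : ExteriorAlgebra R L') (V : ExteriorAlgebra R L) : Prop where
  dual : HasDualBasis B
  form_mem : Ω ∈ ⋀[R]^n L'
  multi_mem : V ∈ ⋀[R]^n L
  pair_eq_one : pair B V Ω = 1
  multi_top : ∀ u ∈ ⋀[R]^(n + 1) L, u = 0
  form_top : ∀ u ∈ ⋀[R]^(n + 1) L', u = 0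

namespace IsTopPair

section Sharp

variable {R L L' : Type*} [CommRing R] [AddCommGroup L] [Module R L]
  [AddCommGroup L'] [Module R L'] {B : L →ₗ[R] L' →ₗ[R] R} {n : ℕ}
  {Ω : ExteriorAlgebra R L'} {V : ExteriorAlgebra R L} (h : IsTopPair B n Ω V)

include h

theorem flip : IsTopPair B.flip n V Ω where
  dual := h.dual.flip
  form_mem := h.multi_mem
  multi_mem := h.form_mem
  pair_eq_one := by rw [pair_flip, h.pair_eq_one]
  multi_top := h.form_top
  form_top := h.multi_top

theorem ι_mul_form (θ : L') : ι R θ * Ω = 0 := h.form_top _ (ι_mul_mem θ h.form_mem)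

/-- Contraction is an antiderivation and θ ∧ Ω = 0, so moving θ through the contractions leaves only
its pairings with the factors of U. Thus Ω^♯ turns multiplication into contraction. -/
theorem ι_mul_sharp (θ : L') (U : ExteriorAlgebra R L) :
    ι R θ * sharp B Ω U = sharp B Ω (parity (contract (B.flip θ) U)) := by
  simp only [sharp]
  induction U using right_induction with
  | algebraMap r =>
    rw [interior_algebraMap, mul_smul_comm, h.ι_mul_form, contract_algebraMap, map_zero,
      interior_zero, smul_zero]
  | add a b ha hb => rw [interior_add, mul_add, ha, hb, map_add, map_add, interior_add]
  | mul_ι a x ha =>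
    have e : ι R θ * contract (B x) (interior B a Ω) =
        B x θ • interior B a Ω - contract (B x) (ι R θ * interior B a Ω) := by
      rw [contract_ι_mul]; abel
    rw [interior_mul_ι, e, ha, contract_mul, contract_ι, map_add, map_mul, map_mul, interior_add,
      CliffordAlgebra.involute_involute, AlgHom.commutes, parity_ι, mul_neg, interior_neg,
      interior_mul_ι, interior_mul, interior_algebraMap, sub_eq_add_neg, LinearMap.flip_apply]

theorem parity_sharp (U : ExteriorAlgebra R L) :
    parity (sharp B Ω U) = (-1 : R) ^ n • sharp B Ω (parity U) := by
  rw [sharp, parity_interior, parity_of_mem h.form_mem, map_smul, sharp]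

theorem sharp_form : sharp B.flip V Ω = 1 := by
  rw [sharp, pair_eq_of_mem B.flip h.form_mem h.multi_mem, h.flip.pair_eq_one, map_one]

theorem sharp_multi : sharp B Ω V = 1 := h.flip.sharp_form

/-- One map turns multiplication by a section into contraction and the other turns it back, so the
composite is the identity up to the sign (-1)^(k(n+1)) in degree k. -/
theorem sharp_sharp (U : ExteriorAlgebra R L) :
    sharp B.flip V (sharp B Ω U) = if Even n then parity U else U := by
  induction U using right_induction with
  | algebraMap r =>
    have e := h.sharp_form
    simp only [sharp] at e ⊢
    rw [AlgHom.commutes, ite_self, interior_algebraMap, interior_smul, e,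
      Algebra.algebraMap_eq_smul_one]
  | add a b ha hb =>
    have e : sharp B.flip V (sharp B Ω (a + b)) =
      sharp B.flip V (sharp B Ω a) + sharp B.flip V (sharp B Ω b) := by
      simp only [sharp, interior_add]
    rw [e, ha, hb]
    split_ifs <;> simp
  | mul_ι a x ha =>
    -- The contraction takes the shape in which `ι_mul_sharp`, with the modules exchanged, turns it
    -- into multiplication by x.
    have e : sharp B Ω (a * ι R x) = -parity (contract (B x) (parity (sharp B Ω a))) := by
      rw [parity_contract, CliffordAlgebra.involute_involute, neg_neg, sharp, interior_mul_ι, sharp]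
    have e3 : sharp B.flip V (-parity (contract (B x) (parity (sharp B Ω a)))) =
        -(ι R x * sharp B.flip V (parity (sharp B Ω a))) := by
      rw [h.flip.ι_mul_sharp]
      simp only [sharp]
      rw [interior_neg]
      rfl
    have e4 : sharp B.flip V (parity (sharp B Ω a)) =
        (-1 : R) ^ n • parity (sharp B.flip V (sharp B Ω a)) := by
      rw [h.flip.parity_sharp, smul_smul, ← mul_pow]
      simp
    rw [e, e3, e4, ha, map_mul, parity_ι]
    split_ifs with hn
    · rw [CliffordAlgebra.involute_involute, hn.neg_one_pow, one_smul, ι_mul_eq, mul_neg]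
    · rw [Nat.not_even_iff_odd] at hn
      rw [hn.neg_one_pow, neg_smul, one_smul, mul_neg, neg_neg, ι_mul_eq,
        CliffordAlgebra.involute_involute]

theorem sharp_injective : Function.Injective (sharp B Ω : ExteriorAlgebra R L → _) := by
  intro U W hUW
  have e := h.sharp_sharp U
  rw [hUW, h.sharp_sharp W] at e
  split_ifs at e with hn
  · exact (CliffordAlgebra.involute_involutive.injective e).symm
  · exact e.symm

theorem sharp_surjective : Function.Surjective (sharp B Ω : ExteriorAlgebra R L → _) := by
  intro w
  have e := h.flip.sharp_sharp
  by_cases hn : Even n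
  · refine ⟨sharp B.flip V (parity w), ?_⟩
    have := e (parity w)
    rwa [if_pos hn, CliffordAlgebra.involute_involute] at this
  · refine ⟨sharp B.flip V w, ?_⟩
    have := e w
    rwa [if_neg hn] at this

/-- This is `ι_mul_sharp` applied twice. The sign left by the parities cancels the one from
reordering the two contractions. -/
theorem mul_sharp_of_mem_two {w : ExteriorAlgebra R L'} (hw : w ∈ ⋀[R]^2 L')
    (U : ExteriorAlgebra R L) : w * sharp B Ω U = sharp B Ω (interior B.flip w U) := by
  rw [ExteriorAlgebra.exteriorPower, pow_two] at hw
  induction hw using Submodule.mul_induction_on' with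
  | mem_mul_mem a ha b hb =>
    obtain ⟨θ, rfl⟩ := ha
    obtain ⟨η, rfl⟩ := hb
    rw [mul_assoc, h.ι_mul_sharp, h.ι_mul_sharp, interior_mul, interior_ι, interior_ι,
      parity_contract, CliffordAlgebra.involute_involute, CliffordAlgebra.contractLeft_comm, neg_neg]
  | add x hx y hy h1 h2 =>
    rw [add_mul, h1, h2]
    simp only [sharp, interior_add]

/-- V^♯ is injective and sends a top form to its value on V. -/
theorem eq_smul_of_mem {w : ExteriorAlgebra R L'} (hw : w ∈ ⋀[R]^n L') :
    w = pair B V w • Ω := by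
  apply h.flip.sharp_injective
  simp only [sharp]
  rw [interior_smul, pair_eq_of_mem B.flip hw h.multi_mem, pair_flip]
  have := h.sharp_form
  rw [sharp] at this
  rw [this, Algebra.algebraMap_eq_smul_one]

theorem smul_form_injective {r : R} (hr : r • Ω = 0) : r = 0 := by
  have e := congrArg (pair B V) hr
  rw [pair_smul, h.pair_eq_one, mul_one] at e
  simpa [pair] using e

/-- For n > 0 every term of Ω contains a one-form, so r annihilates Ω, and ⟨Ω, V⟩ = 1 gives r = 0.
In rank zero there are no nonzero one-forms to test r. -/
theorem eq_zero_of_smul_ι (hn : n ≠ 0) {r : R} (hr : ∀ θ : L', r • ι R θ = 0) : r = 0 := by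
  apply h.smul_form_injective
  obtain ⟨k, rfl⟩ := Nat.exists_eq_succ_of_ne_zero hn
  have hm := h.form_mem
  clear h
  rw [ExteriorAlgebra.exteriorPower, pow_succ'] at hm
  induction hm using Submodule.mul_induction_on' with
  | mem_mul_mem a ha b hb =>
    obtain ⟨θ, rfl⟩ := ha
    rw [← smul_mul_assoc, hr, zero_mul]
  | add x hx y hy h1 h2 => rw [smul_add, h1, h2, add_zero]

theorem section_eq_zero (hn : n = 0) (x : L) : x = 0 := by
  subst hn
  apply (ExteriorAlgebra.ι_inj R x 0).mp
  rw [map_zero]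
  exact h.multi_top _ (ι_mem_one x)

end Sharp

/-! ### The operator ∂ defined by Ω -/

section BV

set_option linter.unusedSectionVars false

variable {𝕜 R L L' : Type*} [Field 𝕜] [CharZero 𝕜] [CommRing R] [Algebra 𝕜 R]
  [AddCommGroup L] [Module R L] [AddCommGroup L'] [Module R L'] {B : L →ₗ[R] L' →ₗ[R] R} {n : ℕ}
  {Ω : ExteriorAlgebra R L'} {V : ExteriorAlgebra R L} (h : IsTopPair B n Ω V)
  (𝔞 : LieAlgebroid 𝕜 R L)

include h

theorem differential_form : differential 𝔞 B Ω = 0 :=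
  h.form_top _ ((differential_spec 𝔞 B h.dual).mem h.form_mem)

/-- `bv` is built with `Function.invFun`; surjectivity of Ω^♯ makes its value a true preimage. -/
theorem sharp_bv (u : ExteriorAlgebra R L) :
    sharp B Ω (bv 𝔞 B Ω u) = differential 𝔞 B (sharp B Ω (parity u)) :=
  Function.invFun_eq (h.sharp_surjective _)

theorem differential_sharp (u : ExteriorAlgebra R L) :
    differential 𝔞 B (sharp B Ω u) = sharp B Ω (bv 𝔞 B Ω (parity u)) := by
  rw [h.sharp_bv, CliffordAlgebra.involute_involute]

theorem bv_add (u v : ExteriorAlgebra R L) :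
    bv 𝔞 B Ω (u + v) = bv 𝔞 B Ω u + bv 𝔞 B Ω v := by
  apply h.sharp_injective
  have e : ∀ a b, sharp B Ω (a + b) = sharp B Ω a + sharp B Ω b := fun a b => interior_add B a b Ω
  rw [e, h.sharp_bv, h.sharp_bv, h.sharp_bv, map_add, e, map_add]

theorem bv_neg (u : ExteriorAlgebra R L) : bv 𝔞 B Ω (-u) = -bv 𝔞 B Ω u :=
  map_neg (AddMonoidHom.mk' (bv 𝔞 B Ω) (h.bv_add 𝔞)) u

theorem bv_zero : bv 𝔞 B Ω (0 : ExteriorAlgebra R L) = 0 :=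
  map_zero (AddMonoidHom.mk' (bv 𝔞 B Ω) (h.bv_add 𝔞))

theorem parity_bv (u : ExteriorAlgebra R L) :
    parity (bv 𝔞 B Ω u) = -bv 𝔞 B Ω (parity u) := by
  apply h.sharp_injective
  have e1 : sharp B Ω (-bv 𝔞 B Ω (parity u)) = -sharp B Ω (bv 𝔞 B Ω (parity u)) :=
    interior_neg B _ Ω
  have e2 : ∀ a, sharp B Ω (parity a) = (-1 : R) ^ n • parity (sharp B Ω a) := fun a => by
    rw [h.parity_sharp, smul_smul, ← mul_pow]; simp
  have hD := differential_spec 𝔞 B h.dual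
  rw [e1, e2, h.sharp_bv, h.sharp_bv, hD.parity_apply, h.parity_sharp]
  rcases Nat.even_or_odd n with hn | hn <;> simp [hn.neg_one_pow]

theorem bv_algebraMap (f : R) : bv 𝔞 B Ω (algebraMap R _ f) = 0 := by
  apply h.sharp_injective
  have hD := differential_spec 𝔞 B h.dual
  obtain ⟨φ, hφ, _⟩ := hD.exists_fun f
  rw [h.sharp_bv, AlgHom.commutes]
  simp only [sharp]
  rw [interior_algebraMap, hD.smul, h.differential_form, hφ, h.ι_mul_form, interior_zero]
  simp

/-- Degrees can be counted through Ω^♯: l + 1 becomes n - l - 1, then n - l under d, and V^♯, which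
undoes Ω^♯ up to parity, returns degree l. -/
theorem bv_mem {l : ℕ} {u : ExteriorAlgebra R L} (hu : u ∈ ⋀[R]^(l + 1) L) :
    bv 𝔞 B Ω u ∈ ⋀[R]^l L := by
  have hD := differential_spec 𝔞 B h.dual
  rcases le_or_gt (l + 1) n with hl | hl
  · obtain ⟨j, rfl⟩ := Nat.exists_eq_add_of_le hl
    have h1 : sharp B Ω (bv 𝔞 B Ω u) ∈ ⋀[R]^(j + 1) L' := by
      rw [h.sharp_bv, parity_of_mem hu]
      exact hD.mem (interior_mem B (Submodule.smul_mem _ _ hu) j Ω h.form_mem)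
    have hV := h.multi_mem
    rw [show l + 1 + j = j + 1 + l by ring] at hV
    have h2 := interior_mem B.flip h1 l V hV
    change sharp B.flip V _ ∈ _ at h2
    rw [h.sharp_sharp] at h2
    split_ifs at h2
    · rw [h.parity_bv, ← h.bv_neg, parity_of_mem hu] at h2
      rcases Nat.even_or_odd (l + 1) with hk | hk
      · simp only [hk.neg_one_pow, one_smul] at h2
        rw [h.bv_neg] at h2
        exact (Submodule.neg_mem_iff _).mp h2
      · simpa only [hk.neg_one_pow, neg_smul, one_smul, neg_neg] using h2
    · exact h2
  -- Above the top degree the count is void, but u itself vanishes.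
  · have : u = 0 := by
      obtain ⟨j, hj⟩ := Nat.exists_eq_add_of_lt hl
      rw [ExteriorAlgebra.exteriorPower, show l + 1 = n + 1 + j by omega, pow_add] at hu
      have e : LinearMap.range (ι R : L →ₗ[R] _) ^ (n + 1) = ⊥ :=
        (Submodule.eq_bot_iff _).mpr h.multi_top
      rw [e, Submodule.bot_mul] at hu
      exact (Submodule.mem_bot R).mp hu
    rw [this, h.bv_zero]
    exact Submodule.zero_mem _

theorem exists_bv_ι (x : L) : ∃ r, bv 𝔞 B Ω (ι R x) = algebraMap R _ r :=
  exists_of_mem_zero (h.bv_mem 𝔞 (ι_mem_one x))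

/-- Ω is closed for reasons of degree, so Cartan's formula leaves d i_x Ω, which is -Ω^♯∂x. -/
theorem lieForm_form {x : L} {r : R} (hr : bv 𝔞 B Ω (ι R x) = algebraMap R _ r) :
    lieForm 𝔞 B x Ω = -r • Ω := by
  have e := h.sharp_bv 𝔞 (ι R x)
  rw [hr, parity_ι] at e
  simp only [sharp] at e
  rw [interior_algebraMap, interior_neg, interior_ι] at e
  change contract (B x) (differential 𝔞 B Ω) + differential 𝔞 B (contract (B x) Ω) = _
  rw [h.differential_form, map_zero, zero_add, neg_smul, e, map_neg, neg_neg]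

/-- Since ⟨Ω, V⟩ is constant, L_x scales V and Ω by opposite functions. -/
theorem lieMulti_multi {x : L} {r : R} (hr : bv 𝔞 B Ω (ι R x) = algebraMap R _ r) :
    lieMulti 𝔞 x V = r • V := by
  have hL := lie_isDualDerivation (𝔞 := 𝔞) h.dual x
  have e := hL.interior_comm V Ω
  have e1 : lieForm 𝔞 B x 1 = 0 := by
    rw [← map_one (algebraMap R _), hL.map_fun', Derivation.map_one_eq_zero, map_zero]
  have e2 := h.sharp_multi
  rw [sharp] at e2
  rw [h.lieForm_form 𝔞 hr, map_smul, e2, e1, pair_eq_of_mem B (hL.mem h.multi_mem) h.form_mem,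
    Algebra.algebraMap_eq_smul_one, ← add_smul, ← Algebra.algebraMap_eq_smul_one, eq_comm,
    map_eq_zero_iff _ (ExteriorAlgebra.algebraMap_leftInverse L').injective, add_neg_eq_zero] at e
  rw [h.flip.eq_smul_of_mem (hL.mem h.multi_mem), pair_flip, e]

end BV

end IsTopPair

theorem left_induction {R L : Type*} [CommRing R] [AddCommGroup L] [Module R L]
    {p : ExteriorAlgebra R L → Prop} (algebraMap : ∀ r, p (algebraMap R _ r))
    (add : ∀ a b, p a → p b → p (a + b)) (ι_mul : ∀ x a, p a → p (ι R x * a))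
    (u : ExteriorAlgebra R L) : p u :=
  CliffordAlgebra.left_induction (P := p) 0 algebraMap add (fun x a => ι_mul a x) u

theorem sharp_add {R L L' : Type*} [CommRing R] [AddCommGroup L] [Module R L]
    [AddCommGroup L'] [Module R L'] (B : L →ₗ[R] L' →ₗ[R] R) (Ω : ExteriorAlgebra R L')
    (u v : ExteriorAlgebra R L) : sharp B Ω (u + v) = sharp B Ω u + sharp B Ω v :=
  interior_add B u v Ω

theorem sharp_neg {R L L' : Type*} [CommRing R] [AddCommGroup L] [Module R L]
    [AddCommGroup L'] [Module R L'] (B : L →ₗ[R] L' →ₗ[R] R) (Ω : ExteriorAlgebra R L')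
    (u : ExteriorAlgebra R L) : sharp B Ω (-u) = -sharp B Ω u :=
  interior_neg B u Ω

theorem sharp_smul {R L L' : Type*} [CommRing R] [AddCommGroup L] [Module R L]
    [AddCommGroup L'] [Module R L'] (B : L →ₗ[R] L' →ₗ[R] R) (Ω : ExteriorAlgebra R L')
    (r : R) (u : ExteriorAlgebra R L) : sharp B Ω (r • u) = r • sharp B Ω u :=
  interior_smul B r u Ω

theorem sharp_mul_ι {R L L' : Type*} [CommRing R] [AddCommGroup L] [Module R L]
    [AddCommGroup L'] [Module R L'] (B : L →ₗ[R] L' →ₗ[R] R) (Ω : ExteriorAlgebra R L')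
    (u : ExteriorAlgebra R L) (x : L) :
    sharp B Ω (u * ι R x) = contract (B x) (sharp B Ω u) :=
  interior_mul_ι B x u Ω

namespace IsTopPair

/-! ### The Laplacians and the compatibility of d_* with the bracket -/

section BV

variable {𝕜 R L L' : Type*} [Field 𝕜] [CharZero 𝕜] [CommRing R] [Algebra 𝕜 R]
  [AddCommGroup L] [Module R L] [AddCommGroup L'] [Module R L'] {B : L →ₗ[R] L' →ₗ[R] R} {n : ℕ}
  {Ω : ExteriorAlgebra R L'} {V : ExteriorAlgebra R L} (h : IsTopPair B n Ω V)
  (𝔞 : LieAlgebroid 𝕜 R L) (𝔟 : LieAlgebroid 𝕜 R L')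

include h

/-- The extra term is df ∧ Ω^♯b up to sign, which `ι_mul_sharp` converts into a contraction of b. -/
theorem bv_smul (f : R) (b : ExteriorAlgebra R L) :
    bv 𝔞 B Ω (f • b) = f • bv 𝔞 B Ω b - contract (anchorDual 𝔞 f) b := by
  apply h.sharp_injective
  have hD := differential_spec 𝔞 B h.dual
  obtain ⟨φ, hφ, hφ'⟩ := hD.exists_fun f
  have e : B.flip φ = anchorDual 𝔞 f := LinearMap.ext hφ'
  rw [h.sharp_bv, map_smul, sharp_smul, hD.smul, hφ, h.ι_mul_sharp, e, parity_contract,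
    CliffordAlgebra.involute_involute, sub_eq_add_neg, sharp_add, sharp_smul, h.sharp_bv, add_comm]

/-- Cartan's formula d i_x = L_x - i_x d on Ω^♯b, read through Ω^♯. There L_x contributes [x, b] and
the factor -∂x by which it scales Ω. -/
theorem bv_ι_mul (x : L) (b : ExteriorAlgebra R L) :
    bv 𝔞 B Ω (ι R x * b) =
      bv 𝔞 B Ω (ι R x) * b - ι R x * bv 𝔞 B Ω b - schouten 𝔞 (ι R x) b := by
  apply h.sharp_injective
  have hL := lie_isDualDerivation (𝔞 := 𝔞) h.dual x
  obtain ⟨r, hr⟩ := h.exists_bv_ι 𝔞 x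
  have e1 : sharp B Ω (parity (ι R x * b)) = -contract (B x) (sharp B Ω b) := by
    rw [map_mul, parity_ι, neg_mul, ← mul_ι_eq, sharp_neg, sharp_mul_ι]
  have e2 : differential 𝔞 B (contract (B x) (sharp B Ω b)) =
      lieForm 𝔞 B x (sharp B Ω b) - contract (B x) (differential 𝔞 B (sharp B Ω b)) := by
    change _ = contract (B x) (differential 𝔞 B _) + differential 𝔞 B (contract (B x) _) - _
    abel
  have e3 : lieForm 𝔞 B x (sharp B Ω b) =
      sharp B Ω (schouten 𝔞 (ι R x) b) - r • sharp B Ω b := by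
    have := hL.interior_comm b Ω
    rw [h.lieForm_form 𝔞 hr, map_smul, neg_smul, ← sub_eq_add_neg] at this
    exact this
  rw [h.sharp_bv, e1, map_neg, e2, e3, h.differential_sharp, ← sharp_mul_ι, mul_ι_eq, h.parity_bv,
    CliffordAlgebra.involute_involute, hr, ← Algebra.smul_def]
  simp only [sub_eq_add_neg, sharp_add, sharp_neg, sharp_smul, mul_neg]
  abel

/-- The operator `∂` generates the Schouten bracket. -/
theorem bv_mul (a b : ExteriorAlgebra R L) :
    bv 𝔞 B Ω (a * b) =
      bv 𝔞 B Ω a * b + parity a * bv 𝔞 B Ω b + schouten 𝔞 (parity a) b := by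
  induction a using left_induction with
  | algebraMap r =>
    rw [AlgHom.commutes, ← Algebra.smul_def, h.bv_smul, h.bv_algebraMap, schouten_algebraMap,
      ← Algebra.smul_def]
    simp [sub_eq_add_neg]
  | add u v hu hv =>
    rw [add_mul, h.bv_add, hu, hv, h.bv_add, map_add, map_add, AddMonoidHom.add_apply]
    noncomm_ring
  | ι_mul x a ha =>
    -- After x is peeled off and [x, ab] expanded, `schouten_mul_left` collects the remaining
    -- bracket terms.
    rw [mul_assoc, h.bv_ι_mul, ha, h.bv_ι_mul 𝔞 x a, schouten_ι_mul, map_mul, parity_ι, neg_mul,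
      map_neg, AddMonoidHom.neg_apply, schouten_mul_left, CliffordAlgebra.involute_involute]
    noncomm_ring

theorem laplacian_add (u v : ExteriorAlgebra R L) :
    laplacian 𝔞 𝔟 B Ω (u + v) = laplacian 𝔞 𝔟 B Ω u + laplacian 𝔞 𝔟 B Ω v := by
  simp only [laplacian, h.bv_add, map_add]
  abel

/-- Combine the generating formula for ∂ with the product rule for d_*: the cross terms cancel, and
what exceeds the derivation rule is the defect of d_* on the bracket. -/
theorem laplacian_mul (a b : ExteriorAlgebra R L) :
    laplacian 𝔞 𝔟 B Ω (a * b) =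
      laplacian 𝔞 𝔟 B Ω a * b + a * laplacian 𝔞 𝔟 B Ω b +
        (differential 𝔟 B.flip (schouten 𝔞 (parity a) b) -
          schouten 𝔞 (differential 𝔟 B.flip (parity a)) b +
          schouten 𝔞 a (differential 𝔟 B.flip b)) := by
  have hD := differential_spec 𝔟 B.flip h.dual.flip
  simp only [laplacian, hD.map_mul, h.bv_mul, h.bv_add, map_add, h.parity_bv, hD.parity_apply,
    CliffordAlgebra.involute_involute, map_neg, AddMonoidHom.neg_apply]
  noncomm_ring

theorem derivation_schouten_iff :
    (∀ (k l : ℕ), ∀ u ∈ ⋀[R]^k L, ∀ v ∈ ⋀[R]^l L,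
      differential 𝔟 B.flip (schouten 𝔞 u v) = schouten 𝔞 (differential 𝔟 B.flip u) v +
        (-1 : R) ^ (k + 1) • schouten 𝔞 u (differential 𝔟 B.flip v)) ↔
    ∀ u v, laplacian 𝔞 𝔟 B Ω (u * v) =
      laplacian 𝔞 𝔟 B Ω u * v + u * laplacian 𝔞 𝔟 B Ω v := by
  have key : ∀ k, ∀ u ∈ ⋀[R]^k L, ∀ w : ExteriorAlgebra R L,
      schouten 𝔞 (parity u) w = -((-1 : R) ^ (k + 1) • schouten 𝔞 u w) := by
    intro k u hu w
    rw [parity_of_mem hu]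
    rcases Nat.even_or_odd k with hk | hk
    · simp [hk.neg_one_pow, hk.add_one.neg_one_pow]
    · simp [hk.neg_one_pow, hk.add_one.neg_one_pow]
  constructor
  · intro H u v
    rw [h.laplacian_mul, add_eq_left]
    -- Substituting the parity of u moves the sign into the last term. The expression is additive in
    -- a and in v, so homogeneous arguments suffice.
    suffices H' : ∀ a, differential 𝔟 B.flip (schouten 𝔞 a v) -
        schouten 𝔞 (differential 𝔟 B.flip a) v +
          schouten 𝔞 (parity a) (differential 𝔟 B.flip v) = 0 by
      have := H' (parity u)
      rwa [CliffordAlgebra.involute_involute] at this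
    intro a
    induction a using homogeneous_induction with
    | h k a ha =>
      induction v using homogeneous_induction with
      | h l v hv => rw [H k l a ha v hv, key k a ha]; abel
      | hadd v w hv hw =>
        simp only [map_add] at *
        rw [← add_zero (0 : ExteriorAlgebra R L)]
        nth_rewrite 1 [← hv]
        rw [← hw]
        abel
    | hadd a b ha hb =>
      simp only [map_add, AddMonoidHom.add_apply] at *
      rw [← add_zero (0 : ExteriorAlgebra R L)]
      nth_rewrite 1 [← ha]
      rw [← hb]
      abel
  · intro H k l u hu v hv
    have e := h.laplacian_mul 𝔞 𝔟 (parity u) v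
    rw [H, left_eq_add, CliffordAlgebra.involute_involute, key k u hu, ← sub_eq_add_neg,
      sub_sub, sub_eq_zero] at e
    exact e

/-- After V^♯ is applied this is the relation defining ∂_*, since `sharp_sharp` removes the
composites on both sides; the resulting sign is the same for n even and n odd. -/
theorem bv_flip_sharp (u : ExteriorAlgebra R L) :
    bv 𝔟 B.flip V (sharp B Ω u) = -sharp B Ω (differential 𝔟 B.flip (parity u)) := by
  apply h.flip.sharp_injective
  have hD := differential_spec 𝔟 B.flip h.dual.flip
  rw [h.flip.sharp_bv, h.parity_sharp, sharp_smul, sharp_neg, h.sharp_sharp, h.sharp_sharp]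
  split_ifs with hn
  · rw [hn.neg_one_pow, one_smul, hD.parity_apply, neg_neg]
  · rw [Nat.not_even_iff_odd] at hn
    rw [hn.neg_one_pow, neg_smul, one_smul, map_neg]

/-- Ω^♯ exchanges ∂ with d and d_* with ∂_*, and the signs cancel in the composites. This is the
bridge between Δ and Δ_*. -/
theorem laplacian_sharp (u : ExteriorAlgebra R L) :
    laplacian 𝔟 𝔞 B.flip V (sharp B Ω u) = sharp B Ω (laplacian 𝔞 𝔟 B Ω u) := by
  have hD := differential_spec 𝔟 B.flip h.dual.flip
  rw [laplacian, laplacian, h.bv_flip_sharp, LinearMap.flip_flip, map_neg, h.differential_sharp,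
    h.differential_sharp, h.bv_flip_sharp, h.parity_bv, CliffordAlgebra.involute_involute,
    hD.parity_apply, CliffordAlgebra.involute_involute, h.bv_neg, sharp_neg, map_neg, sharp_neg,
    sharp_add, neg_neg, neg_neg, add_comm]

theorem laplacian_mem {k : ℕ} {u : ExteriorAlgebra R L} (hu : u ∈ ⋀[R]^k L) :
    laplacian 𝔞 𝔟 B Ω u ∈ ⋀[R]^k L := by
  have hD := differential_spec 𝔟 B.flip h.dual.flip
  refine Submodule.add_mem _ ?_ (h.bv_mem 𝔞 (hD.mem hu))
  rcases k with _ | k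
  · obtain ⟨r, rfl⟩ := exists_of_mem_zero hu
    rw [h.bv_algebraMap, map_zero]
    exact Submodule.zero_mem _
  · exact hD.mem (h.bv_mem 𝔞 hu)

theorem laplacian_one : laplacian 𝔞 𝔟 B Ω 1 = 0 := by
  have hD := differential_spec 𝔟 B.flip h.dual.flip
  rw [laplacian, hD.map_one, h.bv_zero, ← map_one (algebraMap R _), h.bv_algebraMap, map_zero,
    add_zero]

/-- Ω^♯V = 1, and Δ_* kills 1. -/
theorem laplacian_multi : laplacian 𝔞 𝔟 B Ω V = 0 := by
  apply h.sharp_injective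
  rw [← h.laplacian_sharp, h.sharp_multi, h.flip.laplacian_one]
  exact (interior_zero B Ω).symm

/-- If the Laplacian is a derivation, it is compatible with the pairing of sections. -/
theorem laplacian_pairing (H : ∀ u v, laplacian 𝔞 𝔟 B Ω (u * v) =
      laplacian 𝔞 𝔟 B Ω u * v + u * laplacian 𝔞 𝔟 B Ω v) (x : L) (θ : L') :
    laplacian 𝔟 𝔞 B.flip V (algebraMap R _ (B x θ)) =
      algebraMap R _ (pair B (ι R x) (laplacian 𝔟 𝔞 B.flip V (ι R θ)) +
        pair B (laplacian 𝔞 𝔟 B Ω (ι R x)) (ι R θ)) := by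
  -- With θ = Ω^♯U the function ⟨θ, x⟩ is Ω^♯(U ∧ x), and the derivation rule for Δ applies to U ∧
  -- x.
  obtain ⟨U, hU⟩ := h.sharp_surjective (ι R θ)
  rw [map_add, ← pair_eq_of_mem B (ι_mem_one x) (h.flip.laplacian_mem 𝔟 𝔞 (ι_mem_one θ)),
    ← pair_eq_of_mem B (h.laplacian_mem 𝔞 𝔟 (ι_mem_one x)) (ι_mem_one θ), interior_ι,
    ← contract_ι, ← hU, ← sharp_mul_ι, h.laplacian_sharp, H, sharp_add, sharp_mul_ι,
    ← h.laplacian_sharp]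
  simp only [sharp, interior_mul]

/-- A dual derivation that agrees with the Laplacian on one side agrees with it on the other. -/
theorem laplacian_flip_eq {Y : R → R} {D : ExteriorAlgebra R L →+ ExteriorAlgebra R L}
    {D' : ExteriorAlgebra R L' →+ ExteriorAlgebra R L'} (hD : IsDualDerivation B Y D D')
    {r : R} (hr : IsUnit r) (H : ∀ u, laplacian 𝔞 𝔟 B Ω u = r • D u) (w : ExteriorAlgebra R L') :
    laplacian 𝔟 𝔞 B.flip V w = r • D' w := by
  -- From ΔV = 0 one gets DV = 0, and then ⟨Ω, V⟩ = 1 gives D'Ω = 0. Hence D'Ω^♯ = Ω^♯D, the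
  -- relation that the Laplacians satisfy.
  have hDV : D V = 0 := by
    have := H V
    rwa [h.laplacian_multi, eq_comm, hr.smul_eq_zero] at this
  have hY : D' 1 = 0 := by
    have e := hD.map_mul' 1 1
    rw [mul_one, mul_one, one_mul] at e
    exact left_eq_add.mp e
  have hDΩ : D' Ω = 0 := by
    have e := hD.interior_comm V Ω
    have e2 := h.sharp_multi
    rw [sharp] at e2
    rw [hDV, interior_zero, e2, hY, zero_add,
      pair_eq_of_mem B h.multi_mem (hD.flip.mem h.form_mem), eq_comm,
      map_eq_zero_iff _ (ExteriorAlgebra.algebraMap_leftInverse L').injective] at e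
    rw [h.eq_smul_of_mem (hD.flip.mem h.form_mem), e, zero_smul]
  obtain ⟨u, rfl⟩ := h.sharp_surjective w
  rw [h.laplacian_sharp, H, sharp_smul]
  simp only [sharp]
  rw [hD.interior_comm, hDΩ, map_zero, add_zero]

end BV

end IsTopPair

/-! ### The Laplacian on functions and sections -/

section Components

variable {𝕜 R L L' : Type*} [Field 𝕜] [CharZero 𝕜] [CommRing R] [Algebra 𝕜 R]
  [AddCommGroup L] [Module R L] [AddCommGroup L'] [Module R L']
  (𝔞 : LieAlgebroid 𝕜 R L) (𝔟 : LieAlgebroid 𝕜 R L') (B : L →ₗ[R] L' →ₗ[R] R)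
  (Ω : ExteriorAlgebra R L') (V : ExteriorAlgebra R L)

/-- The differential of a function, as a section. -/
def dFun (f : R) : L' := ExteriorAlgebra.ιInv (differential 𝔞 B (algebraMap R _ f))

/-- The Lie derivative of a one-form, as a section. -/
def lieOne (x : L) (θ : L') : L' := ExteriorAlgebra.ιInv (lieForm 𝔞 B x (ι R θ))

/-- The section `i_x dθ`. -/
def insertD (x : L) (θ : L') : L' :=
  ExteriorAlgebra.ιInv (contract (B x) (differential 𝔞 B (ι R θ)))

/-- The function `∂x`. -/
def bvFun (x : L) : R := ExteriorAlgebra.algebraMapInv (bv 𝔞 B Ω (ι R x))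

/-- The Laplacian of a function, as a function. -/
def lapFun (f : R) : R := ExteriorAlgebra.algebraMapInv (laplacian 𝔞 𝔟 B Ω (algebraMap R _ f))

/-- The Laplacian of a section, as a section. -/
def lapSec (x : L) : L := ExteriorAlgebra.ιInv (laplacian 𝔞 𝔟 B Ω (ι R x))

/-- The failure of the Laplacian to be a derivation for the product of a function and a section. -/
def lapDefect (f : R) (u : L) : L :=
  𝔞.bracket u (dFun 𝔟 B.flip f) - lieOne 𝔟 B.flip (dFun 𝔞 B f) u

theorem ι_ιInv {u : ExteriorAlgebra R L} (hu : u ∈ ⋀[R]^1 L) :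
    ι R (ExteriorAlgebra.ιInv u) = u := by
  obtain ⟨x, rfl⟩ := exists_of_mem_one hu
  rw [ExteriorAlgebra.ι_leftInverse x]

theorem algebraMap_algebraMapInv {u : ExteriorAlgebra R L} (hu : u ∈ ⋀[R]^0 L) :
    algebraMap R _ (ExteriorAlgebra.algebraMapInv u) = u := by
  obtain ⟨x, rfl⟩ := exists_of_mem_zero hu
  rw [AlgHom.commutes]
  rfl

theorem algebraMap_inj {f g : R} :
    algebraMap R (ExteriorAlgebra R L) f = algebraMap R _ g ↔ f = g :=
  (ExteriorAlgebra.algebraMap_leftInverse L).injective.eq_iff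

variable {B}

namespace HasDualBasis

variable (hB : HasDualBasis B)

include hB

theorem differential_algebraMap (f : R) :
    differential 𝔞 B (algebraMap R _ f) = ι R (dFun 𝔞 B f) :=
  (ι_ιInv ((differential_spec 𝔞 B hB).degree_fun f)).symm

theorem pair_dFun (x : L) (f : R) : B x (dFun 𝔞 B f) = 𝔞.anchor x f := by
  rw [← (differential_spec 𝔞 B hB).eval_fun, hB.differential_algebraMap, pair_ι_ι]

theorem lieForm_ι (x : L) (θ : L') : lieForm 𝔞 B x (ι R θ) = ι R (lieOne 𝔞 B x θ) :=
  (ι_ιInv ((lie_isDualDerivation hB x).degree' θ)).symm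

theorem pair_lieOne (x y : L) (θ : L') :
    B y (lieOne 𝔞 B x θ) = 𝔞.anchor x (B y θ) - B (𝔞.bracket x y) θ := by
  have e := (lie_isDualDerivation (𝔞 := 𝔞) hB x).pairing y θ
  rw [hB.lieForm_ι, lieMulti, (schouten_spec 𝔞).section_section, pair_ι_ι, pair_ι_ι] at e
  rw [← e]; ring

theorem contract_differential_ι (x : L) (θ : L') :
    contract (B x) (differential 𝔞 B (ι R θ)) = ι R (insertD 𝔞 B x θ) :=
  (ι_ιInv (contract_mem _ ((differential_spec 𝔞 B hB).degree_section θ) 1 rfl)).symm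

theorem lieOne_eq (x : L) (θ : L') :
    lieOne 𝔞 B x θ = insertD 𝔞 B x θ + dFun 𝔞 B (B x θ) := by
  apply (ExteriorAlgebra.ι_inj R _ _).mp
  rw [← hB.lieForm_ι, map_add, ← hB.contract_differential_ι, ← hB.differential_algebraMap,
    ← contract_ι]
  rfl

theorem pair_insertD (x y : L) (θ : L') :
    B y (insertD 𝔞 B x θ) =
      𝔞.anchor x (B y θ) - 𝔞.anchor y (B x θ) - B (𝔞.bracket x y) θ := by
  have e := hB.pair_lieOne 𝔞 x y θ
  rw [hB.lieOne_eq, map_add, hB.pair_dFun] at e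
  rw [eq_sub_of_add_eq e]; ring

theorem pair_left_ext {θ η : L'} (hθ : ∀ x, B x θ = B x η) : θ = η := by
  obtain ⟨J, hJ, e, ε, he, hε⟩ := hB
  rw [hε θ, hε η]
  simp only [hθ]

theorem dFun_mul (f g : R) : dFun 𝔞 B (f * g) = f • dFun 𝔞 B g + g • dFun 𝔞 B f := by
  refine hB.pair_left_ext fun x => ?_
  simp [hB.pair_dFun]

theorem lieOne_smul (x : L) (f : R) (θ : L') :
    lieOne 𝔞 B x (f • θ) = 𝔞.anchor x f • θ + f • lieOne 𝔞 B x θ := by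
  refine hB.pair_left_ext fun y => ?_
  simp [hB.pair_lieOne]
  ring

/-- The pairing of the differentials of two functions. -/
theorem anchor_dFun_comm (f g : R) :
    𝔞.anchor (dFun 𝔟 B.flip f) g = 𝔟.anchor (dFun 𝔞 B g) f := by
  rw [← hB.pair_dFun, ← hB.flip.pair_dFun]
  rfl

end HasDualBasis

namespace IsTopPair

variable {Ω V} {n : ℕ} (h : IsTopPair B n Ω V)

include h

theorem bv_ι (x : L) : bv 𝔞 B Ω (ι R x) = algebraMap R _ (bvFun 𝔞 B Ω x) :=
  (algebraMap_algebraMapInv (h.bv_mem 𝔞 (ι_mem_one x))).symm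

theorem bvFun_add (x y : L) : bvFun 𝔞 B Ω (x + y) = bvFun 𝔞 B Ω x + bvFun 𝔞 B Ω y := by
  rw [bvFun, map_add, h.bv_add, map_add]; rfl

theorem bvFun_smul (f : R) (x : L) :
    bvFun 𝔞 B Ω (f • x) = f * bvFun 𝔞 B Ω x - 𝔞.anchor x f := by
  rw [← algebraMap_inj (L := L), ← h.bv_ι, map_smul, h.bv_smul, h.bv_ι, contract_ι,
    Algebra.smul_def, map_sub, map_mul, anchorDual_apply]

theorem bvFun_zero : bvFun 𝔞 B Ω 0 = 0 := by
  have e := h.bvFun_add 𝔞 0 0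
  rw [add_zero] at e
  exact left_eq_add.mp e

theorem bvFun_neg (x : L) : bvFun 𝔞 B Ω (-x) = -bvFun 𝔞 B Ω x := by
  have e := h.bvFun_add 𝔞 x (-x)
  rw [add_neg_cancel, h.bvFun_zero] at e
  exact (neg_eq_of_add_eq_zero_right e.symm).symm

theorem laplacian_algebraMap (f : R) :
    laplacian 𝔞 𝔟 B Ω (algebraMap R _ f) = algebraMap R _ (lapFun 𝔞 𝔟 B Ω f) :=
  (algebraMap_algebraMapInv (h.laplacian_mem 𝔞 𝔟 (algebraMap_mem_zero f))).symm

theorem laplacian_ι (x : L) :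
    laplacian 𝔞 𝔟 B Ω (ι R x) = ι R (lapSec 𝔞 𝔟 B Ω x) :=
  (ι_ιInv (h.laplacian_mem 𝔞 𝔟 (ι_mem_one x))).symm

theorem lapFun_eq (f : R) : lapFun 𝔞 𝔟 B Ω f = bvFun 𝔞 B Ω (dFun 𝔟 B.flip f) := by
  rw [← algebraMap_inj (L := L), ← h.laplacian_algebraMap, laplacian, h.bv_algebraMap, map_zero,
    zero_add, h.dual.flip.differential_algebraMap, h.bv_ι]

/-- On functions Δ = ∂d_* has order two: the rule ∂(fx) = f∂x - ρ(x)f produces the two cross terms,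
written here with the differentials of f. -/
theorem lapFun_mul (f g : R) :
    lapFun 𝔞 𝔟 B Ω (f * g) = f * lapFun 𝔞 𝔟 B Ω g + g * lapFun 𝔞 𝔟 B Ω f -
      𝔞.anchor (dFun 𝔟 B.flip f) g - 𝔟.anchor (dFun 𝔞 B f) g := by
  rw [h.lapFun_eq, h.dual.flip.dFun_mul, h.bvFun_add, h.bvFun_smul, h.bvFun_smul, h.lapFun_eq,
    h.lapFun_eq, h.dual.anchor_dFun_comm 𝔞 𝔟 g f]
  ring

/-- In `laplacian_mul` for a function and a section, the bracket of d_*f gives [x, d_*f], and the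
two other terms are those of Cartan's formula for L_{df}x. -/
theorem lapSec_smul (f : R) (x : L) :
    lapSec 𝔞 𝔟 B Ω (f • x) = f • lapSec 𝔞 𝔟 B Ω x + lapFun 𝔞 𝔟 B Ω f • x +
      lapDefect 𝔞 𝔟 B f x := by
  apply (ExteriorAlgebra.ι_inj R _ _).mp
  have e : anchorDual 𝔞 f = B.flip (dFun 𝔞 B f) :=
    LinearMap.ext fun y => (h.dual.pair_dFun 𝔞 y f).symm
  have e2 : 𝔞.anchor x f = B.flip (dFun 𝔞 B f) x := (h.dual.pair_dFun 𝔞 x f).symm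
  rw [← h.laplacian_ι, map_smul, Algebra.smul_def, h.laplacian_mul, AlgHom.commutes,
    schouten_algebraMap, schouten_algebraMap, h.dual.flip.differential_algebraMap,
    (schouten_spec 𝔞).section_section, contract_ι, anchorDual_apply, e2, e,
    h.dual.flip.contract_differential_ι, map_neg, h.dual.flip.differential_algebraMap,
    h.laplacian_algebraMap, h.laplacian_ι, lapDefect, h.dual.flip.lieOne_eq, 𝔞.bracket_skew x,
    ← Algebra.smul_def, ← Algebra.smul_def]
  simp only [map_add, map_sub, map_neg, map_smul]
  abel

/-- On bisections the anticommutator of ∂ and i_θ is the pairing with dθ. Applied to d_*u, this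
moves i_θ past ∂ in ⟨∂d_*u, θ⟩. -/
theorem pair_lapSec (u : L) (θ : L') :
    B (lapSec 𝔞 𝔟 B Ω u) θ = 𝔟.anchor θ (bvFun 𝔞 B Ω u) -
      bvFun 𝔞 B Ω (insertD 𝔟 B.flip θ u) +
      pair B (differential 𝔟 B.flip (ι R u)) (differential 𝔞 B (ι R θ)) := by
  have hD := differential_spec 𝔞 B h.dual
  have hD' := differential_spec 𝔟 B.flip h.dual.flip
  have key : ∀ U ∈ ⋀[R]^2 L, bv 𝔞 B Ω (contract (B.flip θ) U) + contract (B.flip θ) (bv 𝔞 B Ω U) =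
      algebraMap R _ (pair B U (differential 𝔞 B (ι R θ))) := by
    intro U hU
    apply h.sharp_injective
    -- The product rule for d(θ ∧ Ω^♯U), every term of which is Ω^♯ of something.
    have e := hD.map_mul (ι R θ) (sharp B Ω U)
    rw [parity_ι, h.ι_mul_sharp, h.differential_sharp, h.differential_sharp,
      h.mul_sharp_of_mem_two (hD.degree_section θ), neg_mul, h.ι_mul_sharp, parity_contract,
      parity_contract, h.parity_bv, CliffordAlgebra.involute_involute,
      pair_eq_of_mem B.flip (hD.degree_section θ) hU, pair_flip, map_neg parity,
      parity_contract, CliffordAlgebra.involute_involute, neg_neg, map_neg, neg_neg] at e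
    rw [sharp_add, e]
    abel
  have e := key _ (hD'.degree_section u)
  rw [h.dual.flip.contract_differential_ι, h.bv_ι] at e
  have e2 : contract (B.flip θ) (ι R (lapSec 𝔞 𝔟 B Ω u)) =
      contract (B.flip θ) (differential 𝔟 B.flip (bv 𝔞 B Ω (ι R u))) +
      contract (B.flip θ) (bv 𝔞 B Ω (differential 𝔟 B.flip (ι R u))) := by
    rw [← h.laplacian_ι, laplacian, map_add]
  rw [contract_ι, h.bv_ι, h.dual.flip.differential_algebraMap, contract_ι,
    eq_sub_of_add_eq' e, ← map_sub, ← map_add, algebraMap_inj, h.dual.flip.pair_dFun] at e2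
  rw [← LinearMap.flip_apply, e2]
  ring

/-- Each Lie derivative is moved across the pairing by its Leibniz rule, and the brackets cancel.
Only the vector field ρ(d_*f) + ρ_*(df) survives. -/
theorem pair_lapDefect (f : R) (u : L) (θ : L') :
    B (lapDefect 𝔞 𝔟 B f u) θ + B u (lapDefect 𝔟 𝔞 B.flip f θ) =
      -(𝔞.anchor (dFun 𝔟 B.flip f) (B u θ) + 𝔟.anchor (dFun 𝔞 B f) (B u θ)) := by
  have e1 := h.dual.pair_lieOne 𝔞 (dFun 𝔟 B.flip f) u θ
  have e2 := h.dual.flip.pair_lieOne 𝔟 (dFun 𝔞 B f) θ u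
  simp only [LinearMap.flip_apply] at e2
  simp only [lapDefect, LinearMap.flip_flip, map_sub, LinearMap.sub_apply]
  rw [e1, e2, 𝔞.bracket_skew u, 𝔟.bracket_skew θ]
  simp only [map_neg, LinearMap.neg_apply]
  ring

end IsTopPair

end Components

/-! ### Compatibility of the Laplacians with the pairing -/

section Compatibility

variable {𝕜 R L L' : Type*} [Field 𝕜] [CharZero 𝕜] [CommRing R] [Algebra 𝕜 R]
  [AddCommGroup L] [Module R L] [AddCommGroup L'] [Module R L']
  (𝔞 : LieAlgebroid 𝕜 R L) (𝔟 : LieAlgebroid 𝕜 R L') (B : L →ₗ[R] L' →ₗ[R] R)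
  (Ω : ExteriorAlgebra R L') (V : ExteriorAlgebra R L)

/-- The Laplacians are compatible with the pairing of sections, where the one on `Γ(∧A*)` is
applied to functions. -/
def LaplacianCompatible : Prop := ∀ (u : L) (θ : L'),
  lapFun 𝔟 𝔞 B.flip V (B u θ) = B u (lapSec 𝔟 𝔞 B.flip V θ) + B (lapSec 𝔞 𝔟 B Ω u) θ

/-- `t` is the trace of the endomorphism `T`, computed in any finite dual basis. -/
def IsFrameTrace (T : L' →ₗ[R] L') (t : R) : Prop :=
  ∀ (J : Type) (_ : Fintype J) (e : J → L) (ε : J → L'),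
    (∀ x, x = ∑ i, B x (ε i) • e i) → (∀ θ, θ = ∑ i, B (e i) θ • ε i) →
    ∑ i, B (e i) (T (ε i)) = t

variable {B Ω V}

theorem commutator_mul {D₁ D₂ : ExteriorAlgebra R L →+ ExteriorAlgebra R L}
    (hm : ∀ a b, D₁ (a * b) = D₁ a * b + a * D₁ b) (hm' : ∀ a b, D₂ (a * b) = D₂ a * b + a * D₂ b)
    (a b : ExteriorAlgebra R L) :
    D₁ (D₂ (a * b)) - D₂ (D₁ (a * b)) =
      (D₁ (D₂ a) - D₂ (D₁ a)) * b + a * (D₁ (D₂ b) - D₂ (D₁ b)) := by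
  simp only [hm, hm', map_add]
  noncomm_ring

namespace IsTopPair

variable {n : ℕ} (h : IsTopPair B n Ω V)

include h

theorem laplacianCompatible_iff :
    (∀ (u : L) (θ : L'), laplacian 𝔟 𝔞 B.flip V (algebraMap R _ (B u θ)) =
      algebraMap R _ (pair B (ι R u) (laplacian 𝔟 𝔞 B.flip V (ι R θ)) +
        pair B (laplacian 𝔞 𝔟 B Ω (ι R u)) (ι R θ))) ↔ LaplacianCompatible 𝔞 𝔟 B Ω V := by
  refine forall₂_congr fun u θ => ?_
  rw [h.flip.laplacian_algebraMap, h.flip.laplacian_ι, h.laplacian_ι, pair_ι_ι, pair_ι_ι,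
    algebraMap_inj]

theorem laplacianCompatible_flip_iff :
    (∀ (u : L) (θ : L'), laplacian 𝔞 𝔟 B Ω (algebraMap R _ (B u θ)) =
      algebraMap R _ (pair B (ι R u) (laplacian 𝔟 𝔞 B.flip V (ι R θ)) +
        pair B (laplacian 𝔞 𝔟 B Ω (ι R u)) (ι R θ))) ↔
      LaplacianCompatible 𝔟 𝔞 B.flip V Ω := by
  rw [LaplacianCompatible, forall_comm]
  refine forall₂_congr fun θ u => ?_
  rw [h.laplacian_algebraMap, h.flip.laplacian_ι, h.laplacian_ι, pair_ι_ι, pair_ι_ι,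
    algebraMap_inj, LinearMap.flip_flip, add_comm]
  rfl

/-- Compatibility at (u, fθ), less f times compatibility at (u, θ), shows that the dual defect alone
accounts for the right side of `pair_lapDefect`. Nothing remains for the defect of u. -/
theorem lapDefect_eq_zero (H : LaplacianCompatible 𝔞 𝔟 B Ω V) (f : R) (u : L) :
    lapDefect 𝔞 𝔟 B f u = 0 := by
  refine h.dual.flip.pair_left_ext fun θ => ?_
  have e1 := H u (f • θ)
  have e2 := H u θ
  have e3 := h.flip.lapFun_mul 𝔟 𝔞 f (B u θ)
  have e4 := h.pair_lapDefect 𝔞 𝔟 f u θ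
  rw [map_smul, smul_eq_mul, h.flip.lapSec_smul, map_smul, smul_eq_mul, map_add, map_add, map_smul,
    map_smul, smul_eq_mul, smul_eq_mul] at e1
  rw [LinearMap.flip_flip] at e3
  rw [LinearMap.flip_apply, LinearMap.flip_apply, map_zero, LinearMap.zero_apply]
  linear_combination e4 - e3 + e1 - f * e2

/-- Let K = ρ(d_*f) + ρ_*(df). Compatibility at (fu, θ), where the defect is now zero, says that K
multiplies every ⟨u, θ⟩ by Δ_*f - Δf. Replacing θ by rθ and using that K is a derivation gives
K(r)⟨u, θ⟩ = 0, hence K = 0, and then Δ_*f = Δf. -/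
theorem anchor_dFun_add_eq_zero (H : LaplacianCompatible 𝔞 𝔟 B Ω V) (f r : R) :
    𝔞.anchor (dFun 𝔟 B.flip f) r + 𝔟.anchor (dFun 𝔞 B f) r = 0 ∧
      lapFun 𝔞 𝔟 B Ω f = lapFun 𝔟 𝔞 B.flip V f := by
  -- In rank zero all sections, hence all differentials of functions, vanish; in positive rank
  -- `eq_zero_of_smul_ι` is available.
  rcases eq_or_ne n 0 with hn | hn
  · rw [h.lapFun_eq, h.flip.lapFun_eq, h.section_eq_zero hn (dFun 𝔟 B.flip f),
      h.flip.section_eq_zero hn (dFun 𝔞 B f), h.flip.section_eq_zero hn (dFun 𝔞 B.flip.flip f),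
      h.bvFun_zero, h.flip.bvFun_zero]
    simp
  set K : R → R := fun r => 𝔞.anchor (dFun 𝔟 B.flip f) r + 𝔟.anchor (dFun 𝔞 B f) r with hK
  have K_mul : ∀ r g, K (r * g) = r * K g + g * K r := fun r g => by
    simp only [hK, Derivation.leibniz, smul_eq_mul]; ring
  have K_pair : ∀ u θ, K (B u θ) = -(lapFun 𝔞 𝔟 B Ω f - lapFun 𝔟 𝔞 B.flip V f) * B u θ := by
    intro u θ
    have e1 := H (f • u) θ
    have e2 := H u θ
    have e3 := h.flip.lapFun_mul 𝔟 𝔞 f (B u θ)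
    rw [map_smul, LinearMap.smul_apply, smul_eq_mul, h.lapSec_smul, h.lapDefect_eq_zero 𝔞 𝔟 H,
      LinearMap.smul_apply, smul_eq_mul, add_zero, map_add, LinearMap.add_apply, map_smul,
      map_smul, LinearMap.smul_apply, smul_eq_mul, LinearMap.smul_apply, smul_eq_mul] at e1
    rw [LinearMap.flip_flip] at e3
    simp only [hK]
    linear_combination e3 - e1 + f * e2
  have K_zero : ∀ r, K r = 0 := fun r => by
    refine h.eq_zero_of_smul_ι hn fun θ => ?_
    rw [← map_smul]
    suffices K r • θ = 0 by rw [this, map_zero]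
    refine h.dual.pair_left_ext fun u => ?_
    have e1 := K_pair u (r • θ)
    rw [map_smul, smul_eq_mul, K_mul, K_pair] at e1
    rw [map_smul, smul_eq_mul, map_zero]
    linear_combination e1
  refine ⟨K_zero r, ?_⟩
  rw [← sub_eq_zero]
  refine h.eq_zero_of_smul_ι hn fun θ => ?_
  rw [← map_smul]
  suffices (lapFun 𝔞 𝔟 B Ω f - lapFun 𝔟 𝔞 B.flip V f) • θ = 0 by rw [this, map_zero]
  refine h.dual.pair_left_ext fun u => ?_
  have e1 := K_pair u θ
  rw [K_zero] at e1
  rw [map_smul, smul_eq_mul, map_zero]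
  linear_combination e1

/-- The two conditions differ only in the Laplacian applied to ⟨u, θ⟩, and compatibility makes the
two agree on functions. -/
theorem laplacianCompatible_flip (H : LaplacianCompatible 𝔞 𝔟 B Ω V) :
    LaplacianCompatible 𝔟 𝔞 B.flip V Ω := fun θ u => by
  have e := H u θ
  rw [← (h.anchor_dFun_add_eq_zero 𝔞 𝔟 H (B u θ) 0).2] at e
  rw [LinearMap.flip_flip]
  simp only [LinearMap.flip_apply]
  rw [e, add_comm]

theorem laplacianCompatible_comm :
    LaplacianCompatible 𝔞 𝔟 B Ω V ↔ LaplacianCompatible 𝔟 𝔞 B.flip V Ω :=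
  ⟨h.laplacianCompatible_flip 𝔞 𝔟, fun H => by
    have := h.flip.laplacianCompatible_flip 𝔟 𝔞 H
    rwa [LinearMap.flip_flip] at this⟩

/-- A derivation of `Γ(∧A*)` that is linear over the functions acts on the top form by its trace. -/
theorem derivation_form_eq {P : ExteriorAlgebra R L' →+ ExteriorAlgebra R L'} {T : L' →ₗ[R] L'}
    (hP : ∀ a b, P (a * b) = P a * b + a * P b) (hP0 : ∀ f, P (algebraMap R _ f) = 0)
    (hPT : ∀ α, P (ι R α) = ι R (T α)) {J : Type} [Fintype J] {e : J → L} {ε : J → L'}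
    (hε : ∀ θ, θ = ∑ i, B (e i) θ • ε i) : P Ω = (∑ i, B (e i) (T (ε i))) • Ω := by
  -- A derivation that kills functions is determined by T. On Ω each summand becomes a multiple of Ω
  -- because T(ε i) ∧ Ω = 0.
  have key : ∀ w, P w = ∑ i, ι R (T (ε i)) * contract (B (e i)) w := by
    intro w
    induction w using left_induction with
    | algebraMap r => simp only [hP0, contract_algebraMap, mul_zero, Finset.sum_const_zero]
    | add a b ha hb => simp only [map_add, ha, hb, mul_add, Finset.sum_add_distrib]
    | ι_mul θ a ha =>
      have e1 : ι R (T θ) = ∑ i, B (e i) θ • ι R (T (ε i)) := by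
        conv_lhs => rw [hε θ]
        simp only [map_sum, map_smul]
      simp only [hP, hPT, ha, contract_ι_mul, mul_sub, Finset.sum_sub_distrib, mul_smul_comm]
      rw [e1, Finset.sum_mul, Finset.mul_sum, sub_eq_add_neg, ← Finset.sum_neg_distrib]
      congr 1
      · exact Finset.sum_congr rfl fun i _ => smul_mul_assoc _ _ _
      · refine Finset.sum_congr rfl fun i _ => ?_
        rw [← mul_assoc, ← mul_assoc, ι_mul_eq, parity_ι, neg_mul, neg_mul, mul_assoc]
  rw [key, Finset.sum_smul]
  refine Finset.sum_congr rfl fun i _ => ?_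
  have e1 := contract_ι_mul (B (e i)) (T (ε i)) Ω
  rw [h.ι_mul_form, map_zero, eq_comm, sub_eq_zero] at e1
  exact e1.symm

end IsTopPair

end Compatibility

/-! ### The operator L_{u∘θ} - [L_u, L_θ] and its trace -/

section Dorfman

variable {𝕜 R L L' : Type*} [Field 𝕜] [CharZero 𝕜] [CommRing R] [Algebra 𝕜 R]
  [AddCommGroup L] [Module R L] [AddCommGroup L'] [Module R L']
  (𝔞 : LieAlgebroid 𝕜 R L) (𝔟 : LieAlgebroid 𝕜 R L') {B : L →ₗ[R] L' →ₗ[R] R}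
  {Ω : ExteriorAlgebra R L'} {V : ExteriorAlgebra R L}

theorem dorfmanDefect_eq (u : L) (θ : L') (α : ExteriorAlgebra R L') :
    dorfmanDefect 𝔞 𝔟 B u θ α =
      (lieForm 𝔞 B (-insertD 𝔟 B.flip θ u) α + lieMulti 𝔟 (lieOne 𝔞 B u θ) α) -
        (lieForm 𝔞 B u (lieMulti 𝔟 θ α) - lieMulti 𝔟 θ (lieForm 𝔞 B u α)) := rfl

theorem dorfmanDefect_add (u : L) (θ : L') (α β : ExteriorAlgebra R L') :
    dorfmanDefect 𝔞 𝔟 B u θ (α + β) =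
      dorfmanDefect 𝔞 𝔟 B u θ α + dorfmanDefect 𝔞 𝔟 B u θ β := by
  simp only [dorfmanDefect_eq, map_add]
  abel

theorem HasDualBasis.dorfmanDefect_mul (hB : HasDualBasis B) (u : L) (θ : L')
    (a b : ExteriorAlgebra R L') :
    dorfmanDefect 𝔞 𝔟 B u θ (a * b) =
      dorfmanDefect 𝔞 𝔟 B u θ a * b + a * dorfmanDefect 𝔞 𝔟 B u θ b := by
  have h1 := fun x => (lie_isDualDerivation (𝔞 := 𝔞) hB x).map_mul'
  have h2 := fun x => (lie_isDualDerivation (𝔞 := 𝔟) hB.flip x).map_mul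
  simp only [dorfmanDefect_eq]
  rw [commutator_mul (h1 u) (h2 θ), h1, h2]
  noncomm_ring

/-- The left side is the action of L_{u∘θ} - [L_u, L_θ] on f. Linearity of this operator over
functions thus becomes a condition on the defect of Δ(fu). -/
theorem HasDualBasis.anchor_dorfman (hB : HasDualBasis B) (u : L) (θ : L') (f : R) :
    -𝔞.anchor (insertD 𝔟 B.flip θ u) f + 𝔟.anchor (lieOne 𝔞 B u θ) f -
      (𝔞.anchor u (𝔟.anchor θ f) - 𝔟.anchor θ (𝔞.anchor u f)) =
      -B (lapDefect 𝔞 𝔟 B f u) θ := by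
  have e1 := hB.flip.pair_insertD 𝔟 θ (dFun 𝔞 B f) u
  have e2 := hB.pair_lieOne 𝔞 u (dFun 𝔟 B.flip f) θ
  have e3 := hB.flip.pair_lieOne 𝔟 (dFun 𝔞 B f) θ u
  simp only [LinearMap.flip_apply] at e1 e3
  have e4 := hB.flip.pair_dFun 𝔟 (lieOne 𝔞 B u θ) f
  have e5 := hB.flip.pair_dFun 𝔟 θ f
  simp only [LinearMap.flip_apply] at e4 e5
  rw [hB.pair_dFun, hB.pair_dFun, 𝔟.bracket_skew θ] at e1
  rw [e4, e5] at e2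
  rw [e1, e2, lapDefect, map_sub, LinearMap.sub_apply, e3, map_neg]
  ring

theorem HasDualBasis.dorfmanDefect_algebraMap (hB : HasDualBasis B) (u : L) (θ : L') (f : R) :
    dorfmanDefect 𝔞 𝔟 B u θ (algebraMap R _ f) =
      algebraMap R _ (-B (lapDefect 𝔞 𝔟 B f u) θ) := by
  have h1 := fun x => (lie_isDualDerivation (𝔞 := 𝔞) hB x).map_fun'
  have h2 := fun x => (lie_isDualDerivation (𝔞 := 𝔟) hB.flip x).map_fun
  rw [dorfmanDefect_eq, h1, h2, h1, h2, h2, h1, ← hB.anchor_dorfman 𝔞 𝔟]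
  simp only [map_neg, map_add, map_sub, Derivation.neg_apply]

theorem HasDualBasis.dorfmanDefect_mem (hB : HasDualBasis B) (u : L) (θ : L') (α : L') :
    dorfmanDefect 𝔞 𝔟 B u θ (ι R α) ∈ ⋀[R]^1 L' := by
  have h1 := fun x a => (lie_isDualDerivation (𝔞 := 𝔞) hB x).flip.mem (k := 1) (a := a)
  have h2 := fun x a => (lie_isDualDerivation (𝔞 := 𝔟) hB.flip x).mem (k := 1) (a := a)
  have hα := ι_mem_one (R := R) α
  rw [dorfmanDefect_eq]
  exact Submodule.sub_mem _ (Submodule.add_mem _ (h1 _ _ hα) (h2 _ _ hα))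
    (Submodule.sub_mem _ (h1 _ _ (h2 _ _ hα)) (h2 _ _ (h1 _ _ hα)))

namespace IsTopPair

variable {n : ℕ} (h : IsTopPair B n Ω V)

include h

/-- L_x and L_θ scale Ω by -∂x and ∂_*θ, so the operator scales it by an explicit function. The
factor 2 arises because `pair_lapSec` and its dual each contribute one ⟨d_*u, dθ⟩. -/
theorem dorfmanDefect_form (u : L) (θ : L') :
    dorfmanDefect 𝔞 𝔟 B u θ Ω =
      (2 * pair B (differential 𝔟 B.flip (ι R u)) (differential 𝔞 B (ι R θ)) +
        (lapFun 𝔟 𝔞 B.flip V (B u θ) -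
          (B u (lapSec 𝔟 𝔞 B.flip V θ) + B (lapSec 𝔞 𝔟 B Ω u) θ))) • Ω := by
  have h1 := fun x => h.lieForm_form 𝔞 (h.bv_ι 𝔞 x)
  have h2 := fun x => h.flip.lieMulti_multi 𝔟 (h.flip.bv_ι 𝔟 x)
  have h3 := fun x => (lie_isDualDerivation (𝔞 := 𝔞) h.dual x).flip.smul
  have h4 := fun x => (lie_isDualDerivation (𝔞 := 𝔟) h.dual.flip x).smul
  have e1 := h.pair_lapSec 𝔞 𝔟 u θ
  have e2 := h.flip.pair_lapSec 𝔟 𝔞 θ u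
  have e3 := h.flip.lapFun_eq 𝔟 𝔞 (B u θ)
  rw [pair_flip, LinearMap.flip_flip, LinearMap.flip_apply] at e2
  rw [LinearMap.flip_flip] at e3
  rw [dorfmanDefect_eq, h1, h2, h2, h1, h3, h4, h1, h2, h.bvFun_neg, h.dual.lieOne_eq,
    h.flip.bvFun_add, e1, e2, e3]
  simp only [smul_smul, ← add_smul, ← sub_smul]
  congr 1
  rw [map_neg]
  ring

/-- A function-linear derivation scales Ω by its trace. By `dorfmanDefect_form` the trace therefore
differs from 2⟨d_*u, dθ⟩ by exactly the failure of compatibility at (u, θ). -/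
theorem dorfman_iff :
    LaplacianCompatible 𝔞 𝔟 B Ω V ↔ ∀ (u : L) (θ : L'), ∃ T : L' →ₗ[R] L',
      (∀ α, ι R (T α) = dorfmanDefect 𝔞 𝔟 B u θ (ι R α)) ∧
      IsFrameTrace B T
        (2 * pair B (differential 𝔟 B.flip (ι R u)) (differential 𝔞 B (ι R θ))) := by
  have key : ∀ (u : L) (θ : L') (T : L' →ₗ[R] L')
      (hT : ∀ α, ι R (T α) = dorfmanDefect 𝔞 𝔟 B u θ (ι R α))
      (h0 : ∀ f, B (lapDefect 𝔞 𝔟 B f u) θ = 0) {J : Type} [Fintype J] (e : J → L) (ε : J → L')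
      (hε : ∀ θ, θ = ∑ i, B (e i) θ • ε i),
      ∑ i, B (e i) (T (ε i)) =
        2 * pair B (differential 𝔟 B.flip (ι R u)) (differential 𝔞 B (ι R θ)) +
        (lapFun 𝔟 𝔞 B.flip V (B u θ) -
          (B u (lapSec 𝔟 𝔞 B.flip V θ) + B (lapSec 𝔞 𝔟 B Ω u) θ)) := by
    intro u θ T hT h0 J _ e ε hε
    have e1 := h.derivation_form_eq
      (P := AddMonoidHom.mk' (dorfmanDefect 𝔞 𝔟 B u θ) (dorfmanDefect_add 𝔞 𝔟 u θ)) (T := T)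
      (h.dual.dorfmanDefect_mul 𝔞 𝔟 u θ)
      (fun f => (h.dual.dorfmanDefect_algebraMap 𝔞 𝔟 u θ f).trans (by rw [h0]; simp))
      (fun α => (hT α).symm) hε
    rw [AddMonoidHom.mk'_apply, h.dorfmanDefect_form, ← sub_eq_zero, ← sub_smul] at e1
    exact (sub_eq_zero.mp (h.smul_form_injective e1)).symm
  constructor
  · intro H u θ
    have h0 : ∀ f, B (lapDefect 𝔞 𝔟 B f u) θ = 0 := fun f => by
      rw [h.lapDefect_eq_zero 𝔞 𝔟 H, map_zero, LinearMap.zero_apply]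
    let T : L' →ₗ[R] L' :=
      { toFun := fun α => ExteriorAlgebra.ιInv (dorfmanDefect 𝔞 𝔟 B u θ (ι R α))
        map_add' := fun α β => by rw [map_add, dorfmanDefect_add, map_add]
        map_smul' := fun f α => by
          rw [map_smul, Algebra.smul_def, h.dual.dorfmanDefect_mul, h.dual.dorfmanDefect_algebraMap,
            h0, neg_zero, map_zero, zero_mul, zero_add, ← Algebra.smul_def, map_smul]
          rfl }
    have hT : ∀ α, ι R (T α) = dorfmanDefect 𝔞 𝔟 B u θ (ι R α) :=
      fun α => ι_ιInv (h.dual.dorfmanDefect_mem 𝔞 𝔟 u θ α)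
    refine ⟨T, hT, fun J _ e ε he hε => ?_⟩
    rw [key u θ T hT h0 e ε hε, H u θ, sub_self, add_zero]
  · intro H u θ
    obtain ⟨T, hT, htr⟩ := H u θ
    have h0 : ∀ f, B (lapDefect 𝔞 𝔟 B f u) θ = 0 := by
      intro f
      rcases eq_or_ne n 0 with hn | hn
      · rw [h.section_eq_zero hn (lapDefect 𝔞 𝔟 B f u), map_zero, LinearMap.zero_apply]
      -- Linearity of T at fα against the Leibniz rule of the operator: its value on f annihilates
      -- every α.
      · refine h.eq_zero_of_smul_ι hn fun α => ?_
        have e1 := hT (f • α)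
        rw [map_smul, map_smul, map_smul, hT, Algebra.smul_def f (ι R α),
          h.dual.dorfmanDefect_mul, h.dual.dorfmanDefect_algebraMap, ← Algebra.smul_def,
          ← Algebra.smul_def, right_eq_add, neg_smul, neg_eq_zero] at e1
        exact e1
    obtain ⟨J, hJ, e, ε, he, hε⟩ := h.dual
    have e1 := htr J hJ e ε he hε
    rw [key u θ T hT h0 e ε hε, add_eq_left, sub_eq_zero] at e1
    exact e1

end IsTopPair

end Dorfman

/-! ### Lie derivatives of forms on the base -/

section BaseLie

variable {𝕜 R : Type*} [Field 𝕜] [CommRing R] [Algebra 𝕜 R]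

theorem lieBaseForm_spec (X : Derivation 𝕜 R R) :
    (∀ f, lieBaseForm X (algebraMap R _ f) = algebraMap R _ (X f)) ∧
    (∀ α, lieBaseForm X (ι R α) = ι R (lieOneForm X α)) ∧
    ∀ a b, lieBaseForm X (a * b) = a * lieBaseForm X b + lieBaseForm X a * b :=
  (exists_lieBaseForm X).choose_spec

theorem lieBaseForm_smul_form (X : Derivation 𝕜 R R) (f : R) (s : BaseForms 𝕜 R) :
    lieBaseForm X (f • s) = X f • s + f • lieBaseForm X s := by
  rw [Algebra.smul_def, (lieBaseForm_spec X).2.2, (lieBaseForm_spec X).1, ← Algebra.smul_def,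
    ← Algebra.smul_def, add_comm]

theorem lieBaseForm_add (X Y : Derivation 𝕜 R R) :
    lieBaseForm (X + Y) = lieBaseForm X + lieBaseForm Y := by
  refine twisted_derivation_ext (AlgHom.id R _) (fun f => ?_) (fun α => ?_)
    (lieBaseForm_spec _).2.2 (fun a b => ?_)
  · simp [(lieBaseForm_spec _).1]
  · rw [AddMonoidHom.add_apply, (lieBaseForm_spec _).2.1, (lieBaseForm_spec _).2.1,
      (lieBaseForm_spec _).2.1, ← map_add]
    congr 1
    ext Z
    simp [lieOneForm]
    ring
  · simp only [AddMonoidHom.add_apply, (lieBaseForm_spec _).2.2, AlgHom.id_apply]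
    noncomm_ring

theorem lieBaseForm_zero : lieBaseForm (0 : Derivation 𝕜 R R) = 0 := by
  have e := lieBaseForm_add (0 : Derivation 𝕜 R R) 0
  rw [add_zero] at e
  exact left_eq_add.mp e

theorem lieBaseForm_lie (X Y : Derivation 𝕜 R R) (s : BaseForms 𝕜 R) :
    lieBaseForm ⁅X, Y⁆ s =
      lieBaseForm X (lieBaseForm Y s) - lieBaseForm Y (lieBaseForm X s) := by
  refine DFunLike.congr_fun (show lieBaseForm ⁅X, Y⁆ =
    (lieBaseForm X).comp (lieBaseForm Y) - (lieBaseForm Y).comp (lieBaseForm X) from ?_) s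
  refine twisted_derivation_ext (AlgHom.id R _) (fun f => ?_) (fun α => ?_)
    (lieBaseForm_spec _).2.2 (fun a b => ?_)
  · simp [(lieBaseForm_spec _).1, Derivation.commutator_apply]
  · simp only [AddMonoidHom.sub_apply, AddMonoidHom.comp_apply, (lieBaseForm_spec _).2.1]
    rw [← map_sub]
    congr 1
    ext Z
    simp [lieOneForm, Derivation.commutator_apply]
    rw [leibniz_lie X Y Z, map_add]
    ring
  · simp only [AddMonoidHom.sub_apply, AddMonoidHom.comp_apply, (lieBaseForm_spec _).2.2,
      AlgHom.id_apply, map_add]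
    noncomm_ring

end BaseLie

/-! ### Modular cocycles and the formula for Δ -/

section Modular

variable {𝕜 R L L' : Type*} [Field 𝕜] [CharZero 𝕜] [CommRing R] [Algebra 𝕜 R]
  [AddCommGroup L] [Module R L] [AddCommGroup L'] [Module R L']
  (𝔞 : LieAlgebroid 𝕜 R L) (𝔟 : LieAlgebroid 𝕜 R L') {B : L →ₗ[R] L' →ₗ[R] R}
  {Ω : ExteriorAlgebra R L'} {V : ExteriorAlgebra R L} {s : BaseForms 𝕜 R} {X₀ : L} {ξ₀ : L'}

theorem half_mul_two : algebraMap 𝕜 R (1 / 2) * 2 = 1 := by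
  rw [← map_ofNat (algebraMap 𝕜 R) 2, ← map_mul]
  norm_num

theorem eq_half_mul {a b : R} (hab : 2 * a = b) : a = algebraMap 𝕜 R (1 / 2) * b := by
  rw [← hab, ← mul_assoc, half_mul_two, one_mul]

theorem lieSum_isDualDerivation (hB : HasDualBasis B) (x : L) (ξ : L') :
    IsDualDerivation B (fun f => 𝔟.anchor ξ f + 𝔞.anchor x f) (lieSum 𝔟 𝔞 B.flip ξ x)
      (lieSum 𝔞 𝔟 B x ξ) := by
  have h := (lie_isDualDerivation (𝔞 := 𝔟) hB.flip ξ).flip.add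
    (lie_isDualDerivation (𝔞 := 𝔞) hB x)
  rw [LinearMap.flip_flip, add_comm (lieMulti 𝔟 ξ)] at h
  exact h

theorem HasDualBasis.lieSum_ι (hB : HasDualBasis B) (x u : L) (ξ : L') :
    lieSum 𝔟 𝔞 B.flip ξ x (ι R u) = ι R (lieOne 𝔟 B.flip ξ u + 𝔞.bracket x u) := by
  rw [map_add, ← hB.flip.lieForm_ι, ← (schouten_spec 𝔞).section_section]
  rfl

namespace IsTopPair

variable {n : ℕ} (h : IsTopPair B n Ω V)

include h

/-- L_uV = (∂u)V, so the cocycle condition determines how ρ(u) acts on s. -/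
theorem lieBaseForm_anchor (hξ : IsModularCocycle 𝔞 B V s ξ₀) (u : L) :
    lieBaseForm (𝔞.anchor u) s = (B u ξ₀ - bvFun 𝔞 B Ω u) • s := by
  let ℓ : ExteriorAlgebra R L →ₗ[R] R :=
    { toFun := fun U => pair B U Ω
      map_add' := fun U W => by simp [pair, interior]
      map_smul' := fun c U => by simp [pair, interior] }
  have hℓ : ℓ V = 1 := h.pair_eq_one
  -- Pairing the first tensor factor with Ω removes V, since ⟨Ω, V⟩ = 1.
  have e := congrArg (TensorProduct.lift (LinearMap.lsmul R (BaseForms 𝕜 R) ∘ₗ ℓ)) (hξ u)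
  rw [h.lieMulti_multi 𝔞 (h.bv_ι 𝔞 u)] at e
  simp only [map_add, map_smul, TensorProduct.lift.tmul, LinearMap.comp_apply, hℓ,
    LinearMap.lsmul_apply, one_smul, LinearMap.smul_apply] at e
  rw [sub_smul, ← e]
  abel

variable (hs : ∀ r : R, r • s = 0 → r = 0) (hX : IsModularCocycle 𝔟 B.flip Ω s X₀)
  (hξ : IsModularCocycle 𝔞 B V s ξ₀)

include hs hX hξ

/-- With no defect, ρ_*(L_uθ) = [ρ(u), ρ_*(θ)] + ρ(i_θ d_*u) as vector fields. Both sides multiply s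
by functions given by `lieBaseForm_anchor`; cancelling s leaves the claim. Compatibility controls
the sum of ⟨Δu, θ⟩ and ⟨u, Δ_*θ⟩, this identity their difference. -/
theorem pair_lapSec_sub {u : L} {θ : L'} (h0 : ∀ f, B (lapDefect 𝔞 𝔟 B f u) θ = 0) :
    B u (lapSec 𝔟 𝔞 B.flip V θ) - B (lapSec 𝔞 𝔟 B Ω u) θ - lapFun 𝔟 𝔞 B.flip V (B u θ) =
      -B (lieOne 𝔟 B.flip ξ₀ u + 𝔞.bracket X₀ u) θ := by
  have hder : 𝔟.anchor (lieOne 𝔞 B u θ) =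
      ⁅𝔞.anchor u, 𝔟.anchor θ⁆ + 𝔞.anchor (insertD 𝔟 B.flip θ u) := by
    ext f
    have e := h.dual.anchor_dorfman 𝔞 𝔟 u θ f
    rw [h0] at e
    rw [Derivation.add_apply, Derivation.commutator_apply]
    linear_combination e
  have c1 := h.lieBaseForm_anchor 𝔞 hξ
  have c2 := h.flip.lieBaseForm_anchor 𝔟 hX
  -- In the commutator acting on s the products of the two factors cancel, and only the derivatives
  -- of the factors remain.
  have e := c2 (lieOne 𝔞 B u θ)
  rw [hder, lieBaseForm_add, AddMonoidHom.add_apply, lieBaseForm_lie, c1, c1, c2,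
    lieBaseForm_smul_form, lieBaseForm_smul_form, c1, c2, smul_smul, smul_smul, ← add_smul,
    ← add_smul, ← sub_smul, ← add_smul, ← sub_eq_zero, ← sub_smul] at e
  have e := hs _ e
  rw [h.dual.lieOne_eq, h.flip.bvFun_add, ← h.dual.lieOne_eq] at e
  have e1 := h.pair_lapSec 𝔞 𝔟 u θ
  have e2 := h.flip.pair_lapSec 𝔟 𝔞 θ u
  have e3 := h.flip.lapFun_eq 𝔟 𝔞 (B u θ)
  have e4 := h.dual.flip.pair_insertD 𝔟 θ ξ₀ u
  have e5 := h.dual.flip.pair_lieOne 𝔟 ξ₀ θ u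
  have e6 := h.dual.pair_lieOne 𝔞 u X₀ θ
  rw [pair_flip, LinearMap.flip_flip, LinearMap.flip_apply] at e2
  rw [LinearMap.flip_flip] at e3
  simp only [LinearMap.flip_apply, map_sub] at e e4 e5
  rw [𝔟.bracket_skew, map_neg] at e4
  rw [𝔞.bracket_skew, map_neg, LinearMap.neg_apply] at e6
  rw [e4, e6] at e
  rw [map_add, LinearMap.add_apply, e5, e1, e2, e3]
  linear_combination -e

/-- The zero field ρ(d_*f) + ρ_*(df) kills s, while `lieBaseForm_anchor` and its dual compute its
factor, in which ∂d_*f = Δf and ∂_*df = Δ_*f occur. -/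
theorem lapFun_add {f : R}
    (h0 : ∀ r, 𝔞.anchor (dFun 𝔟 B.flip f) r + 𝔟.anchor (dFun 𝔞 B f) r = 0) :
    lapFun 𝔞 𝔟 B Ω f + lapFun 𝔟 𝔞 B.flip V f = 𝔟.anchor ξ₀ f + 𝔞.anchor X₀ f := by
  have hder : 𝔞.anchor (dFun 𝔟 B.flip f) + 𝔟.anchor (dFun 𝔞 B f) = 0 := Derivation.ext h0
  have e := congrArg (fun D => lieBaseForm D s) hder
  simp only [lieBaseForm_add, AddMonoidHom.add_apply, lieBaseForm_zero, AddMonoidHom.zero_apply]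
    at e
  rw [h.lieBaseForm_anchor 𝔞 hξ, h.flip.lieBaseForm_anchor 𝔟 hX, ← add_smul] at e
  have e := hs _ e
  have e2 := h.dual.flip.pair_dFun 𝔟 ξ₀ f
  have e3 := h.dual.pair_dFun 𝔞 X₀ f
  simp only [LinearMap.flip_apply] at e e2
  rw [h.lapFun_eq, h.flip.lapFun_eq, LinearMap.flip_flip, ← e2, ← e3]
  linear_combination -e

/-- Compatibility and `pair_lapSec_sub` together leave 2⟨Δu, θ⟩; on functions Δ = Δ_* turns
`lapFun_add` into a formula for 2Δf. -/
theorem laplacianCompatible_iff_modular :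
    LaplacianCompatible 𝔞 𝔟 B Ω V ↔
      (∀ f : R, laplacian 𝔞 𝔟 B Ω (algebraMap R _ f) =
        algebraMap 𝕜 R (1 / 2) • lieSum 𝔟 𝔞 B.flip ξ₀ X₀ (algebraMap R _ f)) ∧
      ∀ u : L, laplacian 𝔞 𝔟 B Ω (ι R u) =
        algebraMap 𝕜 R (1 / 2) • lieSum 𝔟 𝔞 B.flip ξ₀ X₀ (ι R u) := by
  have hL := lieSum_isDualDerivation 𝔞 𝔟 h.dual X₀ ξ₀
  have conv : ((∀ f : R, laplacian 𝔞 𝔟 B Ω (algebraMap R _ f) =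
        algebraMap 𝕜 R (1 / 2) • lieSum 𝔟 𝔞 B.flip ξ₀ X₀ (algebraMap R _ f)) ∧
      ∀ u : L, laplacian 𝔞 𝔟 B Ω (ι R u) =
        algebraMap 𝕜 R (1 / 2) • lieSum 𝔟 𝔞 B.flip ξ₀ X₀ (ι R u)) ↔
      (∀ f : R, lapFun 𝔞 𝔟 B Ω f =
        algebraMap 𝕜 R (1 / 2) * (𝔟.anchor ξ₀ f + 𝔞.anchor X₀ f)) ∧
      ∀ u : L, lapSec 𝔞 𝔟 B Ω u =
        algebraMap 𝕜 R (1 / 2) • (lieOne 𝔟 B.flip ξ₀ u + 𝔞.bracket X₀ u) := by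
    refine and_congr (forall_congr' fun f => ?_) (forall_congr' fun u => ?_)
    · rw [h.laplacian_algebraMap, hL.map_fun, Algebra.smul_def, ← map_mul, algebraMap_inj]
    · rw [h.laplacian_ι, h.dual.lieSum_ι, ← map_smul, ExteriorAlgebra.ι_inj]
  rw [conv]
  constructor
  · intro H
    refine ⟨fun f => eq_half_mul ?_, fun u => h.dual.flip.pair_left_ext fun θ => ?_⟩
    · have e := h.lapFun_add 𝔞 𝔟 hs hX hξ fun r => (h.anchor_dFun_add_eq_zero 𝔞 𝔟 H f r).1
      rw [← (h.anchor_dFun_add_eq_zero 𝔞 𝔟 H f 0).2] at e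
      rw [← e]; ring
    · have e := h.pair_lapSec_sub 𝔞 𝔟 hs hX hξ (u := u) (θ := θ) fun f => by
        rw [h.lapDefect_eq_zero 𝔞 𝔟 H, map_zero, LinearMap.zero_apply]
      rw [map_smul, smul_eq_mul, LinearMap.flip_apply, LinearMap.flip_apply]
      refine eq_half_mul ?_
      linear_combination -e - H u θ
  · rintro ⟨H1, H2⟩
    -- Half a Lie derivative obeys the Leibniz rule on fu, so there is no defect, and
    -- `pair_lapSec_sub` can be read backwards.
    have hdef : ∀ f u, lapDefect 𝔞 𝔟 B f u = 0 := by
      intro f u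
      have e := h.lapSec_smul 𝔞 𝔟 f u
      rw [H2, H2, H1, h.dual.flip.lieOne_smul, 𝔞.leibniz] at e
      rw [← sub_eq_zero.mpr e.symm]
      module
    intro u θ
    have e := h.pair_lapSec_sub 𝔞 𝔟 hs hX hξ (u := u) (θ := θ) fun f => by
      rw [hdef, map_zero, LinearMap.zero_apply]
    have e2 := congrArg (fun x => 2 * B x θ) (H2 u)
    simp only [map_smul, LinearMap.smul_apply, smul_eq_mul] at e2
    rw [← mul_assoc, mul_comm 2 (algebraMap 𝕜 R _), half_mul_two, one_mul] at e2
    linear_combination -e - e2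

/-- A Laplacian that is a derivation is half the Lie derivative along the modular cocycles. -/
theorem laplacian_eq_of_derivation (H : ∀ u v, laplacian 𝔞 𝔟 B Ω (u * v) =
      laplacian 𝔞 𝔟 B Ω u * v + u * laplacian 𝔞 𝔟 B Ω v) (u : ExteriorAlgebra R L) :
    laplacian 𝔞 𝔟 B Ω u = algebraMap 𝕜 R (1 / 2) • lieSum 𝔟 𝔞 B.flip ξ₀ X₀ u := by
  have hL := lieSum_isDualDerivation 𝔞 𝔟 h.dual X₀ ξ₀
  -- A derivation is compatible with the pairing, which settles degrees zero and one; these generate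
  -- the exterior algebra.
  obtain ⟨H0, H1⟩ := (h.laplacianCompatible_iff_modular 𝔞 𝔟 hs hX hξ).mp
    ((h.laplacianCompatible_iff 𝔞 𝔟).mp (h.laplacian_pairing 𝔞 𝔟 H))
  induction u using ExteriorAlgebra.induction with
  | algebraMap r => exact H0 r
  | ι x => exact H1 x
  | mul a b ha hb =>
    rw [H, ha, hb, hL.map_mul, smul_add, smul_mul_assoc, mul_smul_comm]
  | add a b ha hb => rw [h.laplacian_add, ha, hb, map_add, smul_add]

/-- The passage between the two sides is made at the explicit formulas, where the dual derivation is
known; each derivation property is then recovered from the formula on its own side. -/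
theorem bialgebroid_tfae :
    List.TFAE [
      ∀ (k l : ℕ), ∀ u ∈ ⋀[R]^k L, ∀ v ∈ ⋀[R]^l L,
        differential 𝔟 B.flip (schouten 𝔞 u v) = schouten 𝔞 (differential 𝔟 B.flip u) v +
          (-1 : R) ^ (k + 1) • schouten 𝔞 u (differential 𝔟 B.flip v),
      ∀ (k l : ℕ), ∀ θ ∈ ⋀[R]^k L', ∀ η ∈ ⋀[R]^l L',
        differential 𝔞 B (schouten 𝔟 θ η) = schouten 𝔟 (differential 𝔞 B θ) η +
          (-1 : R) ^ (k + 1) • schouten 𝔟 θ (differential 𝔞 B η),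
      ∀ u v, laplacian 𝔞 𝔟 B Ω (u * v) =
        laplacian 𝔞 𝔟 B Ω u * v + u * laplacian 𝔞 𝔟 B Ω v,
      ∀ θ η, laplacian 𝔟 𝔞 B.flip V (θ * η) =
        laplacian 𝔟 𝔞 B.flip V θ * η + θ * laplacian 𝔟 𝔞 B.flip V η,
      ∀ u, laplacian 𝔞 𝔟 B Ω u = algebraMap 𝕜 R (1 / 2) • lieSum 𝔟 𝔞 B.flip ξ₀ X₀ u,
      ∀ θ, laplacian 𝔟 𝔞 B.flip V θ = algebraMap 𝕜 R (1 / 2) • lieSum 𝔞 𝔟 B X₀ ξ₀ θ] := by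
  have hL := lieSum_isDualDerivation 𝔞 𝔟 h.dual X₀ ξ₀
  have hu : IsUnit (algebraMap 𝕜 R (1 / 2)) := .of_mul_eq_one _ half_mul_two
  tfae_have 1 ↔ 3 := h.derivation_schouten_iff 𝔞 𝔟
  tfae_have 2 ↔ 4 := h.flip.derivation_schouten_iff 𝔟 𝔞
  tfae_have 3 → 5 := h.laplacian_eq_of_derivation 𝔞 𝔟 hs hX hξ
  tfae_have 5 → 6 := h.laplacian_flip_eq 𝔞 𝔟 hL hu
  tfae_have 6 → 4 := fun H θ η => by
    rw [H, H, H, hL.map_mul', smul_add, smul_mul_assoc, mul_smul_comm]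
  tfae_have 4 → 6 := h.flip.laplacian_eq_of_derivation 𝔟 𝔞 hs hξ hX
  tfae_have 6 → 5 := h.flip.laplacian_flip_eq 𝔟 𝔞 hL.flip hu
  tfae_have 5 → 3 := fun H θ η => by
    rw [H, H, H, hL.map_mul, smul_add, smul_mul_assoc, mul_smul_comm]
  tfae_finish

theorem laplacianCompatible_tfae :
    List.TFAE [
      ∀ (u : L) (θ : L'), laplacian 𝔟 𝔞 B.flip V (algebraMap R _ (B u θ)) =
        algebraMap R _ (pair B (ι R u) (laplacian 𝔟 𝔞 B.flip V (ι R θ)) +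
          pair B (laplacian 𝔞 𝔟 B Ω (ι R u)) (ι R θ)),
      ∀ (u : L) (θ : L'), laplacian 𝔞 𝔟 B Ω (algebraMap R _ (B u θ)) =
        algebraMap R _ (pair B (ι R u) (laplacian 𝔟 𝔞 B.flip V (ι R θ)) +
          pair B (laplacian 𝔞 𝔟 B Ω (ι R u)) (ι R θ)),
      ∀ (u : L) (θ : L'), ∃ T : L' →ₗ[R] L',
        (∀ α, ι R (T α) = dorfmanDefect 𝔞 𝔟 B u θ (ι R α)) ∧
        IsFrameTrace B T
          (2 * pair B (differential 𝔟 B.flip (ι R u)) (differential 𝔞 B (ι R θ))),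
      ∀ (θ : L') (u : L), ∃ T : L →ₗ[R] L,
        (∀ x, ι R (T x) = dorfmanDefect 𝔟 𝔞 B.flip θ u (ι R x)) ∧
        IsFrameTrace B.flip T
          (2 * pair B.flip (differential 𝔞 B (ι R θ)) (differential 𝔟 B.flip (ι R u))),
      (∀ f : R, laplacian 𝔞 𝔟 B Ω (algebraMap R _ f) =
        algebraMap 𝕜 R (1 / 2) • lieSum 𝔟 𝔞 B.flip ξ₀ X₀ (algebraMap R _ f)) ∧
        ∀ u : L, laplacian 𝔞 𝔟 B Ω (ι R u) =
          algebraMap 𝕜 R (1 / 2) • lieSum 𝔟 𝔞 B.flip ξ₀ X₀ (ι R u),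
      (∀ f : R, laplacian 𝔟 𝔞 B.flip V (algebraMap R _ f) =
        algebraMap 𝕜 R (1 / 2) • lieSum 𝔞 𝔟 B X₀ ξ₀ (algebraMap R _ f)) ∧
        ∀ θ : L', laplacian 𝔟 𝔞 B.flip V (ι R θ) =
          algebraMap 𝕜 R (1 / 2) • lieSum 𝔞 𝔟 B X₀ ξ₀ (ι R θ)] := by
  rw [h.laplacianCompatible_iff, h.laplacianCompatible_flip_iff]
  tfae_have 1 ↔ 2 := h.laplacianCompatible_comm 𝔞 𝔟
  tfae_have 1 ↔ 3 := h.dorfman_iff 𝔞 𝔟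
  tfae_have 2 ↔ 4 := h.flip.dorfman_iff 𝔟 𝔞
  tfae_have 1 ↔ 5 := h.laplacianCompatible_iff_modular 𝔞 𝔟 hs hX hξ
  tfae_have 2 ↔ 6 := h.flip.laplacianCompatible_iff_modular 𝔟 𝔞 hs hξ hX
  tfae_finish

end IsTopPair

end Modular

/-! ### Exterior powers and traces from frames -/

theorem pow_smul_exteriorPower_eq_zero {R L : Type*} [CommRing R] [AddCommGroup L] [Module R L]
    {n : ℕ} {r : R} {v : Fin n → L} {c : L → Fin n → R} (hr : ∀ y, r • y = ∑ k, c y k • v k)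
    {u : ExteriorAlgebra R L} (hu : u ∈ ⋀[R]^(n + 1) L) : r ^ (n + 1) • u = 0 := by
  rw [← ExteriorAlgebra.ιMulti_span_fixedDegree] at hu
  induction hu using Submodule.span_induction with
  | mem u hu =>
    obtain ⟨y, rfl⟩ := hu
    -- One factor r goes to each of the n + 1 arguments, which then lie in the span of the v k.
    have e1 : r ^ (n + 1) • ExteriorAlgebra.ιMulti R (n + 1) y =
        ExteriorAlgebra.ιMulti R (n + 1) fun i => ∑ k, c (y i) k • v k := by
      simp only [← hr]
      have := (ExteriorAlgebra.ιMulti R (M := L) (n + 1)).toMultilinearMap.map_smul_univ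
        (fun _ => r) y
      simp only [Finset.prod_const, Finset.card_univ, Fintype.card_fin] at this
      exact this.symm
    rw [e1]
    refine ((ExteriorAlgebra.ιMulti R (M := L) (n + 1)).toMultilinearMap.map_sum
      (fun i k => c (y i) k • v k)).trans (Finset.sum_eq_zero fun κ _ => ?_)
    refine ((ExteriorAlgebra.ιMulti R (M := L) (n + 1)).toMultilinearMap.map_smul_univ
      (fun i => c (y i) (κ i)) fun i => v (κ i)).trans ?_
    -- Pigeonhole: n + 1 indices with only n values, so some factor repeats.
    have hκ : ¬ Function.Injective fun i => v (κ i) := by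
      intro hinj
      have := Fintype.card_le_of_injective κ fun i j hij => hinj (congrArg v hij)
      simp at this
    refine (congrArg _ ((ExteriorAlgebra.ιMulti R (M := L) (n + 1)).map_eq_zero_of_not_injective
      _ hκ)).trans (smul_zero _)
  | zero => rw [smul_zero]
  | add x y hx hy h1 h2 => rw [smul_add, h1, h2, add_zero]
  | smul a x hx h1 => rw [smul_comm, h1, smul_zero]

/-- T is the sum of the rank-one maps y ↦ φ i y • T (b i). The b i need only span in this dual
sense; they need not be independent. -/
theorem trace_eq_sum_of_frame {K P J : Type*} [Field K] [AddCommGroup P] [Module K P]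
    [Module.Finite K P] [Fintype J] {b : J → P} {φ : J → Module.Dual K P}
    (hb : ∀ y, y = ∑ i, φ i y • b i) (T : P →ₗ[K] P) :
    LinearMap.trace K P T = ∑ i, φ i (T (b i)) := by
  have e : T = ∑ i, (φ i).smulRight (T (b i)) := by
    ext y
    conv_lhs => rw [hb y]
    simp
  conv_lhs => rw [e]
  simp

/-- The trace of an endomorphism of sections and the trace in a fibre. -/
theorem exists_fibre_trace_iff {R L L' K P : Type*} [CommRing R] [AddCommGroup L] [Module R L]
    [AddCommGroup L'] [Module R L'] [Field K] [AddCommGroup P] [Module K P] [Module.Finite K P]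
    {B : L →ₗ[R] L' →ₗ[R] R} (T : L' →ₗ[R] L') (t : R) (φ : R →+* K) (ev : L' →+ P)
    (hsmul : ∀ f θ, ev (f • θ) = φ f • ev θ) (hsurj : Function.Surjective ev)
    (coev : L → Module.Dual K P) (hpair : ∀ x θ, coev x (ev θ) = φ (B x θ))
    {J : Type} [Fintype J] {e : J → L} {ε : J → L'} (hε : ∀ θ, θ = ∑ i, B (e i) θ • ε i) :
    (∃ Tp : P →ₗ[K] P, (∀ α, ev (T α) = Tp (ev α)) ∧ LinearMap.trace K P Tp = φ t) ↔
      φ (∑ i, B (e i) (T (ε i))) = φ t := by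
  have hfr : ∀ y, y = ∑ i, coev (e i) y • ev (ε i) := by
    intro y
    obtain ⟨θ, rfl⟩ := hsurj y
    conv_lhs => rw [hε θ]
    simp only [map_sum, hsmul, hpair]
  have htr : ∀ Tp : P →ₗ[K] P, (∀ α, ev (T α) = Tp (ev α)) →
      LinearMap.trace K P Tp = φ (∑ i, B (e i) (T (ε i))) := by
    intro Tp hTp
    rw [trace_eq_sum_of_frame hfr, map_sum]
    simp only [← hTp, hpair]
  constructor
  · rintro ⟨Tp, hTp, h⟩
    rw [← htr Tp hTp, h]
  · intro h
    -- The frame dictates the fibre map; linearity of T over functions makes it compatible with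
    -- evaluation.
    let Tp : P →ₗ[K] P := ∑ i, (coev (e i)).smulRight (ev (T (ε i)))
    have hTp : ∀ α, ev (T α) = Tp (ev α) := by
      intro α
      conv_lhs => rw [hε α]
      simp only [map_sum, map_smul, hsmul, Tp, LinearMap.sum_apply, LinearMap.smulRight_apply,
        hpair]
    exact ⟨Tp, hTp, (htr Tp hTp).trans h⟩

theorem finite_fibre {𝕜 : Type*} [RCLike 𝕜] (n : ℕ) {M : Type*} [TopologicalSpace M]
    {A : M → Type*} [TopologicalSpace (Bundle.TotalSpace (Fin n → 𝕜) A)]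
    [∀ p, TopologicalSpace (A p)] [∀ p, AddCommGroup (A p)] [∀ p, Module 𝕜 (A p)]
    [FiberBundle (Fin n → 𝕜) A] [VectorBundle 𝕜 (Fin n → 𝕜) A] (p : M) : Module.Finite 𝕜 (A p) :=
  Module.Finite.equiv ((trivializationAt (Fin n → 𝕜) A p).linearEquivAt 𝕜 p
    (FiberBundle.mem_baseSet_trivializationAt' p)).symm

/-! ### Vector bundles with dual top sections -/

section Geometry

variable {𝕜 : Type*} [RCLike 𝕜] {m n : ℕ} {M : Type*} [TopologicalSpace M]
  [ChartedSpace (EuclideanSpace ℝ (Fin m)) M]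
  {A : M → Type*} [TopologicalSpace (Bundle.TotalSpace (Fin n → 𝕜) A)]
  [∀ p, TopologicalSpace (A p)] [∀ p, AddCommGroup (A p)] [∀ p, Module 𝕜 (A p)]
  [∀ p, Module ℝ (A p)] [FiberBundle (Fin n → 𝕜) A]
  [VectorBundle 𝕜 (Fin n → 𝕜) A] [VectorBundle ℝ (Fin n → 𝕜) A]

/-- The value of a top form on sections. -/
def topEval (Ω : ExteriorAlgebra (Fn 𝕜 m M) (DualSec 𝕜 m n M A)) (v : Fin n → Sec 𝕜 m n M A) :
    Fn 𝕜 m M :=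
  pair (duality 𝕜 m n M A) (ExteriorAlgebra.ιMulti (Fn 𝕜 m M) n v) Ω

/-- V is a combination of products of n sections, so 1 = ⟨Ω, V⟩ is a combination of values of Ω.
This global relation does the work of a partition of unity. -/
theorem span_topEval_eq_top {Ω : ExteriorAlgebra (Fn 𝕜 m M) (DualSec 𝕜 m n M A)}
    {V : ExteriorAlgebra (Fn 𝕜 m M) (Sec 𝕜 m n M A)} (hV : V ∈ ⋀[Fn 𝕜 m M]^n (Sec 𝕜 m n M A))
    (hΩV : pair (duality 𝕜 m n M A) V Ω = 1) : Ideal.span (Set.range (topEval Ω)) = ⊤ := by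
  let ℓ : ExteriorAlgebra (Fn 𝕜 m M) (Sec 𝕜 m n M A) →ₗ[Fn 𝕜 m M] Fn 𝕜 m M :=
    { toFun := fun U => pair (duality 𝕜 m n M A) U Ω
      map_add' := fun U W => by simp [pair, interior]
      map_smul' := fun c U => by simp [pair, interior] }
  rw [Ideal.eq_top_iff_one]
  have h1 : ℓ V ∈ Submodule.map ℓ (⋀[Fn 𝕜 m M]^n (Sec 𝕜 m n M A)) := ⟨V, hV, rfl⟩
  rw [← ExteriorAlgebra.ιMulti_span_fixedDegree, Submodule.map_span, ← Set.range_comp] at h1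
  rw [← hΩV]
  exact h1

/-- Cramer's rule in each fibre. With the square, both sides vanish where Ω(v) does, so no
independence of v is needed. -/
theorem topEval_sq_smul (Ω : ExteriorAlgebra (Fn 𝕜 m M) (DualSec 𝕜 m n M A))
    (v : Fin n → Sec 𝕜 m n M A) (y : Sec 𝕜 m n M A) :
    topEval Ω v ^ 2 • y =
      ∑ k, (topEval Ω v * topEval Ω (Function.update v k y)) • v k := by
  refine Subtype.ext (funext fun p => ?_)
  obtain ⟨w, hw⟩ := exists_fibre_form (n := n) Ω p
  have := finite_fibre (𝕜 := 𝕜) n (A := A) p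
  have hup : ∀ k, (fun i => (Function.update v k y i).1 p) =
      Function.update (fun i => (v i).1 p) k (y.1 p) := fun k => by
    funext i
    by_cases hi : i = k
    · subst hi; simp
    · simp [hi]
  have e := smul_eq_sum_update (finrank_fibre p) w (fun i => (v i).1 p) (y.1 p)
  simp only [← hup, ← hw] at e
  exact e.trans (map_sum (secAt (𝕜 := 𝕜) (m := m) (n := n) (A := A) p)
    (fun k => (topEval Ω v * topEval Ω (Function.update v k y)) • v k) Finset.univ).symm

/-- The values of Ω generate the unit ideal, so one is nonzero at p and its n sections form a basis
there; constant coefficients then reach every vector. -/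
theorem secAt_surjective {Ω : ExteriorAlgebra (Fn 𝕜 m M) (DualSec 𝕜 m n M A)}
    {V : ExteriorAlgebra (Fn 𝕜 m M) (Sec 𝕜 m n M A)} (hV : V ∈ ⋀[Fn 𝕜 m M]^n (Sec 𝕜 m n M A))
    (hΩV : pair (duality 𝕜 m n M A) V Ω = 1) (p : M) :
    Function.Surjective (secAt (𝕜 := 𝕜) (m := m) (n := n) (A := A) p) := by
  intro y
  obtain ⟨w, hw⟩ := exists_fibre_form (n := n) Ω p
  have := finite_fibre (𝕜 := 𝕜) n (A := A) p
  obtain ⟨v, hv⟩ : ∃ v, evalAt p (topEval Ω v) ≠ 0 := by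
    by_contra! H
    have hle : Ideal.span (Set.range (topEval Ω)) ≤ RingHom.ker (evalAt (𝕜 := 𝕜) (m := m) p) := by
      rw [Ideal.span_le]
      rintro _ ⟨v, rfl⟩
      exact H v
    rw [span_topEval_eq_top hV hΩV, top_le_iff, Ideal.eq_top_iff_one, RingHom.mem_ker,
      map_one] at hle
    exact one_ne_zero hle
  have hv' : (w fun i => (v i).1 p) ≠ 0 := by rw [← hw]; exact hv
  have e := smul_eq_sum_update (finrank_fibre p) w (fun i => (v i).1 p) y
  have key : ∀ (c : 𝕜) (x : Sec 𝕜 m n M A),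
      secAt p (algebraMap 𝕜 (Fn 𝕜 m M) c • x) = c • x.1 p := fun c x => rfl
  refine ⟨∑ k, algebraMap 𝕜 (Fn 𝕜 m M) (((w fun i => (v i).1 p) ^ 2)⁻¹ *
    ((w fun i => (v i).1 p) * w (Function.update (fun i => (v i).1 p) k y))) • v k, ?_⟩
  rw [map_sum]
  simp only [key, mul_smul _ (_ * _)]
  rw [← Finset.smul_sum, ← e, smul_smul, inv_mul_cancel₀ (pow_ne_zero 2 hv'), one_smul]

/-- By Cramer's rule a power of each value Ω(v) kills degree n + 1, and these powers still generate
the unit ideal. -/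
theorem isTopPair_duality {Ω : ExteriorAlgebra (Fn 𝕜 m M) (DualSec 𝕜 m n M A)}
    (hΩ : Ω ∈ ⋀[Fn 𝕜 m M]^n (DualSec 𝕜 m n M A))
    {V : ExteriorAlgebra (Fn 𝕜 m M) (Sec 𝕜 m n M A)} (hV : V ∈ ⋀[Fn 𝕜 m M]^n (Sec 𝕜 m n M A))
    (hΩV : pair (duality 𝕜 m n M A) V Ω = 1) : IsTopPair (duality 𝕜 m n M A) n Ω V := by
  have hB := hasDualBasis_duality Ω V hV hΩV
  -- The exponent is the square of Cramer's rule, once for each of n + 1 factors.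
  have htop := Ideal.span_pow_eq_top _ (span_topEval_eq_top hV hΩV) (2 * (n + 1))
  have descend : ∀ {N : Type _} [AddCommGroup N] [Module (Fn 𝕜 m M) N] (u : N),
      (∀ v, (topEval Ω v ^ 2) ^ (n + 1) • u = 0) → u = 0 := by
    intro N _ _ u hu
    have hle : Ideal.span ((fun x => x ^ (2 * (n + 1))) '' Set.range (topEval Ω)) ≤
        LinearMap.ker (LinearMap.toSpanSingleton (Fn 𝕜 m M) N u) := by
      rw [Ideal.span_le]
      rintro _ ⟨_, ⟨v, rfl⟩, rfl⟩
      have := hu v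
      rw [← pow_mul] at this
      exact this
    rw [htop, top_le_iff, Ideal.eq_top_iff_one, LinearMap.mem_ker,
      LinearMap.toSpanSingleton_apply, one_smul] at hle
    exact hle
  refine ⟨hB, hΩ, hV, hΩV, fun u hu => descend u fun v => ?_, fun u hu => descend u fun v => ?_⟩
  · exact pow_smul_exteriorPower_eq_zero (topEval_sq_smul Ω v) hu
  · obtain ⟨J, _, e, ε, he, hε⟩ := hB
    -- The n one-forms y ↦ Ω(v) Ω(v with y in place k), expanded in the dual basis. Cramer's rule
    -- paired with θ expresses Ω(v)² θ through them, with coefficients ⟨v k, θ⟩.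
    refine pow_smul_exteriorPower_eq_zero (v := fun k => ∑ i, (topEval Ω v *
      topEval Ω (Function.update v k (e i))) • ε i)
      (c := fun θ k => duality 𝕜 m n M A (v k) θ) (fun θ => ?_) hu
    conv_lhs => rw [hε θ, Finset.smul_sum]
    simp only [Finset.smul_sum]
    rw [Finset.sum_comm]
    refine Finset.sum_congr rfl fun i _ => ?_
    have e1 := congrArg (fun x => duality 𝕜 m n M A x θ) (topEval_sq_smul Ω v (e i))
    simp only [map_smul, map_sum, LinearMap.smul_apply, LinearMap.sum_apply, smul_eq_mul] at e1
    rw [smul_smul, e1, Finset.sum_smul]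
    refine Finset.sum_congr rfl fun k _ => ?_
    rw [smul_smul, mul_comm]

theorem dualSecAt_surjective {Ω : ExteriorAlgebra (Fn 𝕜 m M) (DualSec 𝕜 m n M A)}
    {V : ExteriorAlgebra (Fn 𝕜 m M) (Sec 𝕜 m n M A)} (hV : V ∈ ⋀[Fn 𝕜 m M]^n (Sec 𝕜 m n M A))
    (hΩV : pair (duality 𝕜 m n M A) V Ω = 1) (p : M) :
    Function.Surjective (dualSecAt (𝕜 := 𝕜) (m := m) (n := n) (A := A) p) := by
  intro α
  obtain ⟨J, _, e, ε, he, hε⟩ := hasDualBasis_duality Ω V hV hΩV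
  have key : ∀ (c : 𝕜) (x : DualSec 𝕜 m n M A),
      dualSecAt p (algebraMap 𝕜 (Fn 𝕜 m M) c • x) = c • x.1 p := fun c x => rfl
  refine ⟨∑ i, algebraMap 𝕜 (Fn 𝕜 m M) (α ((e i).1 p)) • ε i, ?_⟩
  rw [map_sum]
  simp only [key]
  ext y
  obtain ⟨x, rfl⟩ := secAt_surjective hV hΩV p y
  have e1 : secAt p x = ∑ i, (ε i).1 p (secAt p x) • (e i).1 p := by
    conv_lhs => rw [he x]
    rw [map_sum]
    rfl
  conv_rhs => rw [e1]
  rw [map_sum, LinearMap.sum_apply]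
  refine Finset.sum_congr rfl fun i _ => ?_
  rw [map_smul, LinearMap.smul_apply, smul_eq_mul, smul_eq_mul, mul_comm]

theorem eq_iff_evalAt {f g : Fn 𝕜 m M} : f = g ↔ ∀ p, evalAt p f = evalAt p g :=
  ⟨fun h _ => by rw [h], fun h => Subtype.ext (funext h)⟩

/-- A dual basis of sections restricts to a frame of each fibre, so fibre traces are values of the
frame sum; a dual basis exists, so the quantifier over all of them is not vacuous. -/
theorem hasTrace_iff {Ω : ExteriorAlgebra (Fn 𝕜 m M) (DualSec 𝕜 m n M A)}
    {V : ExteriorAlgebra (Fn 𝕜 m M) (Sec 𝕜 m n M A)} (hV : V ∈ ⋀[Fn 𝕜 m M]^n (Sec 𝕜 m n M A))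
    (hΩV : pair (duality 𝕜 m n M A) V Ω = 1)
    (T : Sec 𝕜 m n M A →ₗ[Fn 𝕜 m M] Sec 𝕜 m n M A) (t : Fn 𝕜 m M) :
    HasTrace T t ↔ IsFrameTrace (duality 𝕜 m n M A).flip T t := by
  have key : ∀ (J : Type) (_ : Fintype J) (e : J → DualSec 𝕜 m n M A) (ε : J → Sec 𝕜 m n M A)
      (_ : ∀ θ, θ = ∑ i, (duality 𝕜 m n M A).flip (e i) θ • ε i),
      HasTrace T t ↔ ∑ i, (duality 𝕜 m n M A).flip (e i) (T (ε i)) = t := by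
    intro J _ e ε hε
    rw [eq_iff_evalAt]
    refine forall_congr' fun p => ?_
    have := finite_fibre (𝕜 := 𝕜) n (A := A) p
    exact exists_fibre_trace_iff T t (evalAt p) (secAt p) (fun _ _ => rfl)
      (secAt_surjective hV hΩV p) (fun θ => θ.1 p) (fun _ _ => rfl) hε
  constructor
  · intro H J _ e ε _ hε
    exact (key J _ e ε hε).mp H
  · intro H
    obtain ⟨J, _, e, ε, he, hε⟩ := (hasDualBasis_duality Ω V hV hΩV).flip
    exact (key J _ e ε hε).mpr (H J _ e ε he hε)

theorem hasDualTrace_iff {Ω : ExteriorAlgebra (Fn 𝕜 m M) (DualSec 𝕜 m n M A)}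
    {V : ExteriorAlgebra (Fn 𝕜 m M) (Sec 𝕜 m n M A)} (hV : V ∈ ⋀[Fn 𝕜 m M]^n (Sec 𝕜 m n M A))
    (hΩV : pair (duality 𝕜 m n M A) V Ω = 1)
    (T : DualSec 𝕜 m n M A →ₗ[Fn 𝕜 m M] DualSec 𝕜 m n M A) (t : Fn 𝕜 m M) :
    HasDualTrace T t ↔ IsFrameTrace (duality 𝕜 m n M A) T t := by
  have key : ∀ (J : Type) (_ : Fintype J) (e : J → Sec 𝕜 m n M A) (ε : J → DualSec 𝕜 m n M A)
      (_ : ∀ θ, θ = ∑ i, duality 𝕜 m n M A (e i) θ • ε i),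
      HasDualTrace T t ↔ ∑ i, duality 𝕜 m n M A (e i) (T (ε i)) = t := by
    intro J _ e ε hε
    rw [eq_iff_evalAt]
    refine forall_congr' fun p => ?_
    have := finite_fibre (𝕜 := 𝕜) n (A := A) p
    exact exists_fibre_trace_iff T t (evalAt p) (dualSecAt p) (fun _ _ => rfl)
      (dualSecAt_surjective hV hΩV p) (fun x => Module.Dual.eval 𝕜 (A p) (x.1 p))
      (fun _ _ => rfl) hε
  constructor
  · intro H J _ e ε _ hε
    exact (key J _ e ε hε).mp H
  · intro H
    obtain ⟨J, _, e, ε, he, hε⟩ := hasDualBasis_duality Ω V hV hΩV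
    exact (key J _ e ε hε).mpr (H J _ e ε he hε)

/-- At each point some vector fields give s a nonzero value, so r vanishes there. This permits
cancelling s. -/
theorem IsVolumeForm.smul_eq_zero {s : BaseForms 𝕜 (Fn 𝕜 m M)} (hs : IsVolumeForm s)
    (r : Fn 𝕜 m M) (hr : r • s = 0) : r = 0 := by
  rw [eq_iff_evalAt]
  intro p
  obtain ⟨Y, hY⟩ := hs.2 p
  have e : r * evalBaseForm s Y = 0 := by
    rw [evalBaseForm, ← pair_smul, hr]
    simp [pair]
  have e2 := congrArg (evalAt p) e
  rw [map_mul, map_zero] at e2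
  rw [map_zero]
  exact (mul_eq_zero.mp e2).resolve_right hY

end Geometry

end LieAlgebroidPair

end

/-! ### The theorem for a pair of Lie algebroids in duality -/

theorem theorem2p4 {𝕜 : Type*} [RCLike 𝕜] {m n : ℕ}
    {M : Type*} [TopologicalSpace M] [ChartedSpace (EuclideanSpace ℝ (Fin m)) M]
    [IsManifold (𝓡 m) ∞ M] [T2Space M] [SigmaCompactSpace M]
    {A : M → Type*} [TopologicalSpace (Bundle.TotalSpace (Fin n → 𝕜) A)]
    [∀ p, TopologicalSpace (A p)] [∀ p, AddCommGroup (A p)] [∀ p, Module 𝕜 (A p)]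
    [∀ p, Module ℝ (A p)] [∀ p, IsScalarTower ℝ 𝕜 (A p)] [FiberBundle (Fin n → 𝕜) A]
    [VectorBundle 𝕜 (Fin n → 𝕜) A] [VectorBundle ℝ (Fin n → 𝕜) A]
    [ContMDiffVectorBundle ∞ (Fin n → 𝕜) A (𝓡 m)]
    (𝔞 : LieAlgebroid 𝕜 (Fn 𝕜 m M) (Sec 𝕜 m n M A))
    (𝔟 : LieAlgebroid 𝕜 (Fn 𝕜 m M) (DualSec 𝕜 m n M A))
    (Ω : ExteriorAlgebra (Fn 𝕜 m M) (DualSec 𝕜 m n M A))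
    (hΩ : Ω ∈ ⋀[Fn 𝕜 m M]^n (DualSec 𝕜 m n M A))
    (V : ExteriorAlgebra (Fn 𝕜 m M) (Sec 𝕜 m n M A))
    (hV : V ∈ ⋀[Fn 𝕜 m M]^n (Sec 𝕜 m n M A))
    (hΩV : pair (duality 𝕜 m n M A) V Ω = 1)
    (s : BaseForms 𝕜 (Fn 𝕜 m M)) (hs : IsVolumeForm s)
    (X₀ : Sec 𝕜 m n M A) (hX₀ : IsModularCocycle 𝔟 (duality 𝕜 m n M A).flip Ω s X₀)
    (ξ₀ : DualSec 𝕜 m n M A) (hξ₀ : IsModularCocycle 𝔞 (duality 𝕜 m n M A) V s ξ₀) :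
    let R := Fn 𝕜 m M
    let B := duality 𝕜 m n M A
    let d := differential 𝔞 B
    let dStar := differential 𝔟 B.flip
    let Δ := laplacian 𝔞 𝔟 B Ω
    let ΔStar := laplacian 𝔟 𝔞 B.flip V
    let half : R := algebraMap 𝕜 R (1 / 2)
    -- `L_{X₀} + L_{ξ₀}` on `Γ(∧A)` and on `Γ(∧A*)`
    let Lie := lieSum 𝔟 𝔞 B.flip ξ₀ X₀
    let LieStar := lieSum 𝔞 𝔟 B X₀ ξ₀
    List.TFAE [
      ∀ (k l : ℕ), ∀ u ∈ ⋀[R]^k (Sec 𝕜 m n M A), ∀ v ∈ ⋀[R]^l (Sec 𝕜 m n M A),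
        dStar (schouten 𝔞 u v) =
          schouten 𝔞 (dStar u) v + (-1 : R) ^ (k + 1) • schouten 𝔞 u (dStar v),
      ∀ (k l : ℕ), ∀ θ ∈ ⋀[R]^k (DualSec 𝕜 m n M A),
        ∀ η ∈ ⋀[R]^l (DualSec 𝕜 m n M A),
        d (schouten 𝔟 θ η) = schouten 𝔟 (d θ) η + (-1 : R) ^ (k + 1) • schouten 𝔟 θ (d η),
      ∀ u v, Δ (u * v) = Δ u * v + u * Δ v,
      ∀ θ η, ΔStar (θ * η) = ΔStar θ * η + θ * ΔStar η,
      ∀ u, Δ u = half • Lie u,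
      ∀ θ, ΔStar θ = half • LieStar θ] ∧
    ((∀ (k l : ℕ), ∀ u ∈ ⋀[R]^k (Sec 𝕜 m n M A), ∀ v ∈ ⋀[R]^l (Sec 𝕜 m n M A),
        dStar (schouten 𝔞 u v) =
          schouten 𝔞 (dStar u) v + (-1 : R) ^ (k + 1) • schouten 𝔞 u (dStar v)) →
      ∀ (u : Sec 𝕜 m n M A) (θ : DualSec 𝕜 m n M A),
        ΔStar (algebraMap R _ (B u θ)) =
          algebraMap R _ (pair B (ExteriorAlgebra.ι R u) (ΔStar (ExteriorAlgebra.ι R θ)) +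
            pair B (Δ (ExteriorAlgebra.ι R u)) (ExteriorAlgebra.ι R θ))) ∧
    List.TFAE [
      ∀ (u : Sec 𝕜 m n M A) (θ : DualSec 𝕜 m n M A),
        ΔStar (algebraMap R _ (B u θ)) =
          algebraMap R _ (pair B (ExteriorAlgebra.ι R u) (ΔStar (ExteriorAlgebra.ι R θ)) +
            pair B (Δ (ExteriorAlgebra.ι R u)) (ExteriorAlgebra.ι R θ)),
      ∀ (u : Sec 𝕜 m n M A) (θ : DualSec 𝕜 m n M A),
        Δ (algebraMap R _ (B u θ)) =
          algebraMap R _ (pair B (ExteriorAlgebra.ι R u) (ΔStar (ExteriorAlgebra.ι R θ)) +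
            pair B (Δ (ExteriorAlgebra.ι R u)) (ExteriorAlgebra.ι R θ)),
      ∀ (u : Sec 𝕜 m n M A) (θ : DualSec 𝕜 m n M A),
        ∃ T : DualSec 𝕜 m n M A →ₗ[R] DualSec 𝕜 m n M A,
          (∀ α, ExteriorAlgebra.ι R (T α) = dorfmanDefect 𝔞 𝔟 B u θ (ExteriorAlgebra.ι R α)) ∧
          HasDualTrace T (2 * pair B (dStar (ExteriorAlgebra.ι R u)) (d (ExteriorAlgebra.ι R θ))),
      ∀ (θ : DualSec 𝕜 m n M A) (u : Sec 𝕜 m n M A),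
        ∃ T : Sec 𝕜 m n M A →ₗ[R] Sec 𝕜 m n M A,
          (∀ x, ExteriorAlgebra.ι R (T x) =
            dorfmanDefect 𝔟 𝔞 B.flip θ u (ExteriorAlgebra.ι R x)) ∧
          HasTrace T (2 * pair B.flip (d (ExteriorAlgebra.ι R θ)) (dStar (ExteriorAlgebra.ι R u))),
      (∀ f : R, Δ (algebraMap R _ f) = half • Lie (algebraMap R _ f)) ∧
        ∀ u : Sec 𝕜 m n M A,
          Δ (ExteriorAlgebra.ι R u) = half • Lie (ExteriorAlgebra.ι R u),
      (∀ f : R, ΔStar (algebraMap R _ f) = half • LieStar (algebraMap R _ f)) ∧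
        ∀ θ : DualSec 𝕜 m n M A,
          ΔStar (ExteriorAlgebra.ι R θ) = half • LieStar (ExteriorAlgebra.ι R θ)] := by
  intro R B d dStar Δ ΔStar half Lie LieStar
  have h := isTopPair_duality hΩ hV hΩV
  have hs' := hs.smul_eq_zero
  refine ⟨h.bialgebroid_tfae 𝔞 𝔟 hs' hX₀ hξ₀, fun H => ?_, ?_⟩
  · exact h.laplacian_pairing 𝔞 𝔟 ((h.derivation_schouten_iff 𝔞 𝔟).mp H)
  · have key := h.laplacianCompatible_tfae 𝔞 𝔟 hs' hX₀ hξ₀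
    -- Traces computed in frames become fibrewise traces.
    simp only [← hasTrace_iff hV hΩV, ← hasDualTrace_iff hV hΩV] at key
    exact key
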